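/- A restricted Boltzmann machine (RBM) with $n$ visible and $k$ hidden units is the distribution $\Pr(X=x,H=h)\propto\exp(\langle x,Wh\rangle+\langle b^{(1)},x\rangle+\langle b^{(2)},h\rangle)$ on $\{\pm1\}^n\times\{\pm1\}^k$, with $W\in\mathbb R^{n\times k}$, $b^{(1)}\in\mathbb R^n$, $b^{(2)}\in\mathbb R^k$; only $X$ is observed. It is $(\lambda_1,\lambda_2)$-bounded if $\sum_j|\tanh W_{ij}|+|b^{(1)}_i|\le\lambda_1$ for every visible $i$ and $\sum_i|W_{ij}|\le\lambda_2$ for every hidden $j$. Visible nodes $i\ne j$ are (two-hop) neighbors if $j$ lies in the Markov blanket of $i$, the minimal set $S\not\ni i$ such that $X_i$ is independent of the visible units outside $S\cup\{i\}$ conditionally on $X_S$. They are $\eta$-nondegenerate two-hop neighbors if the conditional mutual information (in nats) satisfies $I(X_i;X_j\mid X_{\sim\{i,j\}})\ge\eta$, or the same with $i$ and $j$ interchanged. Write $\Lambda=\max(\lambda_2,2)$. There is an absolute constant $C\in\mathbb N$ for which the following holds. For real $\lambda_1,\lambda_2$, $\eta>0$, $\delta>0$ and $n\ge1$ put $$D=\Big\lceil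 C\,\Lambda\,\max\big(1,\log(\lambda_1\Lambda/\eta)\big)\Big\rceil ,$$ and let $m$ be any natural number with $$m\ \ge\ C\,\Lambda^{CD}\log(2n/\delta).$$ Algorithms are programs of an integer random access machine with logarithmic (bit) cost. They are given $n$, $m$, $D$, $\lceil\lambda_1\rceil$, $\lceil\lambda_2\rceil$, $\lceil1/\eta\rceil$ (the nonnegative parts are meant if $\lambda_1$ or $\lambda_2$ is negative) and $m$ samples in $\{\pm1\}^n$. If $N$ denotes the bit length of the whole input, an algorithm is said to be fast if on every such input it halts in time at most $C\,(n^D\,N)^C$. 1. (Testing.) There is one fast program, not depending on any of the parameters, which is also given two distinct visible nodes $i\neq j$ and decides whether to reject the hypothesis $H_0$ that $i,j$ are not two-hop neighbors, against the hypothesis $H_1$ that $i,j$ are $\eta$-nondegenerate two-hop neighbors. For all parameters as above there are $\alpha,\beta\ge0$ with $\alpha+\beta\le\delta$ such that, on $m$ i.i.d. samples of the visible units of any $(\lambda_1,\lambda_2)$-bounded RBM with $n$ visible units, it rejects with probability at most $\alpha$ if $H_0$ holds (Type I error), and fails to reject with probability at most $\beta$ if $H_1$ holds (Type II error). 2. (Structure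 recovery.) There is one fast program, not depending on any of the parameters, which on $m$ i.i.d. samples of the visible units of any $(\lambda_1,\lambda_2)$-bounded RBM with $n$ visible units, all of whose two-hop neighbors are $\eta$-nondegenerate, outputs with probability at least $1-\delta$ exactly the set of all pairs of distinct two-hop neighbors. -/

import Mathlib

open MeasureTheory

/-! ### Restricted Boltzmann machines -/

/-- A spin configuration is a function into `Bool`; `true` is the spin `+1`, `false` is `-1`. -/
def spin (b : Bool) : ℤ := if b then 1 else -1

/-- A restricted Boltzmann machine with `n` visible and `k` hidden units: the weight matrix and
the external fields on the visible and on the hidden units. -/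
structure RBM (n k : ℕ) where
  W : Matrix (Fin n) (Fin k) ℝ
  b₁ : Fin n → ℝ
  b₂ : Fin k → ℝ

namespace RBM

variable {n k : ℕ} (R : RBM n k)

/-- The unnormalized weight `exp (xᵀ W h + ⟨b₁, x⟩ + ⟨b₂, h⟩)`. -/
noncomputable def weight (x : Fin n → Bool) (h : Fin k → Bool) : ℝ :=
  Real.exp ((∑ i, ∑ j, R.W i j * (spin (x i) : ℝ) * (spin (h j) : ℝ))
    + (∑ i, R.b₁ i * (spin (x i) : ℝ)) + ∑ j, R.b₂ j * (spin (h j) : ℝ))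

/-- The normalizing constant. -/
noncomputable def partitionFunction : ℝ :=
  ∑ x : Fin n → Bool, ∑ h : Fin k → Bool, R.weight x h

/-- The probability of a visible configuration (the hidden units are summed out). -/
noncomputable def prob (x : Fin n → Bool) : ℝ :=
  (∑ h : Fin k → Bool, R.weight x h) / R.partitionFunction

theorem weight_pos (x : Fin n → Bool) (h : Fin k → Bool) : 0 < R.weight x h :=
  Real.exp_pos _

theorem partitionFunction_pos : 0 < R.partitionFunction :=
  Finset.sum_pos (fun x _ => Finset.sum_pos (fun h _ => R.weight_pos x h)
    Finset.univ_nonempty) Finset.univ_nonempty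

theorem prob_pos (x : Fin n → Bool) : 0 < R.prob x :=
  div_pos (Finset.sum_pos (fun h _ => R.weight_pos x h) Finset.univ_nonempty)
    R.partitionFunction_pos

theorem sum_prob : ∑ x, R.prob x = 1 := by
  unfold prob
  rw [← Finset.sum_div]
  exact div_self R.partitionFunction_pos.ne'

/-- The law of the vector `X` of visible units. -/
noncomputable def law : PMF (Fin n → Bool) :=
  PMF.ofFintype (fun x => ENNReal.ofReal (R.prob x)) (by
    rw [← ENNReal.ofReal_sum_of_nonneg fun x _ => (R.prob_pos x).le, R.sum_prob,
      ENNReal.ofReal_one])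

/-- The law of `m` independent samples of the vector of visible units. -/
noncomputable def sampleLaw (m : ℕ) : Measure (Fin m → Fin n → Bool) :=
  Measure.pi fun _ => R.law.toMeasure

/-- The marginal probability `P(X_S = x_S)`. -/
noncomputable def marginal (S : Finset (Fin n)) (x : Fin n → Bool) : ℝ :=
  ∑ y : Fin n → Bool with ∀ v ∈ S, y v = x v, R.prob y

/-- `(lam₁, lam₂)`-bounded machines. -/
def IsBounded (lam₁ lam₂ : ℝ) : Prop :=
  (∀ i, (∑ j, |Real.tanh (R.W i j)|) + |R.b₁ i| ≤ lam₁) ∧ ∀ j, ∑ i, |R.W i j| ≤ lam₂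

/-- `S` does not contain `i`, and `X_i` is independent of the remaining visible units (those
outside `S` and different from `i`) conditionally on `X_S`, that is,
`P(x) P(x_S) = P(x_i, x_S) P(x_{∼ i})` for every `x`. -/
def Separates (i : Fin n) (S : Finset (Fin n)) : Prop :=
  i ∉ S ∧ ∀ x, R.prob x * R.marginal S x =
    R.marginal (insert i S) x * R.marginal (Finset.univ.erase i) x

/-- `S` is the Markov blanket of `i`: a minimal separating set. (The law is positive, so that
there is exactly one.) -/
def IsMarkovBlanket (i : Fin n) (S : Finset (Fin n)) : Prop :=
  Minimal (R.Separates i) S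

/-- `i` and `j` are (two-hop) neighbors: `j` belongs to the Markov blanket of `i`. -/
def TwoHopNeighbors (i j : Fin n) : Prop :=
  ∃ S, R.IsMarkovBlanket i S ∧ j ∈ S

/-- The conditional mutual information `I(X_i; X_j | X_{∼ {i, j}})`, in nats. -/
noncomputable def condMutualInfo (i j : Fin n) : ℝ :=
  ∑ x, R.prob x * Real.log
    (R.prob x * R.marginal ((Finset.univ.erase i).erase j) x /
      (R.marginal (Finset.univ.erase j) x * R.marginal (Finset.univ.erase i) x))

/-- `i` and `j` are `η`-nondegenerate two-hop neighbors. -/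
def Nondegenerate (η : ℝ) (i j : Fin n) : Prop :=
  η ≤ R.condMutualInfo i j ∨ η ≤ R.condMutualInfo j i

end RBM

/-! ### Programs of a random access machine, with logarithmic (bit) cost -/

namespace RAM

/-- The memory: cells indexed by natural numbers, each holding an integer. -/
abbrev Memory := ℕ → ℤ

/-- The number of bits charged for an integer (at least `1`). -/
def bitLen (z : ℤ) : ℕ := 1 + Nat.size z.natAbs

/-- Arithmetic expressions with indirect addressing; `load a` is the content of the cell whose
address is the value of `a`, and `div` is integer division. -/
inductive Expr where
  | const (z : ℤ)
  | load (a : Expr)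
  | add (a b : Expr)
  | sub (a b : Expr)
  | mul (a b : Expr)
  | div (a b : Expr)

namespace Expr

/-- The value of an expression. -/
def eval (σ : Memory) : Expr → ℤ
  | const z => z
  | load a => σ (a.eval σ).toNat
  | add a b => a.eval σ + b.eval σ
  | sub a b => a.eval σ - b.eval σ
  | mul a b => a.eval σ * b.eval σ
  | div a b => a.eval σ / b.eval σ

/-- The time for evaluating an expression: every operation is charged the total bit length of
its operands, and a memory access is charged the bit lengths of the address and the content. -/
def cost (σ : Memory) : Expr → ℕ
  | const z => bitLen z
  | load a => a.cost σ + bitLen (a.eval σ) + bitLen (σ (a.eval σ).toNat)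
  | add a b => a.cost σ + b.cost σ + bitLen (a.eval σ) + bitLen (b.eval σ)
  | sub a b => a.cost σ + b.cost σ + bitLen (a.eval σ) + bitLen (b.eval σ)
  | mul a b => a.cost σ + b.cost σ + bitLen (a.eval σ) + bitLen (b.eval σ)
  | div a b => a.cost σ + b.cost σ + bitLen (a.eval σ) + bitLen (b.eval σ)

end Expr

/-- Programs. A condition `c` counts as satisfied when its value is positive. -/
inductive Program where
  | skip
  | store (a e : Expr)
  | seq (p q : Program)
  | ite (c : Expr) (p q : Program)
  | while (c : Expr) (p : Program)

/-- `Exec p σ t σ'`: started in the memory `σ`, the program `p` halts after time `t` in the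
memory `σ'`. -/
inductive Exec : Program → Memory → ℕ → Memory → Prop
  | skip (σ : Memory) : Exec Program.skip σ 1 σ
  | store (a e : Expr) (σ : Memory) :
      Exec (Program.store a e) σ
        (a.cost σ + e.cost σ + bitLen (a.eval σ) + bitLen (e.eval σ))
        (Function.update σ (a.eval σ).toNat (e.eval σ))
  | seq {p q : Program} {σ σ' σ'' : Memory} {t t' : ℕ} :
      Exec p σ t σ' → Exec q σ' t' σ'' → Exec (Program.seq p q) σ (t + t') σ''
  | ite_pos {c : Expr} {p q : Program} {σ σ' : Memory} {t : ℕ} :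
      0 < c.eval σ → Exec p σ t σ' → Exec (Program.ite c p q) σ (c.cost σ + t) σ'
  | ite_neg {c : Expr} {p q : Program} {σ σ' : Memory} {t : ℕ} :
      c.eval σ ≤ 0 → Exec q σ t σ' → Exec (Program.ite c p q) σ (c.cost σ + t) σ'
  | while_pos {c : Expr} {p : Program} {σ σ' σ'' : Memory} {t t' : ℕ} :
      0 < c.eval σ → Exec p σ t σ' → Exec (Program.while c p) σ' t' σ'' →
        Exec (Program.while c p) σ (c.cost σ + t + t') σ''
  | while_neg {c : Expr} {p : Program} {σ : Memory} :
      c.eval σ ≤ 0 → Exec (Program.while c p) σ (c.cost σ) σ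

/-- The initial memory: the input occupies the first cells, all other cells hold `0`. -/
def initial (input : List ℤ) : Memory := fun a => input.getD a 0

/-- The bit length of an input. -/
def inputSize (input : List ℤ) : ℕ := (input.map bitLen).sum

/-- On the given input, `p` halts within time `T`, in a memory with the property `Q`. -/
def HaltsWithin (p : Program) (input : List ℤ) (T : ℕ) (Q : Memory → Prop) : Prop :=
  ∃ t σ, t ≤ T ∧ Exec p (initial input) t σ ∧ Q σ

end RAM

/-! ### The quantities in the theorem -/

/-- The samples as a list of `±1`, one sample after the other. -/
def encodeSamples {n m : ℕ} (x : Fin m → Fin n → Bool) : List ℤ :=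
  (List.ofFn fun a => List.ofFn fun v => spin (x a v)).flatten

/-- The degree `D = ⌈C λ₂ log (λ₁ λ₂ / η)⌉`, where `λ₂` is read as `max λ₂ 2` and the logarithm
as `max 1 (log ·)`. -/
noncomputable def degree (C : ℕ) (lam₁ lam₂ η : ℝ) : ℕ :=
  ⌈C * max lam₂ 2 * max 1 (Real.log (lam₁ * max lam₂ 2 / η))⌉₊

/-- The number `C λ₂ ^ (C D) log (2 n / δ)` of samples, where `λ₂` is read as `max λ₂ 2`. -/
noncomputable def sampleBound (C D n : ℕ) (lam₂ δ : ℝ) : ℝ :=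
  C * max lam₂ 2 ^ (C * D) * Real.log (2 * n / δ)

/-- What an algorithm is told about the model class: the degree, and the parameters
`λ₁`, `λ₂`, `1 / η` rounded up to integers. -/
noncomputable def encodeParameters (D : ℕ) (lam₁ lam₂ η : ℝ) : List ℤ :=
  [(D : ℤ), (⌈lam₁⌉₊ : ℤ), (⌈lam₂⌉₊ : ℤ), (⌈1 / η⌉₊ : ℤ)]

/-- The input of a test for a pair of visible nodes. -/
noncomputable def testInput {n m : ℕ} (D : ℕ) (lam₁ lam₂ η : ℝ) (i j : Fin n)
    (x : Fin m → Fin n → Bool) : List ℤ :=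
  [(n : ℤ), (m : ℤ), (i : ℤ), (j : ℤ)] ++ encodeParameters D lam₁ lam₂ η ++ encodeSamples x

/-- The input of a structure recovery algorithm. -/
noncomputable def recoveryInput {n m : ℕ} (D : ℕ) (lam₁ lam₂ η : ℝ)
    (x : Fin m → Fin n → Bool) : List ℤ :=
  [(n : ℤ), (m : ℤ)] ++ encodeParameters D lam₁ lam₂ η ++ encodeSamples x

/-- A bound polynomial in `n ^ D` and in the bit length of the input. -/
def timeBound (C D n : ℕ) (input : List ℤ) : ℕ :=
  C * (n ^ D * RAM.inputSize input) ^ C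

/-! ### A structured language compiled to random access programs -/

namespace RAM

theorem bitLen_pos (z : ℤ) : 1 ≤ bitLen z := by unfold bitLen; omega

theorem bitLen_le_bitLen {z w : ℤ} (h : |z| ≤ |w|) : bitLen z ≤ bitLen w := by
  unfold bitLen
  rw [Int.abs_eq_natAbs, Int.abs_eq_natAbs] at h
  have : z.natAbs ≤ w.natAbs := by omega
  have := Nat.size_le_size this
  omega

theorem bitLen_le_iff {z : ℤ} {k : ℕ} : bitLen z ≤ k + 1 ↔ |z| < 2 ^ k := by
  unfold bitLen
  rw [add_comm 1, Nat.add_le_add_iff_right, Nat.size_le]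
  zify

theorem bitLen_add_le (z w : ℤ) : bitLen (z + w) ≤ bitLen z + bitLen w := by
  unfold bitLen
  have h1 := Nat.lt_size_self z.natAbs
  have h2 := Nat.lt_size_self w.natAbs
  have h : (z + w).natAbs.size ≤ z.natAbs.size + w.natAbs.size + 1 := by
    rw [Nat.size_le]
    have h3 : 2 ^ z.natAbs.size ≤ 2 ^ (z.natAbs.size + w.natAbs.size) :=
      Nat.pow_le_pow_right (by norm_num) (by omega)
    have h4 : 2 ^ w.natAbs.size ≤ 2 ^ (z.natAbs.size + w.natAbs.size) :=
      Nat.pow_le_pow_right (by norm_num) (by omega)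
    have := Int.natAbs_add_le z w
    rw [pow_succ]; omega
  omega

theorem bitLen_sub_le (z w : ℤ) : bitLen (z - w) ≤ bitLen z + bitLen w := by
  have h := bitLen_add_le z (-w)
  have : bitLen (-w) = bitLen w := by simp [bitLen]
  rwa [this, ← sub_eq_add_neg] at h

theorem bitLen_mul_le (z w : ℤ) : bitLen (z * w) ≤ bitLen z + bitLen w := by
  unfold bitLen
  have h1 := Nat.lt_size_self z.natAbs
  have h2 := Nat.lt_size_self w.natAbs
  have h : (z * w).natAbs.size ≤ z.natAbs.size + w.natAbs.size := by
    rw [Nat.size_le, Int.natAbs_mul, pow_add]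
    exact Nat.mul_lt_mul'' h1 h2
  omega

theorem abs_ediv_le_abs_self (z w : ℤ) : |z / w| ≤ |z| := by
  have := Int.natAbs_ediv_le_natAbs z w
  rw [Int.abs_eq_natAbs, Int.abs_eq_natAbs]
  omega

theorem bitLen_div_le (z w : ℤ) : bitLen (z / w) ≤ bitLen z + bitLen w :=
  (bitLen_le_bitLen (abs_ediv_le_abs_self z w)).trans (Nat.le_add_right _ _)

namespace Expr

/-- The growth of the bit length in an expression. -/
def growth : Expr → ℕ
  | const z => bitLen z
  | load _ => 1
  | add a b => a.growth + b.growth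
  | sub a b => a.growth + b.growth
  | mul a b => a.growth + b.growth
  | div a b => a.growth + b.growth

/-- The cost of an expression in memories of unit bit length. -/
def unitCost : Expr → ℕ
  | const z => bitLen z
  | load a => a.unitCost + a.growth + 1
  | add a b => a.unitCost + b.unitCost + a.growth + b.growth
  | sub a b => a.unitCost + b.unitCost + a.growth + b.growth
  | mul a b => a.unitCost + b.unitCost + a.growth + b.growth
  | div a b => a.unitCost + b.unitCost + a.growth + b.growth

theorem bitLen_eval_le {σ : Memory} {Y : ℕ} (h1 : 1 ≤ Y) (h : ∀ c, bitLen (σ c) ≤ Y) (e : Expr) :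
    bitLen (e.eval σ) ≤ e.growth * Y := by
  induction e with
  | const z => exact Nat.le_mul_of_pos_right _ h1
  | load a _ => simpa [eval, growth] using h _
  | add a b iha ihb => exact (bitLen_add_le _ _).trans (by rw [growth, add_mul]; omega)
  | sub a b iha ihb => exact (bitLen_sub_le _ _).trans (by rw [growth, add_mul]; omega)
  | mul a b iha ihb => exact (bitLen_mul_le _ _).trans (by rw [growth, add_mul]; omega)
  | div a b iha ihb => exact (bitLen_div_le _ _).trans (by rw [growth, add_mul]; omega)

theorem cost_le {σ : Memory} {Y : ℕ} (h1 : 1 ≤ Y) (h : ∀ c, bitLen (σ c) ≤ Y) (e : Expr) :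
    e.cost σ ≤ e.unitCost * Y := by
  have hb := bitLen_eval_le h1 h
  induction e with
  | const z => exact Nat.le_mul_of_pos_right _ h1
  | load a iha =>
    have := hb a; have := h (a.eval σ).toNat
    simp only [cost, unitCost, add_mul]; omega
  | add a b iha ihb =>
    have := hb a; have := hb b; simp only [cost, unitCost, add_mul]; omega
  | sub a b iha ihb =>
    have := hb a; have := hb b; simp only [cost, unitCost, add_mul]; omega
  | mul a b iha ihb =>
    have := hb a; have := hb b; simp only [cost, unitCost, add_mul]; omega
  | div a b iha ihb =>
    have := hb a; have := hb b; simp only [cost, unitCost, add_mul]; omega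

end Expr

/-- The cost of an assignment in memories of unit bit length. -/
def storeCost (a e : Expr) : ℕ := a.unitCost + e.unitCost + a.growth + e.growth

theorem exec_store {σ : Memory} {Y : ℕ} (h1 : 1 ≤ Y) (h : ∀ c, bitLen (σ c) ≤ Y) (a e : Expr) :
    ∃ t ≤ storeCost a e * Y, Exec (Program.store a e) σ t
      (Function.update σ (a.eval σ).toNat (e.eval σ)) := by
  refine ⟨_, ?_, Exec.store a e σ⟩
  have := Expr.cost_le h1 h a
  have := Expr.cost_le h1 h e
  have := Expr.bitLen_eval_le h1 h a
  have := Expr.bitLen_eval_le h1 h e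
  simp only [storeCost, add_mul]; omega

/-- A state of the structured language: registers and arrays. -/
structure State where
  reg : ℕ → ℤ
  arr : ℕ → ℕ → ℤ

namespace State

/-- Assignment to a register. -/
def set (s : State) (r : ℕ) (z : ℤ) : State := { s with reg := Function.update s.reg r z }

/-- Assignment to an array element. -/
def put (s : State) (j k : ℕ) (z : ℤ) : State :=
  { s with arr := Function.update s.arr j (Function.update (s.arr j) k z) }

@[simp] theorem set_reg (s : State) (r q : ℕ) (z : ℤ) :
    (s.set r z).reg q = if q = r then z else s.reg q := by
  simp [set, Function.update_apply]

@[simp] theorem set_arr (s : State) (r : ℕ) (z : ℤ) : (s.set r z).arr = s.arr := rfl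

@[simp] theorem put_reg (s : State) (j k : ℕ) (z : ℤ) : (s.put j k z).reg = s.reg := rfl

@[simp] theorem put_arr (s : State) (j k i l : ℕ) (z : ℤ) :
    (s.put j k z).arr i l = if i = j ∧ l = k then z else s.arr i l := by
  by_cases h : i = j
  · subst h; simp [put, Function.update_apply]
  · simp [put, h]

end State

/-- Expressions over registers, arrays, and the input. -/
inductive Term where
  | const (z : ℤ)
  | reg (r : ℕ)
  | arr (j : ℕ) (a : Term)
  | inp (a : Term)
  | add (a b : Term)
  | sub (a b : Term)
  | mul (a b : Term)
  | div (a b : Term)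

namespace Term

/-- The value of a term. -/
def eval (I : ℕ → ℤ) (s : State) : Term → ℤ
  | const z => z
  | reg r => s.reg r
  | arr j a => s.arr j (a.eval I s).toNat
  | inp a => I (a.eval I s).toNat
  | add a b => a.eval I s + b.eval I s
  | sub a b => a.eval I s - b.eval I s
  | mul a b => a.eval I s * b.eval I s
  | div a b => a.eval I s / b.eval I s

/-- All registers, arrays, and addresses occurring in the term exist. -/
def Safe (P : ℕ) (I : ℕ → ℤ) (s : State) : Term → Prop
  | const _ => True
  | reg r => r < 32
  | arr j a => j < 8 ∧ 0 ≤ a.eval I s ∧ a.Safe P I s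
  | inp a => (a.eval I s).toNat < P ∧ a.Safe P I s
  | add a b => a.Safe P I s ∧ b.Safe P I s
  | sub a b => a.Safe P I s ∧ b.Safe P I s
  | mul a b => a.Safe P I s ∧ b.Safe P I s
  | div a b => a.Safe P I s ∧ b.Safe P I s

end Term

/-- The address `P + c`, where `P` is stored in the cell `β`. -/
def offset (β c : ℕ) : Expr := .add (.load (.const β)) (.const c)

/-- The address of an array element. -/
def arrAddress (β j : ℕ) (a : Expr) : Expr := .add (offset β (64 + j)) (.mul (.const 8) a)

/-- Compilation of terms. -/
def Term.compile (β : ℕ) : Term → Expr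
  | const z => .const z
  | reg r => .load (offset β r)
  | arr j a => .load (arrAddress β j (a.compile β))
  | inp a => .load (a.compile β)
  | add a b => .add (a.compile β) (b.compile β)
  | sub a b => .sub (a.compile β) (b.compile β)
  | mul a b => .mul (a.compile β) (b.compile β)
  | div a b => .div (a.compile β) (b.compile β)

/-- The memory `σ` represents the state `s`: the input is below the address `P`, which is stored
in the cell `β`, followed by the registers, the limits of the loops, and the arrays. -/
structure Rep (β P : ℕ) (I : ℕ → ℤ) (σ : Memory) (s : State) : Prop where
  lt : β < P
  ptr : σ β = P
  inp : ∀ k < P, σ k = I k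
  reg : ∀ r < 32, σ (P + r) = s.reg r
  arr : ∀ j < 8, ∀ k, σ (P + 64 + j + 8 * k) = s.arr j k

section

variable {β P : ℕ} {I : ℕ → ℤ} {σ : Memory} {s : State}

theorem Rep.eval_offset (h : Rep β P I σ s) (c : ℕ) :
    ((offset β c).eval σ).toNat = P + c := by
  simp only [offset, Expr.eval, Int.toNat_natCast, h.ptr]; omega

theorem Rep.eval_arrAddress (h : Rep β P I σ s) (j : ℕ) {a : Expr} (ha : 0 ≤ a.eval σ) :
    ((arrAddress β j a).eval σ).toNat = P + 64 + j + 8 * (a.eval σ).toNat := by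
  simp only [arrAddress, offset, Expr.eval, Int.toNat_natCast, h.ptr]; omega

theorem Rep.eval_compile (h : Rep β P I σ s) {e : Term} (he : e.Safe P I s) :
    (e.compile β).eval σ = e.eval I s := by
  induction e with
  | const z => rfl
  | reg r =>
    simp only [Term.compile, Expr.eval, Term.eval, h.eval_offset]
    exact h.reg r he
  | arr j a ih =>
    obtain ⟨hj, h0, ha⟩ := he
    have := ih ha
    simp only [Term.compile, Expr.eval, Term.eval]
    rw [h.eval_arrAddress j (by rw [this]; exact h0), this]
    exact h.arr j hj _
  | inp a ih =>
    simp only [Term.compile, Expr.eval, Term.eval, ih he.2]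
    exact h.inp _ he.1
  | add a b iha ihb => simp only [Term.compile, Expr.eval, Term.eval, iha he.1, ihb he.2]
  | sub a b iha ihb => simp only [Term.compile, Expr.eval, Term.eval, iha he.1, ihb he.2]
  | mul a b iha ihb => simp only [Term.compile, Expr.eval, Term.eval, iha he.1, ihb he.2]
  | div a b iha ihb => simp only [Term.compile, Expr.eval, Term.eval, iha he.1, ihb he.2]

theorem Rep.set (h : Rep β P I σ s) {r : ℕ} (hr : r < 32) (z : ℤ) :
    Rep β P I (Function.update σ (P + r) z) (s.set r z) where
  lt := h.lt
  ptr := by rw [Function.update_of_ne (by have := h.lt; omega), h.ptr]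
  inp k hk := by rw [Function.update_of_ne (by omega), h.inp k hk]
  reg q hq := by
    rw [Function.update_apply, State.set_reg, h.reg q hq]; simp
  arr j hj k := by rw [Function.update_of_ne (by omega), h.arr j hj k]; rfl

theorem Rep.limit (h : Rep β P I σ s) {r : ℕ} (hr : r < 32) (z : ℤ) :
    Rep β P I (Function.update σ (P + (32 + r)) z) s where
  lt := h.lt
  ptr := by rw [Function.update_of_ne (by have := h.lt; omega), h.ptr]
  inp k hk := by rw [Function.update_of_ne (by omega), h.inp k hk]
  reg q hq := by rw [Function.update_of_ne (by omega), h.reg q hq]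
  arr j hj k := by rw [Function.update_of_ne (by omega), h.arr j hj k]

theorem Rep.put (h : Rep β P I σ s) {j : ℕ} (hj : j < 8) (k : ℕ) (z : ℤ) :
    Rep β P I (Function.update σ (P + 64 + j + 8 * k) z) (s.put j k z) where
  lt := h.lt
  ptr := by rw [Function.update_of_ne (by have := h.lt; omega), h.ptr]
  inp k hk := by rw [Function.update_of_ne (by omega), h.inp k hk]
  reg q hq := by rw [Function.update_of_ne (by omega), h.reg q hq]; rfl
  arr i hi l := by
    rw [Function.update_apply, State.put_arr, h.arr i hi l]
    congr 1
    apply propext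
    omega

end

/-- Commands. In `loop r e p` the register `r` runs through `0, …, e - 1`. -/
inductive Cmd where
  | skip
  | set (r : ℕ) (e : Term)
  | put (j : ℕ) (a e : Term)
  | seq (p q : Cmd)
  | ite (c : Term) (p q : Cmd)
  | loop (r : ℕ) (e : Term) (p : Cmd)

namespace Cmd

/-- Compilation of commands. -/
def compile (β : ℕ) : Cmd → Program
  | skip => .skip
  | set r e => .store (offset β r) (e.compile β)
  | put j a e => .store (arrAddress β j (a.compile β)) (e.compile β)
  | seq p q => .seq (p.compile β) (q.compile β)
  | ite c p q => .ite (c.compile β) (p.compile β) (q.compile β)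
  | loop r e p =>
      .seq (.store (offset β (32 + r)) (e.compile β)) <|
      .seq (.store (offset β r) (.const 0)) <|
      .while (.sub (.load (offset β (32 + r))) (.load (offset β r))) <|
      .seq (p.compile β) (.store (offset β r) (.add (.load (offset β r)) (.const 1)))

/-- The registers that a command may change. -/
def regs : Cmd → List ℕ
  | skip => []
  | set r _ => [r]
  | put _ _ _ => []
  | seq p q => p.regs ++ q.regs
  | ite _ p q => p.regs ++ q.regs
  | loop r _ p => r :: p.regs

/-- The arrays that a command may change. -/
def arrs : Cmd → List ℕ
  | skip => []
  | set _ _ => []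
  | put j _ _ => [j]
  | seq p q => p.arrs ++ q.arrs
  | ite _ p q => p.arrs ++ q.arrs
  | loop _ _ p => p.arrs

/-- A bound for the running time when all values have bit length at most `Y` and all loops are
executed at most `X` times. -/
def time (β Y X : ℕ) : Cmd → ℕ
  | skip => 1
  | set r e => storeCost (offset β r) (e.compile β) * Y
  | put j a e => storeCost (arrAddress β j (a.compile β)) (e.compile β) * Y
  | seq p q => p.time β Y X + q.time β Y X
  | ite c p q => (c.compile β).unitCost * Y + (p.time β Y X + q.time β Y X)
  | loop r e p =>
      storeCost (offset β (32 + r)) (e.compile β) * Y +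
      (storeCost (offset β r) (.const 0) * Y +
      ((Expr.sub (.load (offset β (32 + r))) (.load (offset β r))).unitCost * Y + X *
        ((Expr.sub (.load (offset β (32 + r))) (.load (offset β r))).unitCost * Y + (p.time β Y X +
          storeCost (offset β r) (.add (.load (offset β r)) (.const 1)) * Y))))

theorem exists_time_le (β : ℕ) (p : Cmd) :
    ∃ c d : ℕ, ∀ Y X, 1 ≤ Y → 1 ≤ X → p.time β Y X ≤ c * Y * X ^ d := by
  induction p with
  | skip => exact ⟨1, 0, fun Y X hY _ => by simp [time]; omega⟩
  | set r e => exact ⟨_, 0, fun Y X hY _ => by simp only [time, pow_zero, mul_one]; exact le_rfl⟩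
  | put j a e => exact ⟨_, 0, fun Y X hY _ => by simp only [time, pow_zero, mul_one]; exact le_rfl⟩
  | seq p q ihp ihq =>
    obtain ⟨c, d, h⟩ := ihp
    obtain ⟨c', d', h'⟩ := ihq
    refine ⟨c + c', d + d', fun Y X hY hX => ?_⟩
    have h1 : c * Y * X ^ d ≤ c * Y * X ^ (d + d') := by gcongr; all_goals omega
    have h2 : c' * Y * X ^ d' ≤ c' * Y * X ^ (d + d') := by gcongr; all_goals omega
    have := h Y X hY hX
    have := h' Y X hY hX
    simp only [time, add_mul]; omega
  | ite b p q ihp ihq =>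
    obtain ⟨c, d, h⟩ := ihp
    obtain ⟨c', d', h'⟩ := ihq
    refine ⟨(b.compile β).unitCost + c + c', d + d', fun Y X hY hX => ?_⟩
    have h1 : c * Y * X ^ d ≤ c * Y * X ^ (d + d') := by gcongr; all_goals omega
    have h2 : c' * Y * X ^ d' ≤ c' * Y * X ^ (d + d') := by gcongr; all_goals omega
    have h3 : (b.compile β).unitCost * Y ≤ (b.compile β).unitCost * Y * X ^ (d + d') :=
      Nat.le_mul_of_pos_right _ (Nat.pow_pos hX)
    have := h Y X hY hX
    have := h' Y X hY hX
    simp only [time, add_mul]; omega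
  | loop r e p ih =>
    obtain ⟨c, d, h⟩ := ih
    simp only [time]
    generalize storeCost (offset β (32 + r)) (e.compile β) = k1
    generalize storeCost (offset β r) (.const 0) = k2
    generalize Expr.unitCost _ = k3
    generalize storeCost (offset β r) _ = k4
    refine ⟨k1 + k2 + k3 + k3 + c + k4, d + 1, fun Y X hY hX => ?_⟩
    have h0 : 1 ≤ X ^ (d + 1) := Nat.pow_pos hX
    have hp := Nat.mul_le_mul_left X (h Y X hY hX)
    have e1 : X * (c * Y * X ^ d) = c * Y * X ^ (d + 1) := by ring
    have h1 : ∀ k, k * Y ≤ k * Y * X ^ (d + 1) := fun k => Nat.le_mul_of_pos_right _ h0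
    have h2 : ∀ k, X * (k * Y) ≤ k * Y * X ^ (d + 1) := fun k => by
      rw [mul_comm, pow_succ']
      exact Nat.mul_le_mul_left _ (Nat.le_mul_of_pos_right _ (Nat.pow_pos hX))
    have := h1 k1; have := h1 k2; have := h1 k3; have := h2 k3; have := h2 k4
    simp only [add_mul, mul_add]; omega

/-- The weakest precondition of a command for the postcondition `Q`, including that all computed
values are at most `W` in absolute value and all loops are executed at most `X` times. -/
def wp (I : ℕ → ℤ) (P X W : ℕ) : Cmd → (State → Prop) → State → Prop
  | skip, Q, s => Q s
  | set r e, Q, s => r < 32 ∧ e.Safe P I s ∧ |e.eval I s| ≤ W ∧ Q (s.set r (e.eval I s))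
  | put j a e, Q, s => j < 8 ∧ a.Safe P I s ∧ e.Safe P I s ∧ 0 ≤ a.eval I s ∧ |e.eval I s| ≤ W ∧
      Q (s.put j (a.eval I s).toNat (e.eval I s))
  | seq p q, Q, s => p.wp I P X W (q.wp I P X W Q) s
  | ite c p q, Q, s => c.Safe P I s ∧ (0 < c.eval I s → p.wp I P X W Q s) ∧
      (c.eval I s ≤ 0 → q.wp I P X W Q s)
  | loop r e p, Q, s => ∃ Inv : ℕ → State → Prop, r < 32 ∧ r ∉ p.regs ∧ e.Safe P I s ∧
      |e.eval I s| ≤ X ∧ Inv 0 s ∧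
      (∀ k : ℕ, (k : ℤ) < e.eval I s → ∀ s', Inv k s' →
        p.wp I P X W (Inv (k + 1)) (s'.set r k)) ∧
      ∀ s', Inv (e.eval I s).toNat s' → Q (s'.set r (e.eval I s).toNat)

variable {I : ℕ → ℤ} {P X W : ℕ}

theorem wp_mono {p : Cmd} {Q Q' : State → Prop} (h : ∀ s, Q s → Q' s) {s : State}
    (hp : p.wp I P X W Q s) : p.wp I P X W Q' s := by
  induction p generalizing Q Q' s with
  | skip => exact h _ hp
  | set r e => exact ⟨hp.1, hp.2.1, hp.2.2.1, h _ hp.2.2.2⟩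
  | put j a e => exact ⟨hp.1, hp.2.1, hp.2.2.1, hp.2.2.2.1, hp.2.2.2.2.1, h _ hp.2.2.2.2.2⟩
  | seq p q ihp ihq => exact ihp (fun s => ihq h) hp
  | ite c p q ihp ihq => exact ⟨hp.1, fun hc => ihp h (hp.2.1 hc), fun hc => ihq h (hp.2.2 hc)⟩
  | loop r e p ih =>
    obtain ⟨Inv, h1, h2, h3, h4, h5, h6, h7⟩ := hp
    exact ⟨Inv, h1, h2, h3, h4, h5, h6, fun s' hs => h _ (h7 s' hs)⟩

/-- The states `s` and `s'` differ only in the registers `R` and in the arrays `A`. -/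
def Agree (R A : List ℕ) (s s' : State) : Prop :=
  (∀ r ∉ R, s'.reg r = s.reg r) ∧ ∀ j ∉ A, s'.arr j = s.arr j

theorem wp_agree {p : Cmd} {Q : State → Prop} {s : State} (hp : p.wp I P X W Q s) :
    p.wp I P X W (fun s' => Q s' ∧ Agree p.regs p.arrs s s') s := by
  induction p generalizing Q s with
  | skip => exact ⟨hp, fun _ _ => rfl, fun _ _ => rfl⟩
  | set r e =>
    refine ⟨hp.1, hp.2.1, hp.2.2.1, hp.2.2.2, fun q hq => ?_, fun _ _ => rfl⟩
    simp only [regs, List.mem_singleton] at hq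
    simp [hq]
  | put j a e =>
    refine ⟨hp.1, hp.2.1, hp.2.2.1, hp.2.2.2.1, hp.2.2.2.2.1, hp.2.2.2.2.2, fun q hq => rfl,
      fun i hi => ?_⟩
    simp only [arrs, List.mem_singleton] at hi
    funext l
    simp [hi]
  | seq p q ihp ihq =>
    change p.wp I P X W (q.wp I P X W _) s
    refine wp_mono (fun s' hs => ?_) (ihp hp)
    refine wp_mono (fun s'' hs' => ?_) (ihq hs.1)
    refine ⟨hs'.1, fun r hr => ?_, fun r hr => ?_⟩
    · simp only [regs, List.mem_append, not_or] at hr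
      rw [hs'.2.1 r hr.2, hs.2.1 r hr.1]
    · simp only [arrs, List.mem_append, not_or] at hr
      rw [hs'.2.2 r hr.2, hs.2.2 r hr.1]
  | ite c p q ihp ihq =>
    refine ⟨hp.1, fun hc => wp_mono (fun s' hs => ?_) (ihp (hp.2.1 hc)),
      fun hc => wp_mono (fun s' hs => ?_) (ihq (hp.2.2 hc))⟩
    · refine ⟨hs.1, fun r hr => ?_, fun r hr => ?_⟩
      · simp only [regs, List.mem_append, not_or] at hr
        exact hs.2.1 r hr.1
      · simp only [arrs, List.mem_append, not_or] at hr
        exact hs.2.2 r hr.1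
    · refine ⟨hs.1, fun r hr => ?_, fun r hr => ?_⟩
      · simp only [regs, List.mem_append, not_or] at hr
        exact hs.2.1 r hr.2
      · simp only [arrs, List.mem_append, not_or] at hr
        exact hs.2.2 r hr.2
  | loop r e p ih =>
    obtain ⟨Inv, h1, h2, h3, h4, h5, h6, h7⟩ := hp
    refine ⟨fun k s' => Inv k s' ∧ Agree (r :: p.regs) p.arrs s s', h1, h2, h3, h4,
      ⟨h5, fun _ _ => rfl, fun _ _ => rfl⟩, fun k hk s' hs => ?_, fun s' hs => ?_⟩
    · refine wp_mono (fun s'' hs' => ?_) (ih (h6 k hk s' hs.1))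
      refine ⟨hs'.1, fun q hq => ?_, fun q hq => ?_⟩
      · simp only [List.mem_cons, not_or] at hq
        rw [hs'.2.1 q hq.2, State.set_reg, if_neg hq.1]
        exact hs.2.1 q (by simp [hq])
      · rw [hs'.2.2 q hq]
        exact hs.2.2 q hq
    · refine ⟨h7 s' hs.1, fun q hq => ?_, hs.2.2⟩
      simp only [regs, List.mem_cons, not_or] at hq
      rw [State.set_reg, if_neg hq.1]
      exact hs.2.1 q (by simp [hq])

/-- The rule for loops: the invariant need not mention what the body does not change. -/
theorem wp_loop {r : ℕ} {e : Term} {p : Cmd} {Q : State → Prop} {s : State}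
    (Inv : ℕ → State → Prop) (h1 : r < 32) (h2 : r ∉ p.regs) (h3 : e.Safe P I s) (N : ℕ)
    (hN : e.eval I s = N) (h4 : N ≤ X) (h5 : Inv 0 s)
    (h6 : ∀ k < N, ∀ s', Agree (r :: p.regs) p.arrs s s' → Inv k s' →
      p.wp I P X W (Inv (k + 1)) (s'.set r k))
    (h7 : ∀ s', Agree (r :: p.regs) p.arrs s s' → Inv N s' → Q (s'.set r N)) :
    (loop r e p).wp I P X W Q s := by
  refine ⟨fun k s' => Inv k s' ∧ Agree (r :: p.regs) p.arrs s s', h1, h2, h3,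
      by rw [hN]; simpa using h4, ⟨h5, fun _ _ => rfl, fun _ _ => rfl⟩,
      fun k hk s' hs => ?_, fun s' hs => ?_⟩
  · have := wp_agree (h6 k (by omega) s' hs.2 hs.1)
    refine wp_mono (fun s'' hs' => ⟨hs'.1, fun q hq => ?_, fun q hq => ?_⟩) this
    · have hq' := hq
      simp only [List.mem_cons, not_or] at hq
      rw [hs'.2.1 q hq.2, State.set_reg, if_neg hq.1]
      exact hs.2.1 q hq'
    · rw [hs'.2.2 q hq]
      exact hs.2.2 q hq
  · simp only [hN, Int.toNat_natCast] at hs ⊢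
    exact h7 s' hs.2 hs.1

/-- The cells that are not touched by a command. -/
def Frame (P : ℕ) (p : Cmd) (σ σ' : Memory) : Prop :=
  ∀ r < 32, r ∉ p.regs → σ' (P + r) = σ (P + r) ∧ σ' (P + (32 + r)) = σ (P + (32 + r))

theorem bitLen_le_of_abs_le {σ : Memory} (h : ∀ c, |σ c| ≤ W) (c : ℕ) :
    bitLen (σ c) ≤ bitLen W :=
  bitLen_le_bitLen ((h c).trans (le_abs_self _))

theorem abs_update_le {σ : Memory} (h : ∀ c, |σ c| ≤ W) (a : ℕ) {z : ℤ} (hz : |z| ≤ W) (c : ℕ) :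
    |Function.update σ a z c| ≤ W := by
  rw [Function.update_apply]; split_ifs
  exacts [hz, h c]

theorem exec_of_wp {β : ℕ} (hXW : X ≤ W) {p : Cmd} {Q : State → Prop} {s : State} {σ : Memory}
    (hp : p.wp I P X W Q s) (hr : Rep β P I σ s) (hb : ∀ c, |σ c| ≤ W) :
    ∃ t σ' s', Exec (p.compile β) σ t σ' ∧ t ≤ p.time β (bitLen W) X ∧ Rep β P I σ' s' ∧
      (∀ c, |σ' c| ≤ W) ∧ Q s' ∧ Frame P p σ σ' := by
  have hY := bitLen_pos (W : ℤ)
  induction p generalizing Q s σ with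
  | skip => exact ⟨1, σ, s, .skip σ, le_rfl, hr, hb, hp, fun _ _ _ => ⟨rfl, rfl⟩⟩
  | set r e =>
    obtain ⟨h1, h2, h3, h4⟩ := hp
    obtain ⟨t, ht, hx⟩ := exec_store hY (bitLen_le_of_abs_le hb) (offset β r) (e.compile β)
    rw [hr.eval_compile h2, hr.eval_offset] at hx
    refine ⟨t, _, _, hx, ht, hr.set h1 _, abs_update_le hb _ h3, h4, fun q _ hq' => ?_⟩
    simp only [regs, List.mem_singleton] at hq'
    constructor <;> rw [Function.update_of_ne (by omega)]
  | put j a e =>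
    obtain ⟨h1, h2, h3, h4, h5, h6⟩ := hp
    obtain ⟨t, ht, hx⟩ := exec_store hY (bitLen_le_of_abs_le hb)
      (arrAddress β j (a.compile β)) (e.compile β)
    have ha := hr.eval_compile h2
    rw [hr.eval_compile h3, hr.eval_arrAddress j (by rw [ha]; exact h4), ha] at hx
    refine ⟨t, _, _, hx, ht, hr.put h1 _ _, abs_update_le hb _ h5, h6, fun q hq hq' => ?_⟩
    constructor <;> rw [Function.update_of_ne (by omega)]
  | seq p q ihp ihq =>
    obtain ⟨t, σ', s', x1, t1, r1, b1, q1, f1⟩ := ihp hp hr hb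
    obtain ⟨t', σ'', s'', x2, t2, r2, b2, q2, f2⟩ := ihq q1 r1 b1
    refine ⟨_, σ'', s'', .seq x1 x2, Nat.add_le_add t1 t2, r2, b2, q2, fun r h1 h2 => ?_⟩
    simp only [regs, List.mem_append, not_or] at h2
    have := f1 r h1 h2.1
    have := f2 r h1 h2.2
    constructor <;> simp_all
  | ite c p q ihp ihq =>
    obtain ⟨h1, h2, h3⟩ := hp
    have hc := Expr.cost_le hY (bitLen_le_of_abs_le hb) (c.compile β)
    have he := hr.eval_compile h1
    rcases lt_or_ge 0 (c.eval I s) with h | h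
    · obtain ⟨t, σ', s', x1, t1, r1, b1, q1, f1⟩ := ihp (h2 h) hr hb
      refine ⟨_, σ', s', .ite_pos (by rw [he]; exact h) x1, ?_, r1, b1, q1, fun r h1 h2 => ?_⟩
      · simp only [time]; omega
      · simp only [regs, List.mem_append, not_or] at h2
        exact f1 r h1 h2.1
    · obtain ⟨t, σ', s', x1, t1, r1, b1, q1, f1⟩ := ihq (h3 h) hr hb
      refine ⟨_, σ', s', .ite_neg (by rw [he]; exact h) x1, ?_, r1, b1, q1, fun r h1 h2 => ?_⟩
      · simp only [time]; omega
      · simp only [regs, List.mem_append, not_or] at h2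
        exact f1 r h1 h2.2
  | loop r e p ih =>
    obtain ⟨Inv, h1, h2, h3, h4, h5, h6, h7⟩ := hp
    obtain ⟨t1, ht1, x1⟩ := exec_store hY (bitLen_le_of_abs_le hb) (offset β (32 + r))
      (e.compile β)
    rw [hr.eval_compile h3, hr.eval_offset] at x1
    set v := e.eval I s with hv
    have hvW : |v| ≤ W := h4.trans (by exact_mod_cast hXW)
    have r1 := hr.limit h1 v
    have b1 := abs_update_le hb (P + (32 + r)) hvW
    obtain ⟨t2, ht2, x2⟩ := exec_store hY (bitLen_le_of_abs_le b1) (offset β r) (.const 0)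
    rw [r1.eval_offset] at x2
    have r2 := r1.set h1 0
    have b2 := abs_update_le b1 (P + r) (z := 0) (by simp)
    set c := Expr.sub (.load (offset β (32 + r))) (.load (offset β r)) with hcdef
    set inc := Expr.add (.load (offset β r)) (.const 1) with hinc
    have key : ∀ d k : ℕ, v.toNat = k + d → ∀ s' σ', Inv k s' → Rep β P I σ' (s'.set r k) →
        (∀ c, |σ' c| ≤ W) → σ' (P + (32 + r)) = v →
        ∃ t σ'' s'', Exec (.while c (.seq (p.compile β) (.store (offset β r) inc))) σ' t σ'' ∧
          t ≤ c.unitCost * bitLen W + d * (c.unitCost * bitLen W +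
            (p.time β (bitLen W) X + storeCost (offset β r) inc * bitLen W)) ∧
          Rep β P I σ'' (s''.set r v.toNat) ∧ (∀ c, |σ'' c| ≤ W) ∧ Inv v.toNat s'' ∧
          Frame P (loop r e p) σ' σ'' := by
      intro d
      induction d with
      | zero =>
        intro k hk s' σ' hs hr' hb' hl
        have hc : c.eval σ' = v - k := by
          simp only [hcdef, Expr.eval, hr'.eval_offset, hl, hr'.reg r h1]; simp
        refine ⟨_, σ', s', .while_neg (by rw [hc]; omega), ?_, ?_, hb', ?_,
          fun _ _ _ => ⟨rfl, rfl⟩⟩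
        · rw [zero_mul, add_zero]
          exact Expr.cost_le hY (bitLen_le_of_abs_le hb') c
        · rw [hk]; exact hr'
        · rw [hk]; exact hs
      | succ d ihd =>
        intro k hk s' σ' hs hr' hb' hl
        have hc : c.eval σ' = v - k := by
          simp only [hcdef, Expr.eval, hr'.eval_offset, hl, hr'.reg r h1]; simp
        have hcc := Expr.cost_le hY (bitLen_le_of_abs_le hb') c
        obtain ⟨ta, σa, sa, xa, hta, ra, ba, qa, fa⟩ := ih (h6 k (by omega) s' hs) hr' hb'
        obtain ⟨fr, fl⟩ := fa r h1 h2
        have hrk : σa (P + r) = k := by rw [fr, hr'.reg r h1]; simp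
        obtain ⟨tb, htb, xb⟩ := exec_store hY (bitLen_le_of_abs_le ba) (offset β r) inc
        have hie : inc.eval σa = ((k + 1 : ℕ) : ℤ) := by
          simp only [hinc, Expr.eval, ra.eval_offset, hrk]; push_cast; rfl
        rw [hie, ra.eval_offset] at xb
        have hX : ((k + 1 : ℕ) : ℤ) ≤ v := by omega
        obtain ⟨tc, σc, sc, xc, htc, rc, bc, ic, fc⟩ := ihd (k + 1) (by omega) sa _ qa
          (ra.set h1 _) (abs_update_le ba (P + r) (z := ((k + 1 : ℕ) : ℤ))
            (by rw [abs_of_nonneg (by positivity)]; exact hX.trans ((le_abs_self v).trans hvW)))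
          (by rw [Function.update_of_ne (by omega), fl, hl])
        refine ⟨_, σc, sc, .while_pos (by rw [hc]; omega) (.seq xa xb) xc, ?_, rc, bc, ic,
          fun q hq hq' => ?_⟩
        · rw [add_mul d 1, one_mul]; omega
        · have := fc q hq hq'
          simp only [regs, List.mem_cons, not_or] at hq'
          have := fa q hq hq'.2
          rw [Function.update_of_ne (by omega), Function.update_of_ne (by omega)] at *
          constructor <;> simp_all
    obtain ⟨t3, σ3, s3, x3, ht3, r3, b3, i3, f3⟩ := key v.toNat 0 (by simp) s _ h5
      (by simpa using r2) b2 (by rw [Function.update_of_ne (by omega), Function.update_self])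
    refine ⟨_, σ3, _, .seq x1 (.seq x2 x3), ?_, r3, b3, h7 s3 i3, fun q hq hq' => ?_⟩
    · have : v.toNat * (c.unitCost * bitLen W +
            (p.time β (bitLen W) X + storeCost (offset β r) inc * bitLen W)) ≤
          X * (c.unitCost * bitLen W +
            (p.time β (bitLen W) X + storeCost (offset β r) inc * bitLen W)) :=
        Nat.mul_le_mul_right _ (by have := le_abs_self v; omega)
      simp only [time]
      rw [← hcdef, ← hinc]
      omega
    · have := f3 q hq hq'
      simp only [regs, List.mem_cons, not_or] at hq'
      rw [Function.update_of_ne (by omega), Function.update_of_ne (by omega),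
        Function.update_of_ne (by omega), Function.update_of_ne (by omega)] at this
      exact this

end Cmd

end RAM

/-! ### The programs -/

namespace RAM

namespace Cmd

variable {I : ℕ → ℤ} {P X W : ℕ} {Q : State → Prop} {s : State}

theorem wp_skip : skip.wp I P X W Q s ↔ Q s := Iff.rfl

theorem wp_set {r : ℕ} {e : Term} : (set r e).wp I P X W Q s ↔
    r < 32 ∧ e.Safe P I s ∧ |e.eval I s| ≤ W ∧ Q (s.set r (e.eval I s)) := Iff.rfl

theorem wp_put {j : ℕ} {a e : Term} : (put j a e).wp I P X W Q s ↔
    j < 8 ∧ a.Safe P I s ∧ e.Safe P I s ∧ 0 ≤ a.eval I s ∧ |e.eval I s| ≤ W ∧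
      Q (s.put j (a.eval I s).toNat (e.eval I s)) := Iff.rfl

theorem wp_seq {p q : Cmd} :
    (seq p q).wp I P X W Q s ↔ p.wp I P X W (q.wp I P X W Q) s := Iff.rfl

theorem wp_ite {c : Term} {p q : Cmd} : (ite c p q).wp I P X W Q s ↔
    c.Safe P I s ∧ (0 < c.eval I s → p.wp I P X W Q s) ∧
      (c.eval I s ≤ 0 → q.wp I P X W Q s) := Iff.rfl

end Cmd

open Cmd

/-- `x_r ← 2 ^ e`. -/
def powTwo (r : ℕ) (e : Term) : Cmd :=
  .seq (.set r (.const 1)) (.loop 18 e (.set r (.mul (.reg r) (.const 2))))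

/-- `x_13 ← n ^ D`. -/
def dictionarySize : Cmd :=
  .seq (.set 13 (.const 1)) (.loop 18 (.reg 4) (.set 13 (.mul (.reg 13) (.reg 0))))

/-- The entry with index `t` of the current sample. -/
def sampleEntry (t : Term) : Term :=
  .inp (.add (.reg 7) (.add (.mul (.reg 19) (.reg 0)) t))

/-- `x_15 ←` the monomial with the index `x_er` at the current sample, where the variables with
the indices `x_2` and `x_jr` are replaced by `1`. -/
def monomial (jr er : ℕ) : Cmd :=
  .seq (.set 15 (.const 1)) <| .seq (.set 16 (.reg er)) <| .loop 18 (.reg 4) <|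
    .seq (.set 17 (.sub (.reg 16) (.mul (.reg 0) (.div (.reg 16) (.reg 0))))) <|
    .seq (.set 16 (.div (.reg 16) (.reg 0))) <|
    .ite (.mul (.mul (.sub (.reg 17) (.reg 2)) (.sub (.reg 17) (.reg 2)))
        (.mul (.sub (.reg 17) (.reg jr)) (.sub (.reg 17) (.reg jr))))
      (.set 15 (.mul (.reg 15) (sampleEntry (.reg 17)))) .skip

/-- The rounded prediction at the current sample. -/
def prediction (c : ℕ) : Term :=
  .div (.mul (.reg 11) (.sub (.arr c (.reg 19)) (.arr (c + 1) (.reg 19))))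
    (.add (.arr c (.reg 19)) (.arr (c + 1) (.reg 19)))

/-- `x_20 ←` the correlation of the monomial with index `x_21` with the residuals. -/
def score (jr c : ℕ) : Cmd :=
  .seq (.set 20 (.const 0)) <| .loop 19 (.reg 1) <| .seq (monomial jr 21) <|
    .set 20 (.add (.reg 20) (.mul (.reg 15)
      (.sub (.mul (sampleEntry (.reg 2)) (.reg 11)) (prediction c))))

/-- `x_23` and `x_24 ←` index and sign of a monomial with the largest correlation. -/
def select (jr c : ℕ) : Cmd :=
  .seq (.set 22 (.const (-1))) <| .seq (.set 23 (.const 0)) <| .seq (.set 24 (.const 1)) <|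
  .loop 21 (.reg 13) <| .seq (score jr c) <|
    .seq (.ite (.sub (.reg 20) (.reg 22))
      (.seq (.set 22 (.reg 20)) (.seq (.set 23 (.reg 21)) (.set 24 (.const 1)))) .skip)
      (.ite (.sub (.sub (.const 0) (.reg 20)) (.reg 22))
        (.seq (.set 22 (.sub (.const 0) (.reg 20)))
          (.seq (.set 23 (.reg 21)) (.set 24 (.const (-1))))) .skip)

/-- A step in the direction of the selected monomial. -/
def descend (jr c : ℕ) : Cmd :=
  .loop 19 (.reg 1) <| .seq (monomial jr 23) <|
    .seq (.put c (.reg 19) (.mul (.arr c (.reg 19))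
      (.add (.reg 11) (.mul (.reg 24) (.reg 15)))))
    (.put (c + 1) (.reg 19) (.mul (.arr (c + 1) (.reg 19))
      (.sub (.reg 11) (.mul (.reg 24) (.reg 15)))))

/-- Greedy coordinate descent. -/
def fit (jr c : ℕ) : Cmd :=
  .seq (.loop 19 (.reg 1) (.seq (.put c (.reg 19) (.const 1)) (.put (c + 1) (.reg 19) (.const 1))))
    (.loop 25 (.reg 10) (.seq (select jr c) (descend jr c)))

/-- `x_26 ←` the total distance of the two predictions. -/
def compare : Cmd :=
  .seq (.set 26 (.const 0)) <| .loop 19 (.reg 1) <|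
    .seq (.set 15 (.sub (prediction 0) (prediction 2))) <|
    .ite (.reg 15) (.set 26 (.add (.reg 26) (.reg 15))) (.set 26 (.sub (.reg 26) (.reg 15)))

/-- The `k`-th power of a term. -/
def Term.power (t : Term) : ℕ → Term
  | 0 => .const 1
  | k + 1 => .mul (t.power k) t

/-- The test for the pair `x_2`, `x_3`; the result is in `x_27`. -/
def pairTest : Cmd :=
  .seq (powTwo 8 (.reg 4)) <|
  .seq (powTwo 9 (.div (.reg 4) (.reg 5))) <|
  .seq (.set 11 (Term.power (.reg 8) 9)) <|
  .seq (.set 10 (Term.power (.reg 8) 16)) <|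
  .seq dictionarySize <|
  .seq (fit 2 0) <| .seq (fit 3 2) <| .seq compare <|
  .ite (.mul (.sub (.reg 6) (.const 1))
      (.sub (.mul (.reg 26) (.reg 9)) (.mul (.reg 1) (.reg 11))))
    (.set 27 (.const 1)) (.set 27 (.const 0))

/-- The data of a test. -/
structure TestData where
  I : ℕ → ℤ
  (P X W n m D i j st L e : ℕ)

namespace TestData

/-- The step parameter. -/
def H (d : TestData) : ℕ := (2 ^ d.D) ^ 9

/-- The number of steps. -/
def T (d : TestData) : ℕ := (2 ^ d.D) ^ 16

/-- The inverse of the threshold. -/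
def Z (d : TestData) : ℕ := 2 ^ (d.D / d.L)

/-- The samples. -/
def x (d : TestData) (a r : ℕ) : ℤ := d.I (d.st + (a * d.n + r))

/-- The value of a product of the entries of a sample given by the first `k` digits of `e`, where
the entries with indices `d.i` and `q` are replaced by `1`. -/
def phi (d : TestData) (q a e k : ℕ) : ℤ :=
  ∏ t ∈ Finset.range k,
    if e / d.n ^ t % d.n = d.i ∨ e / d.n ^ t % d.n = q then 1 else d.x a (e / d.n ^ t % d.n)

/-- The assumptions on the data. -/
structure Valid (d : TestData) : Prop where
  hn : 0 < d.n
  hD : 0 < d.D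
  hi : d.i < d.n
  hj : d.j < d.n
  hx : ∀ a < d.m, ∀ r < d.n, d.x a r = 1 ∨ d.x a r = -1
  hP : ∀ a < d.m, ∀ r < d.n, d.st + (a * d.n + r) < d.P
  hX₁ : d.n ^ d.D ≤ d.X
  hX₂ : d.T ≤ d.X
  hX₃ : d.m ≤ d.X
  hX₄ : d.D ≤ d.X
  hW₁ : d.X ≤ d.W
  hW₂ : d.H * (2 * (d.H + 1) ^ d.T) ≤ d.W
  hW₃ : d.m * (2 * d.H) ≤ d.W

/-- The registers hold the given data. -/
structure Base (d : TestData) (s : State) : Prop where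
  r0 : s.reg 0 = d.n
  r1 : s.reg 1 = d.m
  r2 : s.reg 2 = d.i
  r3 : s.reg 3 = d.j
  r4 : s.reg 4 = d.D
  r5 : s.reg 5 = d.L
  r6 : s.reg 6 = d.e
  r7 : s.reg 7 = d.st

/-- The registers hold the given data and the parameters of the algorithm. -/
structure Holds (d : TestData) (s : State) : Prop extends Base d s where
  r9 : s.reg 9 = d.Z
  r10 : s.reg 10 = d.T
  r11 : s.reg 11 = d.H
  r13 : s.reg 13 = (d.n ^ d.D : ℕ)

variable {d : TestData} {s s' : State}

theorem Base.agree (h : d.Base s) {R A : List ℕ} (ha : Agree R A s s')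
    (hR : ∀ r ∈ R, 8 ≤ r) : d.Base s' := by
  have hk : ∀ r < 8, s'.reg r = s.reg r := fun r hr => ha.1 r fun hm => by
    have := hR r hm; omega
  constructor
  · rw [hk 0 (by norm_num), h.r0]
  · rw [hk 1 (by norm_num), h.r1]
  · rw [hk 2 (by norm_num), h.r2]
  · rw [hk 3 (by norm_num), h.r3]
  · rw [hk 4 (by norm_num), h.r4]
  · rw [hk 5 (by norm_num), h.r5]
  · rw [hk 6 (by norm_num), h.r6]
  · rw [hk 7 (by norm_num), h.r7]

theorem Holds.agree (h : d.Holds s) {R A : List ℕ} (ha : Agree R A s s')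
    (hR : ∀ r ∈ R, 15 ≤ r) : d.Holds s' := by
  have hk : ∀ r < 15, s'.reg r = s.reg r := fun r hr => ha.1 r fun hm => by
    have := hR r hm; omega
  refine ⟨h.toBase.agree ha fun r hr => by have := hR r hr; omega, ?_, ?_, ?_, ?_⟩
  · rw [hk 9 (by norm_num), h.r9]
  · rw [hk 10 (by norm_num), h.r10]
  · rw [hk 11 (by norm_num), h.r11]
  · rw [hk 13 (by norm_num), h.r13]

theorem Base.set (h : d.Base s) {r : ℕ} (hr : 8 ≤ r) (z : ℤ) : d.Base (s.set r z) :=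
  h.agree (R := [r]) (A := []) ⟨fun q hq => by simp at hq; simp [hq], fun _ _ => rfl⟩
    (by simpa using hr)

theorem Holds.set (h : d.Holds s) {r : ℕ} (hr : 15 ≤ r) (z : ℤ) : d.Holds (s.set r z) :=
  h.agree (R := [r]) (A := []) ⟨fun q hq => by simp at hq; simp [hq], fun _ _ => rfl⟩
    (by simpa using hr)

theorem abs_phi (hd : d.Valid) {a : ℕ} (ha : a < d.m) (q e k : ℕ) : |d.phi q a e k| = 1 := by
  rw [phi, Finset.abs_prod]
  refine Finset.prod_eq_one fun t _ => ?_
  split_ifs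
  · simp
  · rcases hd.hx a ha _ (Nat.mod_lt (e / d.n ^ t) hd.hn) with h | h <;> rw [h] <;> simp

theorem Valid.one_le_W (hd : d.Valid) : 1 ≤ d.W :=
  (Nat.succ_le_of_lt (Nat.pow_pos hd.hn)).trans (hd.hX₁.trans hd.hW₁)

/-- The specification of `monomial`. -/
theorem wp_monomial (hd : d.Valid) {Q : State → Prop} {jr er q a e : ℕ} (hs : d.Holds s)
    (hjr : jr < 4) (her : 18 < er) (her' : er < 32) (hq : s.reg jr = q) (he : s.reg er = e)
    (hle : e ≤ d.n ^ d.D) (ha : s.reg 19 = a) (ham : a < d.m)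
    (hQ : ∀ s', Agree [15, 16, 17, 18] [] s s' → s'.reg 15 = d.phi q a e d.D → Q s') :
    (monomial jr er).wp d.I d.P d.X d.W Q s := by
  have hW := hd.one_le_W
  have heW : e ≤ d.W := hle.trans (hd.hX₁.trans hd.hW₁)
  have key : (monomial jr er).wp d.I d.P d.X d.W (fun s' => s'.reg 15 = d.phi q a e d.D) s := by
    unfold monomial
    rw [wp_seq, wp_set, wp_seq, wp_set]
    refine ⟨by norm_num, trivial, by simpa [Term.eval] using hW, by norm_num, her', ?_, ?_⟩
    · have : er ≠ 15 := by omega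
      simpa [Term.eval, this, he] using heW
    have e16 : (((s.set 15 ((Term.const 1).eval d.I s)).set 16
        ((Term.reg er).eval d.I (s.set 15 ((Term.const 1).eval d.I s)))).reg 16) = e := by
      simp [Term.eval, he, show er ≠ 15 by omega]
    have e15 : (((s.set 15 ((Term.const 1).eval d.I s)).set 16
        ((Term.reg er).eval d.I (s.set 15 ((Term.const 1).eval d.I s)))).reg 15) = 1 := by
      simp [Term.eval]
    have e0 : ∀ r, r ≠ 15 → r ≠ 16 → (((s.set 15 ((Term.const 1).eval d.I s)).set 16
        ((Term.reg er).eval d.I (s.set 15 ((Term.const 1).eval d.I s)))).reg r) = s.reg r := by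
      intro r h1 h2; simp [h1, h2]
    generalize ((s.set 15 ((Term.const 1).eval d.I s)).set 16
        ((Term.reg er).eval d.I (s.set 15 ((Term.const 1).eval d.I s)))) = s₁ at e16 e15 e0 ⊢
    refine wp_loop (fun k s' => s'.reg 15 = d.phi q a e k ∧ s'.reg 16 = (e / d.n ^ k : ℕ))
      (by norm_num) (by simp [regs]) (by norm_num [Term.Safe]) d.D
      (by rw [Term.eval, e0 _ (by norm_num) (by norm_num), hs.r4]) hd.hX₄ ?_ ?_ ?_
    · simp [e15, e16, phi]
    · rintro k hk s' hag ⟨h15, h16⟩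
      have hr : ∀ r, r ∉ [18, 17, 16, 15, 15] → s'.reg r = s.reg r := fun r hr => by
        rw [hag.1 r (by simp [regs] at hr ⊢; omega), e0 r (by simp at hr; omega)
          (by simp at hr; omega)]
      have hjr' : s'.reg jr = q := by rw [hr jr (by simp; omega), hq]
      have h0 := hr 0 (by decide)
      have h2 := hr 2 (by decide)
      have h7 := hr 7 (by decide)
      have h19 := hr 19 (by decide)
      rw [hs.r0] at h0
      rw [hs.r2] at h2
      rw [hs.r7] at h7
      rw [ha] at h19
      set g := e / d.n ^ k with hg
      have hgn : g / d.n = e / d.n ^ (k + 1) := by rw [hg, Nat.div_div_eq_div_mul, pow_succ]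
      have hgmod : (g : ℤ) - d.n * ((g : ℤ) / d.n) = (g % d.n : ℕ) := by
        have := Nat.mod_add_div g d.n
        zify at this ⊢
        linarith
      have hgW : g ≤ d.W := (Nat.div_le_self _ _).trans heW
      have hmodlt := Nat.mod_lt g hd.hn
      have hphi : d.phi q a e (k + 1) = d.phi q a e k *
          (if g % d.n = d.i ∨ g % d.n = q then 1 else d.x a (g % d.n)) := by
        rw [phi, Finset.prod_range_succ]; rfl
      rw [wp_seq, wp_set, wp_seq, wp_set, wp_ite, wp_set, wp_skip]
      have hj18 : jr ≠ 18 := by omega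
      have hj17 : jr ≠ 17 := by omega
      have hj16 : jr ≠ 16 := by omega
      simp only [Term.eval, Term.Safe, State.set_reg, sampleEntry, h15, h16, h0, h2, h7, h19]
      norm_num
      simp only [hj18, hj17, hj16, if_false, hjr', hgmod]
      have hgm : |((g % d.n : ℕ) : ℤ)| ≤ d.W := by
        rw [Nat.abs_cast]
        exact_mod_cast (Nat.mod_le _ _).trans hgW
      have hgd : |(g : ℤ) / d.n| ≤ d.W := by
        rw [← Int.natCast_div, Nat.abs_cast]
        exact_mod_cast (Nat.div_le_self _ _).trans hgW
      have hfin : (g : ℤ) / d.n = (e : ℤ) / d.n ^ (k + 1) := by exact_mod_cast hgn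
      generalize g % d.n = ρ at *
      have hidx : ((d.st : ℤ) + (a * d.n + ρ)).toNat = d.st + (a * d.n + ρ) := by
        have : (d.st : ℤ) + (a * d.n + ρ) = ((d.st + (a * d.n + ρ) : ℕ) : ℤ) := by push_cast; rfl
        rw [this, Int.toNat_natCast]
      rw [hidx]
      refine ⟨hgm, hgd, by omega, fun hne => ⟨hd.hP a ham _ hmodlt, ?_, ?_, hfin⟩,
        fun hne => ⟨?_, hfin⟩⟩
      · rw [abs_phi hd ham, one_mul]
        change |d.x a ρ| ≤ _
        have : (1 : ℤ) ≤ d.W := by exact_mod_cast hW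
        rcases hd.hx a ham _ hmodlt with h | h <;> rw [h] <;> simpa using this
      · rw [hphi, if_neg]
        · rfl
        · rintro (h | h) <;> rw [h] at hne <;> simp at hne
      · rw [hphi, if_pos, mul_one]
        by_contra hcon
        push Not at hcon
        have h1 : ((ρ : ℤ) - d.i) ≠ 0 := by omega
        have h2 : ((ρ : ℤ) - q) ≠ 0 := by omega
        have := mul_pos (mul_self_pos.mpr h1) (mul_self_pos.mpr h2)
        omega
    · rintro s' hag ⟨h15, h16⟩
      simpa using h15
  refine wp_mono (fun s' hs' => hQ s' ⟨fun r hr => hs'.2.1 r ?_, hs'.2.2⟩ hs'.1) (wp_agree key)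
  simp [monomial, regs] at hr ⊢
  omega

end TestData

end RAM

namespace RAM

open Cmd

namespace TestData

variable {d : TestData} {s s' : State}

theorem two_le_H (hd : d.Valid) : 2 ≤ d.H := by
  unfold H
  calc 2 = 2 ^ 1 := rfl
    _ ≤ 2 ^ (d.D * 9) := Nat.pow_le_pow_right (by norm_num) (by have := hd.hD; omega)
    _ = _ := by rw [pow_mul]

/-- The rounded prediction. -/
def pred (d : TestData) (U V : ℕ → ℤ) (a : ℕ) : ℤ := d.H * (U a - V a) / (U a + V a)

/-- The correlation of a monomial with the residuals. -/
def corr (d : TestData) (q : ℕ) (U V : ℕ → ℤ) (e k : ℕ) : ℤ :=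
  ∑ a ∈ Finset.range k, d.phi q a e d.D * (d.x a d.i * d.H - d.pred U V a)

theorem abs_pred_le {U V : ℕ → ℤ} {a : ℕ} (hU : 0 < U a) (hV : 0 < V a) :
    |d.pred U V a| ≤ d.H := by
  have hs : 0 < U a + V a := by omega
  have hH : (0 : ℤ) ≤ d.H := by positivity
  rw [pred, abs_le]
  constructor
  · rw [Int.le_ediv_iff_mul_le hs]; nlinarith
  · apply Int.ediv_le_of_le_mul hs; nlinarith

theorem abs_res_le (hd : d.Valid) {U V : ℕ → ℤ} {a : ℕ} (ha : a < d.m) (hU : 0 < U a)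
    (hV : 0 < V a) (q e : ℕ) :
    |d.phi q a e d.D * (d.x a d.i * d.H - d.pred U V a)| ≤ 2 * d.H := by
  rw [abs_mul, abs_phi hd ha, one_mul]
  have h1 := abs_pred_le (d := d) hU hV
  have h2 : |d.x a d.i * (d.H : ℤ)| = d.H := by
    rw [abs_mul, Nat.abs_cast]
    rcases hd.hx a ha _ hd.hi with h | h <;> rw [h] <;> simp
  have := abs_sub (d.x a d.i * (d.H : ℤ)) (d.pred U V a)
  linarith

theorem abs_corr_le (hd : d.Valid) {U V : ℕ → ℤ} (hU : ∀ a < d.m, 0 < U a)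
    (hV : ∀ a < d.m, 0 < V a) (q e : ℕ) {k : ℕ} (hk : k ≤ d.m) :
    |d.corr q U V e k| ≤ d.W := by
  have h : |d.corr q U V e k| ≤ ∑ a ∈ Finset.range k, (2 * d.H : ℤ) :=
    (Finset.abs_sum_le_sum_abs _ _).trans <| Finset.sum_le_sum fun a ha => by
      have ha' : a < d.m := (Finset.mem_range.mp ha).trans_le hk
      exact abs_res_le hd ha' (hU a ha') (hV a ha') q e
  rw [Finset.sum_const, Finset.card_range, nsmul_eq_mul] at h
  have h1 : (k : ℤ) * (2 * d.H) ≤ d.m * (2 * d.H) := by gcongr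
  have h2 : (d.m : ℤ) * (2 * d.H) ≤ d.W := by exact_mod_cast hd.hW₃
  omega

/-- The arrays `c`, `c + 1` hold the values `U`, `V`. -/
def Stores (d : TestData) (c : ℕ) (U V : ℕ → ℤ) (s : State) : Prop :=
  ∀ a < d.m, s.arr c a = U a ∧ s.arr (c + 1) a = V a

theorem Stores.agree {c : ℕ} {U V : ℕ → ℤ} (h : d.Stores c U V s) {R A : List ℕ}
    (ha : Agree R A s s') (h1 : c ∉ A) (h2 : c + 1 ∉ A) : d.Stores c U V s' := by
  intro a ham
  rw [ha.2 c h1, ha.2 _ h2]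
  exact h a ham

theorem wp_score (hd : d.Valid) {Q : State → Prop} {jr c q e : ℕ} {U V : ℕ → ℤ}
    (hs : d.Holds s) (hjr : jr < 4) (hc : c < 6) (hq : s.reg jr = q) (he : s.reg 21 = e)
    (hle : e ≤ d.n ^ d.D) (hA : d.Stores c U V s) (hU : ∀ a < d.m, 0 < U a)
    (hV : ∀ a < d.m, 0 < V a)
    (hQ : ∀ s', Agree [15, 16, 17, 18, 19, 20] [] s s' → s'.reg 20 = d.corr q U V e d.m → Q s') :
    (score jr c).wp d.I d.P d.X d.W Q s := by
  have key : (score jr c).wp d.I d.P d.X d.W (fun s' => s'.reg 20 = d.corr q U V e d.m) s := by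
    unfold score
    rw [wp_seq, wp_set]
    refine ⟨by norm_num, trivial, by simp [Term.eval], ?_⟩
    refine wp_loop (fun k s' => s'.reg 20 = d.corr q U V e k) (by norm_num)
      (by simp [regs, monomial]) (by norm_num [Term.Safe]) d.m
      (by simp [Term.eval, hs.r1]) hd.hX₃ (by simp [Term.eval, corr]) ?_ ?_
    · intro k hk s' hag h20
      have hs' : d.Holds s' := (hs.set (r := 20) (by norm_num) _).agree hag (by simp [regs, monomial])
      have hs'' := hs'.set (r := 19) (by norm_num) k
      rw [wp_seq]
      have hjr' : s'.reg jr = q := by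
        rw [hag.1 jr (by simp [regs, monomial]; omega), State.set_reg, if_neg (by omega), hq]
      have he' : s'.reg 21 = e := by
        rw [hag.1 21 (by simp [regs, monomial]), State.set_reg, if_neg (by omega), he]
      refine wp_monomial hd (q := q) (a := k) (e := e) hs'' hjr (by norm_num) (by norm_num)
        (by rw [State.set_reg, if_neg (by omega), hjr']) (by simp [he']) hle (by simp) hk ?_
      intro s₂ hag₂ h15
      have hs₂ := hs''.agree hag₂ (by simp)
      have h20' : s₂.reg 20 = d.corr q U V e k := by
        rw [hag₂.1 20 (by simp)]; simp [h20]
      have h19' : s₂.reg 19 = k := by rw [hag₂.1 19 (by simp)]; simp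
      have hA₂ : d.Stores c U V s₂ := by
        have h1 : d.Stores c U V s' := by
          have := Stores.agree (s := s.set 20 ((Term.const 0).eval d.I s)) hA hag
            (by simp [arrs, monomial]) (by simp [arrs, monomial])
          exact this
        exact Stores.agree (s := s'.set 19 k) h1 hag₂ (by simp) (by simp)
      obtain ⟨hAc, hAc'⟩ := hA₂ k hk
      rw [wp_set]
      have hidx : ((d.st : ℤ) + (k * d.n + d.i)).toNat = d.st + (k * d.n + d.i) := by
        have : (d.st : ℤ) + (k * d.n + d.i) = ((d.st + (k * d.n + d.i) : ℕ) : ℤ) := by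
          push_cast; rfl
        rw [this, Int.toNat_natCast]
      have hval : d.corr q U V e (k + 1) = d.corr q U V e k + d.phi q k e d.D *
          (d.I (d.st + (k * d.n + d.i)) * d.H - d.H * (U k - V k) / (U k + V k)) := by
        rw [corr, Finset.sum_range_succ]; rfl
      have hW := abs_corr_le hd hU hV q e (Nat.succ_le_of_lt hk)
      rw [Nat.succ_eq_add_one, hval] at hW
      simp only [Term.eval, Term.Safe, sampleEntry, prediction, h15, h20', h19', hs₂.r0, hs₂.r2,
        hs₂.r7, hs₂.r11, hidx, Int.toNat_natCast, hAc, hAc', State.set_reg, if_true, hval]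
      refine ⟨by norm_num, ?_, hW, trivial⟩
      norm_num
      exact ⟨hd.hP k hk _ hd.hi, by omega, by omega⟩
    · intro s' _ h
      simpa using h
  refine wp_mono (fun s' hs' => hQ s' ⟨fun r hr => hs'.2.1 r ?_, hs'.2.2⟩ hs'.1) (wp_agree key)
  simp [score, monomial, regs] at hr ⊢
  omega

theorem wp_select (hd : d.Valid) {Q : State → Prop} {jr c q : ℕ} {U V : ℕ → ℤ}
    (hs : d.Holds s) (hjr : jr < 4) (hc : c < 6) (hq : s.reg jr = q)
    (hA : d.Stores c U V s) (hU : ∀ a < d.m, 0 < U a) (hV : ∀ a < d.m, 0 < V a)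
    (hQ : ∀ s', Agree [15, 16, 17, 18, 19, 20, 21, 22, 23, 24] [] s s' → ∀ (e : ℕ) (b : ℤ),
      e < d.n ^ d.D → (b = 1 ∨ b = -1) →
      (∀ e' < d.n ^ d.D, |d.corr q U V e' d.m| ≤ b * d.corr q U V e d.m) →
      s'.reg 23 = e → s'.reg 24 = b → Q s') :
    (select jr c).wp d.I d.P d.X d.W Q s := by
  have hW : (1 : ℤ) ≤ d.W := by exact_mod_cast hd.one_le_W
  have hN : 0 < d.n ^ d.D := Nat.pow_pos hd.hn
  have key : (select jr c).wp d.I d.P d.X d.W (fun s' => ∃ (e : ℕ) (b : ℤ),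
      e < d.n ^ d.D ∧ (b = 1 ∨ b = -1) ∧
      (∀ e' < d.n ^ d.D, |d.corr q U V e' d.m| ≤ b * d.corr q U V e d.m) ∧
      s'.reg 23 = e ∧ s'.reg 24 = b) s := by
    unfold select
    rw [wp_seq, wp_set, wp_seq, wp_set, wp_seq, wp_set]
    refine ⟨by norm_num, trivial, by simpa [Term.eval] using hW, by norm_num, trivial,
      by simp [Term.eval], by norm_num, trivial, by simpa [Term.eval] using hW, ?_⟩
    simp only [Term.eval]
    have hs₀ : d.Holds (((s.set 22 (-1)).set 23 0).set 24 1) :=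
      ((hs.set (by norm_num) _).set (by norm_num) _).set (by norm_num) _
    refine wp_loop (fun k s' => ∃ (e : ℕ) (b : ℤ), (b = 1 ∨ b = -1) ∧ s'.reg 23 = e ∧
      s'.reg 24 = b ∧ (∀ e' < k, |d.corr q U V e' d.m| ≤ s'.reg 22) ∧
      (k = 0 ∧ s'.reg 22 = -1 ∨ e < k ∧ s'.reg 22 = b * d.corr q U V e d.m)) (by norm_num)
      (by simp [regs, score, monomial]) (by norm_num [Term.Safe]) (d.n ^ d.D)
      (by simp [Term.eval, hs.r13]) hd.hX₁ ⟨0, 1, by simp⟩ ?_ ?_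
    · rintro k hk s' hag ⟨e, b, hb, h23, h24, hle, hor⟩
      have hs' : d.Holds s' := hs₀.agree hag (by simp [regs, score, monomial])
      have hs'' := hs'.set (r := 21) (by norm_num) k
      rw [wp_seq]
      have hjr' : s'.reg jr = q := by
        rw [hag.1 jr (by simp [regs, score, monomial]; omega)]
        simp only [State.set_reg]
        rw [if_neg (by omega), if_neg (by omega), if_neg (by omega), hq]
      have hA' : d.Stores c U V s' :=
        Stores.agree (s := ((s.set 22 (-1)).set 23 0).set 24 1) hA hag
          (by simp [arrs, score, monomial]) (by simp [arrs, score, monomial])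
      refine wp_score hd (q := q) (e := k) (U := U) (V := V) hs'' hjr hc
        (by rw [State.set_reg, if_neg (by omega), hjr']) (by simp) hk.le hA' hU hV ?_
      intro s₂ hag₂ h20
      have hC := abs_corr_le hd hU hV q k le_rfl
      have hk2 : ∀ r, 21 < r → s₂.reg r = s'.reg r := fun r hr => by
        rw [hag₂.1 r (by simp; omega), State.set_reg, if_neg (by omega)]
      have h21 : s₂.reg 21 = k := by rw [hag₂.1 21 (by simp)]; simp
      have h22' := hk2 22 (by norm_num)
      have h23' := (hk2 23 (by norm_num)).trans h23
      have h24' := (hk2 24 (by norm_num)).trans h24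
      have hkW : (k : ℤ) ≤ d.W := by exact_mod_cast hk.le.trans (hd.hX₁.trans hd.hW₁)
      have hlow : -1 ≤ s'.reg 22 := by
        rcases hor with h | ⟨h, -⟩
        · exact h.2.ge
        · exact le_trans (by norm_num) ((abs_nonneg _).trans (hle e h))
      have hkW' : |(k : ℤ)| ≤ d.W := by rwa [Nat.abs_cast]
      set v := d.corr q U V k d.m with hv
      have habs := le_abs_self v
      have habs' := neg_le_abs v
      rw [wp_seq, wp_ite, wp_skip]
      refine ⟨by norm_num [Term.Safe], fun hlt => ?_, fun hlt => ?_⟩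
      · simp only [Term.eval, h20, h22'] at hlt
        rw [wp_seq, wp_set, wp_seq, wp_set, wp_set, wp_ite, wp_skip, wp_seq, wp_set, wp_seq, wp_set,
          wp_set]
        simp only [Term.Safe, Term.eval, h20, State.set_reg, h21, reduceIte, Nat.reduceEqDiff,
          Nat.reduceLT, true_and]
        have hv0 : 0 ≤ v := by omega
        refine ⟨hC, hkW', by simpa using hW, fun h => absurd h (by omega),
          fun _ => ⟨k, 1, Or.inl rfl, rfl, rfl, fun e' he' => ?_, Or.inr ⟨by omega, (one_mul v).symm⟩⟩⟩
        rcases Nat.lt_succ_iff_lt_or_eq.mp he' with h | rfl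
        · exact (hle e' h).trans (by omega)
        · rw [← hv, abs_of_nonneg hv0]
      simp only [Term.eval, h20, h22'] at hlt
      · rw [wp_ite, wp_skip, wp_seq, wp_set, wp_seq, wp_set, wp_set]
        simp only [Term.Safe, Term.eval, h20, State.set_reg, h21, h22', h23', h24', reduceIte,
          Nat.reduceEqDiff, Nat.reduceLT, true_and, and_true, zero_sub,
          abs_neg]
        refine ⟨fun h => ⟨hC, hkW', by simpa using hW, k, -1, Or.inr rfl, rfl, rfl,
          fun e' he' => ?_, Or.inr ⟨by omega, by omega⟩⟩, fun h => ⟨e, b, hb, rfl, rfl,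
          fun e' he' => ?_, Or.inr ?_⟩⟩
        · rcases Nat.lt_succ_iff_lt_or_eq.mp he' with h' | rfl
          · have := hle e' h'
            omega
          · rw [← hv, abs_of_nonpos (by omega)]
        · rcases Nat.lt_succ_iff_lt_or_eq.mp he' with h' | rfl
          · exact hle e' h'
          · rw [← hv, abs_le]; omega
        · have hne : ¬ (s'.reg 22 = -1) := by omega
          rcases hor with h' | h'
          · exact absurd h'.2 hne
          · exact ⟨by omega, h'.2⟩
    · rintro s' hag ⟨e, b, hb, h23, h24, hle, hor⟩
      refine ⟨e, b, ?_, hb, ?_, by simpa using h23, by simpa using h24⟩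
      · rcases hor with h | h
        · omega
        · exact h.1
      · rcases hor with h | h
        · omega
        · rw [← h.2]; exact hle
  refine wp_mono ?_ (wp_agree key)
  rintro s' ⟨⟨e, b, h1, h2, h3, h4, h5⟩, hag⟩
  refine hQ s' ⟨fun r hr => hag.1 r ?_, hag.2⟩ e b h1 h2 h3 h4 h5
  simp [select, score, monomial, regs] at hr ⊢
  omega

theorem wp_descend (hd : d.Valid) {Q : State → Prop} {jr c q e : ℕ} {b : ℤ} {U V : ℕ → ℤ}
    (hs : d.Holds s) (hjr : jr < 4) (hc : c < 6) (hq : s.reg jr = q) (he : s.reg 23 = e)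
    (hb : s.reg 24 = b) (hb1 : b = 1 ∨ b = -1)
    (hle : e ≤ d.n ^ d.D) (hA : d.Stores c U V s)
    (hU : ∀ a < d.m, |U a| * (d.H + 1) ≤ d.W) (hV : ∀ a < d.m, |V a| * (d.H + 1) ≤ d.W)
    (hQ : ∀ s', Agree [15, 16, 17, 18, 19] [c, c + 1] s s' →
      d.Stores c (fun a => U a * (d.H + b * d.phi q a e d.D))
        (fun a => V a * (d.H - b * d.phi q a e d.D)) s' → Q s') :
    (descend jr c).wp d.I d.P d.X d.W Q s := by
  have key : (descend jr c).wp d.I d.P d.X d.W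
      (d.Stores c (fun a => U a * (d.H + b * d.phi q a e d.D))
        (fun a => V a * (d.H - b * d.phi q a e d.D))) s := by
    unfold descend
    refine wp_loop (fun k s' => (∀ a < k, s'.arr c a = U a * (d.H + b * d.phi q a e d.D) ∧
        s'.arr (c + 1) a = V a * (d.H - b * d.phi q a e d.D)) ∧
        ∀ a < d.m, k ≤ a → s'.arr c a = U a ∧ s'.arr (c + 1) a = V a) (by norm_num)
      (by simp [regs, monomial]) (by norm_num [Term.Safe]) d.m
      (by simp [Term.eval, hs.r1]) hd.hX₃ ⟨by simp, fun a ha _ => hA a ha⟩ ?_ ?_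
    · rintro k hk s' hag ⟨h1, h2⟩
      have hs' : d.Holds s' := hs.agree hag (by simp [regs, monomial])
      have hs'' := hs'.set (r := 19) (by norm_num) k
      rw [wp_seq]
      have hjr' : s'.reg jr = q := by
        rw [hag.1 jr (by simp [regs, monomial]; omega), hq]
      have he' : s'.reg 23 = e := by rw [hag.1 23 (by simp [regs, monomial]), he]
      have hb' : s'.reg 24 = b := by rw [hag.1 24 (by simp [regs, monomial]), hb]
      refine wp_monomial hd (q := q) (a := k) (e := e) hs'' hjr (by norm_num) (by norm_num)
        (by rw [State.set_reg, if_neg (by omega), hjr']) (by simp [he']) hle (by simp) hk ?_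
      intro s₂ hag₂ h15
      have hs₂ := hs''.agree hag₂ (by simp)
      have h19' : s₂.reg 19 = k := by rw [hag₂.1 19 (by simp)]; simp
      have h24' : s₂.reg 24 = b := by rw [hag₂.1 24 (by simp)]; simp [hb']
      have harr : s₂.arr = s'.arr := funext fun j => by rw [hag₂.2 j (by simp)]; rfl
      obtain ⟨hAc, hAc'⟩ := h2 k hk le_rfl
      have hphi := abs_phi hd hk q e d.D
      have hbphi : |b * d.phi q k e d.D| = 1 := by
        rw [abs_mul, hphi]; rcases hb1 with h | h <;> rw [h] <;> simp
      have hH : (0 : ℤ) ≤ d.H := by positivity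
      have hb1' : |(d.H : ℤ) + b * d.phi q k e d.D| ≤ d.H + 1 :=
        (abs_add_le _ _).trans (by rw [hbphi, abs_of_nonneg hH])
      have hb2' : |(d.H : ℤ) - b * d.phi q k e d.D| ≤ d.H + 1 :=
        (abs_sub _ _).trans (by rw [hbphi, abs_of_nonneg hH])
      rw [wp_seq, wp_put, wp_put]
      simp only [Term.eval, Term.Safe, h15, h19', h24', hs₂.r11, Int.toNat_natCast, harr, hAc,
        hAc', State.put_arr, State.put_reg]
      have hne : c + 1 ≠ c := by omega
      have hne' : c ≠ c + 1 := by omega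
      simp only [hne, hne', false_and, if_false]
      refine ⟨by omega, by norm_num, ⟨⟨by omega, by positivity, by norm_num⟩, by norm_num⟩,
        by positivity, ?_, by omega, by norm_num,
        ⟨⟨by omega, by positivity, by norm_num⟩, by norm_num⟩, by positivity, ?_, ?_, ?_⟩
      · rw [abs_mul]
        calc _ ≤ |U k| * (d.H + 1) := by gcongr
          _ ≤ _ := hU k hk
      · rw [abs_mul]
        calc _ ≤ |V k| * (d.H + 1) := by gcongr
          _ ≤ _ := hV k hk
      · intro a ha
        rcases Nat.lt_succ_iff_lt_or_eq.mp ha with h | rfl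
        · simp only [h.ne, and_false, if_false]
          exact h1 a h
        · simp
      · intro a ha hka
        have : a ≠ k := by omega
        simp only [this, and_false, if_false]
        exact h2 a ha (by omega)
    · rintro s' _ ⟨h, -⟩
      exact h
  refine wp_mono (fun s' hs' => hQ s' ⟨fun r hr => hs'.2.1 r ?_, fun j hj => hs'.2.2 j ?_⟩ hs'.1)
    (wp_agree key)
  · simp [descend, monomial, regs] at hr ⊢
    omega
  · simp [descend, monomial, arrs] at hj ⊢
    omega

end TestData

end RAM

namespace RAM

open Cmd

namespace TestData

variable {d : TestData} {s s' : State}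

/-- The numerators of the odds after `t` steps. -/
def up (d : TestData) (q : ℕ) (θ : ℕ → ℕ × ℤ) (t a : ℕ) : ℤ :=
  ∏ r ∈ Finset.range t, (d.H + (θ r).2 * d.phi q a (θ r).1 d.D)

/-- The denominators of the odds after `t` steps. -/
def down (d : TestData) (q : ℕ) (θ : ℕ → ℕ × ℤ) (t a : ℕ) : ℤ :=
  ∏ r ∈ Finset.range t, (d.H - (θ r).2 * d.phi q a (θ r).1 d.D)

/-- The first `t` steps are in the direction of the largest correlation. -/
def Greedy (d : TestData) (q : ℕ) (θ : ℕ → ℕ × ℤ) (t : ℕ) : Prop :=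
  ∀ r < t, (θ r).1 < d.n ^ d.D ∧ ((θ r).2 = 1 ∨ (θ r).2 = -1) ∧
    ∀ e < d.n ^ d.D, |d.corr q (d.up q θ r) (d.down q θ r) e d.m| ≤
      (θ r).2 * d.corr q (d.up q θ r) (d.down q θ r) (θ r).1 d.m

/-- The distance of the two predictions. -/
def stat (d : TestData) (U V U' V' : ℕ → ℤ) (k : ℕ) : ℤ :=
  ∑ a ∈ Finset.range k, |d.pred U V a - d.pred U' V' a|

theorem step_bounds (hd : d.Valid) {q a e : ℕ} {b : ℤ} (ha : a < d.m) (hb : b = 1 ∨ b = -1) :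
    (1 ≤ d.H + b * d.phi q a e d.D ∧ d.H + b * d.phi q a e d.D ≤ d.H + 1) ∧
    (1 ≤ d.H - b * d.phi q a e d.D ∧ d.H - b * d.phi q a e d.D ≤ d.H + 1) := by
  have h1 := abs_phi hd ha q e d.D
  have h2 : |b * d.phi q a e d.D| = 1 := by
    rw [abs_mul, h1]; rcases hb with h | h <;> rw [h] <;> simp
  have h3 := two_le_H hd
  have h4 := abs_le.mp h2.le
  omega

theorem up_bounds (hd : d.Valid) {q a t : ℕ} {θ : ℕ → ℕ × ℤ} (ha : a < d.m)
    (hθ : ∀ r < t, (θ r).2 = 1 ∨ (θ r).2 = -1) :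
    0 < d.up q θ t a ∧ d.up q θ t a ≤ (d.H + 1) ^ t := by
  refine ⟨Finset.prod_pos fun r hr => ?_, ?_⟩
  · have := (step_bounds hd (q := q) (e := (θ r).1) ha (hθ r (Finset.mem_range.mp hr))).1; omega
  · refine (Finset.prod_le_prod (g := fun _ => (d.H + 1 : ℤ)) (fun r hr => ?_)
      fun r hr => ?_).trans (by simp)
    · have := (step_bounds hd (q := q) (e := (θ r).1) ha (hθ r (Finset.mem_range.mp hr))).1; omega
    · exact (step_bounds hd ha (hθ r (Finset.mem_range.mp hr))).1.2

theorem down_bounds (hd : d.Valid) {q a t : ℕ} {θ : ℕ → ℕ × ℤ} (ha : a < d.m)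
    (hθ : ∀ r < t, (θ r).2 = 1 ∨ (θ r).2 = -1) :
    0 < d.down q θ t a ∧ d.down q θ t a ≤ (d.H + 1) ^ t := by
  refine ⟨Finset.prod_pos fun r hr => ?_, ?_⟩
  · have := (step_bounds hd (q := q) (e := (θ r).1) ha (hθ r (Finset.mem_range.mp hr))).2; omega
  · refine (Finset.prod_le_prod (g := fun _ => (d.H + 1 : ℤ)) (fun r hr => ?_)
      fun r hr => ?_).trans (by simp)
    · have := (step_bounds hd (q := q) (e := (θ r).1) ha (hθ r (Finset.mem_range.mp hr))).2; omega
    · exact (step_bounds hd ha (hθ r (Finset.mem_range.mp hr))).2.2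

theorem pow_mul_le (hd : d.Valid) {t : ℕ} (ht : t < d.T) {u : ℤ} (h0 : 0 < u)
    (h : u ≤ (d.H + 1) ^ t) : |u| * (d.H + 1) ≤ d.W := by
  rw [abs_of_pos h0]
  have h1 : u * (d.H + 1) ≤ ((d.H + 1 : ℕ) : ℤ) ^ (t + 1) := by
    rw [pow_succ]; push_cast; gcongr
  have h2 : (d.H + 1) ^ (t + 1) ≤ (d.H + 1) ^ d.T := Nat.pow_le_pow_right (by omega) ht
  have h3 : (d.H + 1) ^ (t + 1) ≤ d.W := by
    have := two_le_H hd
    have h4 := hd.hW₂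
    nlinarith
  exact h1.trans (by exact_mod_cast h3)

theorem up_congr {q t : ℕ} {θ θ' : ℕ → ℕ × ℤ} (h : ∀ r < t, θ r = θ' r) :
    d.up q θ t = d.up q θ' t :=
  funext fun a => Finset.prod_congr rfl fun r hr => by rw [h r (Finset.mem_range.mp hr)]

theorem down_congr {q t : ℕ} {θ θ' : ℕ → ℕ × ℤ} (h : ∀ r < t, θ r = θ' r) :
    d.down q θ t = d.down q θ' t :=
  funext fun a => Finset.prod_congr rfl fun r hr => by rw [h r (Finset.mem_range.mp hr)]

theorem wp_fit (hd : d.Valid) {Q : State → Prop} {jr c q : ℕ}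
    (hs : d.Holds s) (hjr : jr < 4) (hc : c < 6) (hq : s.reg jr = q)
    (hQ : ∀ s', Agree [15, 16, 17, 18, 19, 20, 21, 22, 23, 24, 25] [c, c + 1] s s' →
      ∀ θ, d.Greedy q θ d.T → d.Stores c (d.up q θ d.T) (d.down q θ d.T) s' → Q s') :
    (fit jr c).wp d.I d.P d.X d.W Q s := by
  have hW : (1 : ℤ) ≤ d.W := by exact_mod_cast hd.one_le_W
  have key : (fit jr c).wp d.I d.P d.X d.W (fun s' => ∃ θ, d.Greedy q θ d.T ∧
      d.Stores c (d.up q θ d.T) (d.down q θ d.T) s') s := by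
    unfold fit
    rw [wp_seq]
    refine wp_loop (fun k s' => ∀ a < k, s'.arr c a = 1 ∧ s'.arr (c + 1) a = 1) (by norm_num)
      (by simp [regs]) (by norm_num [Term.Safe]) d.m (by simp [Term.eval, hs.r1]) hd.hX₃
      (by simp) ?_ ?_
    · intro k hk s' hag h
      rw [wp_seq, wp_put, wp_put]
      have hne : c ≠ c + 1 := by omega
      simp only [Term.eval, Term.Safe, State.set_reg, reduceIte, State.put_reg, Int.toNat_natCast,
        State.put_arr, State.set_arr, hne, false_and, Nat.reduceLT, true_and]
      refine ⟨by omega, by positivity, by simpa using hW, by omega, by positivity,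
        by simpa using hW, fun a ha => ?_⟩
      rcases Nat.lt_succ_iff_lt_or_eq.mp ha with h' | rfl
      · have := h a h'
        simp [h'.ne, this]
      · simp
    · intro s₁ hag₁ h₁
      have hs₁ : d.Holds (s₁.set 19 d.m) := (hs.agree hag₁ (by simp [regs])).set (by norm_num) _
      have hq₁ : (s₁.set 19 d.m).reg jr = q := by
        rw [State.set_reg, if_neg (by omega), hag₁.1 jr (by simp [regs]; omega), hq]
      refine wp_loop (fun k s' => ∃ θ, d.Greedy q θ k ∧
        d.Stores c (d.up q θ k) (d.down q θ k) s') (by norm_num)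
        (by simp [regs, select, score, descend, monomial]) (by norm_num [Term.Safe]) d.T
        (by simp only [Term.eval, hs₁.r10]) hd.hX₂
        ⟨fun _ => (0, 1), fun r hr => absurd hr (Nat.not_lt_zero r), fun a ha => by
          simpa [up, down] using h₁ a ha⟩ ?_ ?_
      · rintro k hk s' hag ⟨θ, hθ, hst⟩
        have hs' : d.Holds (s'.set 25 k) :=
          (hs₁.agree hag (by simp [regs, select, score, descend, monomial])).set (by norm_num) _
        have hq' : (s'.set 25 k).reg jr = q := by
          rw [State.set_reg, if_neg (by omega),
            hag.1 jr (by simp [regs, select, score, descend, monomial]; omega), hq₁]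
        have hU : ∀ a < d.m, 0 < d.up q θ k a ∧ d.up q θ k a ≤ (d.H + 1) ^ k :=
          fun a ha => up_bounds hd ha fun r hr => (hθ r hr).2.1
        have hV : ∀ a < d.m, 0 < d.down q θ k a ∧ d.down q θ k a ≤ (d.H + 1) ^ k :=
          fun a ha => down_bounds hd ha fun r hr => (hθ r hr).2.1
        rw [wp_seq]
        refine wp_select hd hs' hjr hc hq' (U := d.up q θ k) (V := d.down q θ k) hst
          (fun a ha => (hU a ha).1) (fun a ha => (hV a ha).1) ?_
        intro s₂ hag₂ e b he hb hmax h23 h24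
        have hs₂ := hs'.agree hag₂ (by simp)
        refine wp_descend hd hs₂ hjr hc (q := q) (e := e) (b := b) (U := d.up q θ k)
          (V := d.down q θ k) (by rw [hag₂.1 jr (by simp; omega), hq']) h23 h24 hb he.le
          (Stores.agree (s := s'.set 25 k) hst hag₂ (by simp) (by simp))
          (fun a ha => pow_mul_le hd hk (hU a ha).1 (hU a ha).2)
          (fun a ha => pow_mul_le hd hk (hV a ha).1 (hV a ha).2) ?_
        intro s₃ _ hst₃
        have hlt : ∀ r < k, θ r = Function.update θ k (e, b) r := fun r hr => by
          rw [Function.update_of_ne hr.ne]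
        refine ⟨Function.update θ k (e, b), fun r hr => ?_, fun a ha => ?_⟩
        · rcases Nat.lt_succ_iff_lt_or_eq.mp hr with h' | rfl
          · rw [← up_congr (fun q hq => hlt q (hq.trans h')),
              ← down_congr (fun q hq => hlt q (hq.trans h')), ← hlt r h']
            exact hθ r h'
          · rw [← up_congr hlt, ← down_congr hlt, Function.update_self]
            exact ⟨he, hb, hmax⟩
        · have := hst₃ a ha
          rw [up, down, Finset.prod_range_succ, Finset.prod_range_succ, Function.update_self]
          change _ = d.up q _ k a * _ ∧ _ = d.down q _ k a * _
          rw [← up_congr hlt, ← down_congr hlt]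
          exact this
      · rintro s' hag ⟨θ, hθ, hst⟩
        exact ⟨θ, hθ, hst⟩
  refine wp_mono ?_ (wp_agree key)
  rintro s' ⟨⟨θ, h1, h2⟩, hag⟩
  refine hQ s' ⟨fun r hr => hag.1 r ?_, fun j hj => hag.2 j ?_⟩ θ h1 h2
  · simp [fit, select, score, descend, monomial, regs] at hr ⊢
    omega
  · simp [fit, select, score, descend, monomial, arrs] at hj ⊢
    omega

theorem wp_compare (hd : d.Valid) {Q : State → Prop} {U V U' V' : ℕ → ℤ}
    (hs : d.Holds s) (hA : d.Stores 0 U V s) (hA' : d.Stores 2 U' V' s)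
    (hU : ∀ a < d.m, 0 < U a ∧ 0 < V a) (hU' : ∀ a < d.m, 0 < U' a ∧ 0 < V' a)
    (hQ : ∀ s', Agree [15, 19, 26] [] s s' → s'.reg 26 = d.stat U V U' V' d.m → Q s') :
    compare.wp d.I d.P d.X d.W Q s := by
  have key : compare.wp d.I d.P d.X d.W (fun s' => s'.reg 26 = d.stat U V U' V' d.m) s := by
    unfold compare
    rw [wp_seq, wp_set]
    refine ⟨by norm_num, trivial, by simp [Term.eval], ?_⟩
    refine wp_loop (fun k s' => s'.reg 26 = d.stat U V U' V' k) (by norm_num)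
      (by simp [regs]) (by norm_num [Term.Safe]) d.m (by simp [Term.eval, hs.r1]) hd.hX₃
      (by simp [Term.eval, stat]) ?_ ?_
    · intro k hk s' hag h26
      have hs' : d.Holds s' := (hs.set (r := 26) (by norm_num) _).agree hag (by simp [regs])
      have harr : s'.arr = s.arr := funext fun j => hag.2 j (by simp [arrs])
      obtain ⟨a0, a1⟩ := hA k hk
      obtain ⟨a2, a3⟩ := hA' k hk
      have h1 := abs_pred_le (d := d) (hU k hk).1 (hU k hk).2
      have h2 := abs_pred_le (d := d) (hU' k hk).1 (hU' k hk).2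
      have h3 := abs_sub (d.pred U V k) (d.pred U' V' k)
      have hb : ∀ l ≤ d.m, |d.stat U V U' V' l| ≤ d.W := by
        intro l hl
        have h : |d.stat U V U' V' l| ≤ ∑ a ∈ Finset.range l, (2 * d.H : ℤ) := by
          refine (Finset.abs_sum_le_sum_abs _ _).trans <| Finset.sum_le_sum fun a ha => ?_
          have ha' : a < d.m := (Finset.mem_range.mp ha).trans_le hl
          have h1 := abs_pred_le (d := d) (hU a ha').1 (hU a ha').2
          have h2 := abs_pred_le (d := d) (hU' a ha').1 (hU' a ha').2
          have h3 := abs_sub (d.pred U V a) (d.pred U' V' a)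
          rw [abs_abs]; linarith
        rw [Finset.sum_const, Finset.card_range, nsmul_eq_mul] at h
        have h1 : (l : ℤ) * (2 * d.H) ≤ d.m * (2 * d.H) := by gcongr
        have h2 : (d.m : ℤ) * (2 * d.H) ≤ d.W := by exact_mod_cast hd.hW₃
        omega
      have hW := hb (k + 1) hk
      have hval : d.stat U V U' V' (k + 1) =
          d.stat U V U' V' k + |d.pred U V k - d.pred U' V' k| := by
        rw [stat, Finset.sum_range_succ]; rfl
      rw [hval] at hW
      have hdW : |d.pred U V k - d.pred U' V' k| ≤ d.W := by
        have h4 : 2 * d.H ≤ d.W := by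
          have := hd.hW₃
          have : 1 ≤ d.m := by omega
          nlinarith
        have : (2 * d.H : ℤ) ≤ d.W := by exact_mod_cast h4
        linarith
      have hpred : (Term.sub (prediction 0) (prediction 2)).eval d.I (s'.set 19 k) =
          d.pred U V k - d.pred U' V' k := by
        simp [prediction, Term.eval, pred, harr, hs'.r11, a0, a1, a2, a3]
      rw [wp_seq, wp_set, hpred]
      refine ⟨by norm_num, by simp [prediction, Term.Safe, Term.eval], hdW, ?_⟩
      rw [wp_ite, wp_set, wp_set]
      generalize d.pred U V k - d.pred U' V' k = v at *
      simp only [Term.eval, Term.Safe, State.set_reg, reduceIte, Nat.reduceEqDiff, Nat.reduceLT,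
        true_and, h26, hval]
      refine ⟨fun h => ?_, fun h => ?_⟩
      · rw [abs_of_pos h] at hW ⊢
        exact ⟨hW, rfl⟩
      · rw [abs_of_nonpos h, ← sub_eq_add_neg] at hW ⊢
        exact ⟨hW, rfl⟩
    · intro s' _ h
      simpa using h
  refine wp_mono (fun s' hs' => hQ s' ⟨fun r hr => hs'.2.1 r ?_, hs'.2.2⟩ hs'.1) (wp_agree key)
  simp [compare, regs] at hr ⊢
  omega

theorem wp_powTwo {Q : State → Prop} {r k : ℕ} {e : Term} (hr : r < 18)
    (he : e.Safe d.P d.I (s.set r 1)) (hk : e.eval d.I (s.set r 1) = k) (hkX : k ≤ d.X)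
    (hkW : 2 ^ k ≤ d.W)
    (hQ : ∀ s', Agree [r, 18] [] s s' → s'.reg r = (2 ^ k : ℕ) → Q s') :
    (powTwo r e).wp d.I d.P d.X d.W Q s := by
  have hW : 1 ≤ d.W := (Nat.one_le_two_pow).trans hkW
  have key : (powTwo r e).wp d.I d.P d.X d.W (fun s' => s'.reg r = (2 ^ k : ℕ)) s := by
    unfold powTwo
    rw [wp_seq, wp_set]
    refine ⟨by omega, trivial, by simpa [Term.eval] using hW, ?_⟩
    refine wp_loop (fun l s' => s'.reg r = (2 ^ l : ℕ)) (by norm_num)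
      (by simp only [regs, List.mem_singleton]; omega)
      he k hk hkX (by simp [Term.eval]) ?_ ?_
    · intro l hl s' _ h
      have hne : r ≠ 18 := by omega
      have h2 : 2 ^ (l + 1) ≤ d.W := (Nat.pow_le_pow_right (by norm_num) hl).trans hkW
      have h3 : ((2 ^ (l + 1) : ℕ) : ℤ) = s'.reg r * 2 := by rw [h, pow_succ]; push_cast; rfl
      rw [wp_set]
      simp only [Term.eval, Term.Safe, State.set_reg, hne, if_false, if_true, ← h3]
      exact ⟨by omega, ⟨by omega, trivial⟩, by rw [Nat.abs_cast]; exact_mod_cast h2, trivial⟩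
    · intro s' _ h
      simpa [show r ≠ 18 by omega] using h
  refine wp_mono (fun s' hs' => hQ s' ⟨fun q hq => hs'.2.1 q ?_, hs'.2.2⟩ hs'.1) (wp_agree key)
  simp [powTwo, regs] at hq ⊢
  omega

theorem wp_dictionarySize (hd : d.Valid) {Q : State → Prop} (hs : d.Base s)
    (hQ : ∀ s', Agree [13, 18] [] s s' → s'.reg 13 = (d.n ^ d.D : ℕ) → Q s') :
    dictionarySize.wp d.I d.P d.X d.W Q s := by
  have hW := hd.one_le_W
  have key : dictionarySize.wp d.I d.P d.X d.W (fun s' => s'.reg 13 = (d.n ^ d.D : ℕ)) s := by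
    unfold dictionarySize
    rw [wp_seq, wp_set]
    refine ⟨by norm_num, trivial, by simpa [Term.eval] using hW, ?_⟩
    refine wp_loop (fun l s' => s'.reg 13 = (d.n ^ l : ℕ)) (by norm_num) (by simp [regs])
      (by norm_num [Term.Safe]) d.D (by simp [Term.eval, hs.r4]) hd.hX₄ (by simp [Term.eval]) ?_ ?_
    · intro l hl s' hag h
      have h2 : d.n ^ (l + 1) ≤ d.W :=
        (Nat.pow_le_pow_right hd.hn hl).trans (hd.hX₁.trans hd.hW₁)
      have h0 : s'.reg 0 = d.n := by rw [hag.1 0 (by simp [regs])]; simp [hs.r0]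
      have h3 : ((d.n ^ (l + 1) : ℕ) : ℤ) = s'.reg 13 * d.n := by
        rw [h, pow_succ]; push_cast; rfl
      rw [wp_set]
      simp only [Term.eval, Term.Safe, State.set_reg, Nat.reduceEqDiff, reduceIte, h0, ← h3]
      exact ⟨by norm_num, by norm_num, by rw [Nat.abs_cast]; exact_mod_cast h2, trivial⟩
    · intro s' _ h
      simpa using h
  refine wp_mono (fun s' hs' => hQ s' ⟨fun q hq => hs'.2.1 q ?_, hs'.2.2⟩ hs'.1) (wp_agree key)
  simp [dictionarySize, regs] at hq ⊢
  omega

theorem eval_power (I : ℕ → ℤ) (t : Term) (k : ℕ) : (t.power k).eval I s = t.eval I s ^ k := by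
  induction k with
  | zero => simp [Term.power, Term.eval]
  | succ k ih => rw [Term.power, Term.eval, ih, pow_succ]

theorem safe_power {P : ℕ} {I : ℕ → ℤ} {t : Term} (h : t.Safe P I s) (k : ℕ) :
    (t.power k).Safe P I s := by
  induction k with
  | zero => trivial
  | succ k ih => exact ⟨ih, h⟩

/-- The outcome of the test is determined by two greedy sequences. -/
def Outcome (d : TestData) (v : ℤ) : Prop :=
  ∃ θ θ', d.Greedy d.i θ d.T ∧ d.Greedy d.j θ' d.T ∧
    v = if 0 < ((d.e : ℤ) - 1) * (d.stat (d.up d.i θ d.T) (d.down d.i θ d.T)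
      (d.up d.j θ' d.T) (d.down d.j θ' d.T) d.m * d.Z - d.m * d.H) then 1 else 0

theorem wp_pairTest (hd : d.Valid) {Q : State → Prop} (hs : d.Base s)
    (hQ : ∀ s', Agree ((List.range 28).drop 8) [0, 1, 2, 3] s s' → d.Outcome (s'.reg 27) → Q s') :
    pairTest.wp d.I d.P d.X d.W Q s := by
  have hW : (1 : ℤ) ≤ d.W := by exact_mod_cast hd.one_le_W
  have hHW : d.H ≤ d.W := by
    have h1 := hd.hW₂
    have h2 : 1 ≤ (d.H + 1) ^ d.T := Nat.pow_pos (Nat.succ_pos d.H)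
    nlinarith
  have hAH : 2 ^ d.D ≤ d.H := by
    unfold H
    exact Nat.le_self_pow (by norm_num) _
  have hTW : d.T ≤ d.W := hd.hX₂.trans hd.hW₁
  have key : pairTest.wp d.I d.P d.X d.W (fun s' => d.Outcome (s'.reg 27)) s := by
    unfold pairTest
    rw [wp_seq]
    refine wp_powTwo (k := d.D) (by norm_num) (by norm_num [Term.Safe])
      (by simp [Term.eval, hs.r4]) hd.hX₄ (hAH.trans hHW) fun s₁ ag₁ h8 => ?_
    have hs₁ := hs.agree ag₁ (by simp)
    rw [wp_seq]
    have hdiv : d.D / d.L ≤ d.D := Nat.div_le_self _ _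
    refine wp_powTwo (k := d.D / d.L) (by norm_num) (by norm_num [Term.Safe])
      (by simp [Term.eval, hs₁.r4, hs₁.r5]) (hdiv.trans hd.hX₄)
      (((Nat.pow_le_pow_right (by norm_num) hdiv).trans hAH).trans hHW) fun s₂ ag₂ h9 => ?_
    have hs₂ := hs₁.agree ag₂ (by simp)
    have h8₂ : s₂.reg 8 = (2 ^ d.D : ℕ) := by rw [ag₂.1 8 (by simp), h8]
    have e11 : (Term.power (.reg 8) 9).eval d.I s₂ = d.H := by
      rw [eval_power, Term.eval, h8₂, H]; push_cast; rfl
    rw [wp_seq, wp_set, e11, wp_seq, wp_set]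
    have e10 : (Term.power (.reg 8) 16).eval d.I (s₂.set 11 d.H) = d.T := by
      rw [eval_power, Term.eval, State.set_reg, if_neg (by norm_num), h8₂, T]; push_cast; rfl
    rw [e10]
    refine ⟨by norm_num, safe_power (by norm_num [Term.Safe]) _,
      by rw [Nat.abs_cast]; exact_mod_cast hHW, by norm_num,
      safe_power (by norm_num [Term.Safe]) _, by rw [Nat.abs_cast]; exact_mod_cast hTW, ?_⟩
    have hs₃ : d.Base ((s₂.set 11 d.H).set 10 d.T) := (hs₂.set (by norm_num) _).set (by norm_num) _
    rw [wp_seq]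
    refine wp_dictionarySize hd hs₃ fun s₄ ag₄ h13 => ?_
    have hs₄ : d.Holds s₄ := by
      refine ⟨hs₃.agree ag₄ (by simp), ?_, ?_, ?_, h13⟩
      · rw [ag₄.1 9 (by simp)]; exact h9
      · rw [ag₄.1 10 (by simp)]; simp
      · rw [ag₄.1 11 (by simp)]; simp
    rw [wp_seq]
    refine wp_fit hd (q := d.i) hs₄ (by norm_num) (by norm_num) hs₄.r2 fun s₅ ag₅ θ hθ st₅ => ?_
    have hs₅ := hs₄.agree ag₅ (by simp)
    rw [wp_seq]
    refine wp_fit hd (q := d.j) hs₅ (by norm_num) (by norm_num) hs₅.r3 fun s₆ ag₆ θ' hθ' st₆ => ?_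
    have hs₆ := hs₅.agree ag₆ (by simp)
    have st₆' := Stores.agree st₅ ag₆ (by simp) (by simp)
    rw [wp_seq]
    refine wp_compare hd hs₆ st₆' st₆
      (fun a ha => ⟨(up_bounds hd ha fun r hr => (hθ r hr).2.1).1,
        (down_bounds hd ha fun r hr => (hθ r hr).2.1).1⟩)
      (fun a ha => ⟨(up_bounds hd ha fun r hr => (hθ' r hr).2.1).1,
        (down_bounds hd ha fun r hr => (hθ' r hr).2.1).1⟩) fun s₇ ag₇ h26 => ?_
    have hs₇ := hs₆.agree ag₇ (by simp)
    rw [wp_ite, wp_set, wp_set]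
    simp only [Term.eval, Term.Safe, State.set_reg, reduceIte, Nat.reduceLT, true_and, h26, hs₇.r1,
      hs₇.r6, hs₇.r9, hs₇.r11]
    refine ⟨fun h => ⟨by simpa using hW, θ, θ', hθ, hθ', ?_⟩,
      fun h => ⟨by simp, θ, θ', hθ, hθ', ?_⟩⟩
    · rw [if_pos h]
    · rw [if_neg (not_lt.mpr h)]
  refine wp_mono (fun s' hs' => hQ s' ⟨fun r hr => hs'.2.1 r ?_, fun j hj => hs'.2.2 j ?_⟩ hs'.1)
    (wp_agree key)
  · contrapose! hr
    have h : pairTest.regs ⊆ (List.range 28).drop 8 := by decide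
    exact h hr
  · contrapose! hj
    have h : pairTest.arrs ⊆ [0, 1, 2, 3] := by decide
    exact h hj

end TestData

end RAM

namespace RAM

open Cmd

/-- The address of the first free cell: it is at least `8 + n m + n²`. -/
def firstFree : Expr :=
  .add (.const 8) (.add (.mul (.load (.const 0)) (.load (.const 1)))
    (.mul (.load (.const 0)) (.load (.const 0))))

/-- Reads the parameters of the test of a pair, and runs the test. -/
def testMain : Cmd :=
  .seq (.set 0 (.inp (.const 0))) <| .seq (.set 1 (.inp (.const 1))) <|
  .seq (.set 2 (.inp (.const 2))) <| .seq (.set 3 (.inp (.const 3))) <|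
  .seq (.set 4 (.inp (.const 4))) <|
  .seq (.set 5 (.mul (.const 8) (.add (.inp (.const 6)) (.const 2)))) <|
  .seq (.set 6 (.inp (.const 7))) <| .seq (.set 7 (.const 8)) pairTest

/-- The program testing a pair. -/
def testProgram : Program :=
  .seq (.store (.const 5) firstFree) <| .seq (testMain.compile 5) <|
    .store (.const 0) (.load (offset 5 27))

/-- Reads the parameters of the recovery algorithm, and runs the test for all pairs. -/
def recoveryMain : Cmd :=
  .seq (.set 0 (.inp (.const 0))) <| .seq (.set 1 (.inp (.const 1))) <|
  .seq (.set 4 (.inp (.const 2))) <|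
  .seq (.set 5 (.mul (.const 8) (.add (.inp (.const 4)) (.const 2)))) <|
  .seq (.set 6 (.inp (.const 5))) <| .seq (.set 7 (.const 6)) <|
  .loop 2 (.reg 0) <| .loop 3 (.reg 0) <|
    .ite (.mul (.sub (.reg 2) (.reg 3)) (.sub (.reg 2) (.reg 3)))
      (.seq pairTest (.put 6 (.add (.mul (.reg 0) (.reg 2)) (.reg 3)) (.reg 27))) .skip

/-- Copies the result to the first cells. -/
def copyLoop : Program :=
  .while (.sub (.load (.const 1)) (.const 1)) <|
    .seq (.store (.load (.const 1))
      (.load (.add (.load (.const 0)) (.mul (.const 8) (.load (.const 1))))))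
    (.store (.const 1) (.sub (.load (.const 1)) (.const 1)))

/-- The program recovering the structure. -/
def recoveryProgram : Program :=
  .seq (.store (.const 3) firstFree) <| .seq (recoveryMain.compile 3) <|
  .seq (.store (.const 1) (.sub (.mul (.load (offset 3 0)) (.load (offset 3 0))) (.const 1))) <|
  .seq (.store (.const 0) (offset 3 70)) <| .seq copyLoop <|
  .seq (.store (.const 1) (.load (.add (.load (.const 0)) (.const 8)))) <|
    .store (.const 0) (.const 0)

theorem length_le_inputSize (l : List ℤ) : l.length ≤ inputSize l := by
  induction l with
  | nil => simp [inputSize]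
  | cons a l ih =>
    have := bitLen_pos a
    simp only [inputSize, List.map_cons, List.sum_cons, List.length_cons] at ih ⊢
    omega

theorem abs_initial_lt (l : List ℤ) (k : ℕ) : |initial l k| < 2 ^ inputSize l := by
  rw [← bitLen_le_iff]
  unfold initial
  rcases lt_or_ge k l.length with h | h
  · rw [List.getD_eq_getElem _ _ h]
    have : bitLen l[k] ≤ (l.map bitLen).sum :=
      List.single_le_sum (by simp) _ (List.mem_map_of_mem (List.getElem_mem h))
    exact this.trans (Nat.le_succ _)
  · rw [List.getD_eq_default _ _ h]
    simp [bitLen]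

/-- The state in which all registers and arrays are `0`. -/
def State.zero : State := ⟨fun _ => 0, fun _ _ => 0⟩

theorem rep_initial {l : List ℤ} {β P : ℕ} (hβ : β < P) (hP : l.length ≤ P) :
    Rep β P (Function.update (initial l) β P) (Function.update (initial l) β P) State.zero where
  lt := hβ
  ptr := Function.update_self _ _ _
  inp _ _ := rfl
  reg r _ := by
    rw [Function.update_of_ne (by omega), initial, List.getD_eq_default _ _ (by omega)]; rfl
  arr j _ k := by
    rw [Function.update_of_ne (by omega), initial, List.getD_eq_default _ _ (by omega)]; rfl

/-- The bound for the values. -/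
def valueBound (G : ℕ) : ℕ := 2 ^ (20 * G ^ 17)

theorem bitLen_valueBound_le {G : ℕ} (hG : 1 ≤ G) : bitLen (valueBound G) ≤ 22 * G ^ 17 := by
  have : bitLen (valueBound G : ℤ) = 20 * G ^ 17 + 2 := by
    rw [bitLen, valueBound, Int.natAbs_natCast, Nat.size_pow]; ring
  have := Nat.pow_pos (n := 17) hG
  omega

theorem le_valueBound {G k : ℕ} (h : k ≤ 20 * G ^ 17) : k ≤ valueBound G :=
  h.trans Nat.lt_two_pow_self.le

theorem pow_mono_right {G a b : ℕ} (hG : 1 ≤ G) (h : a ≤ b) : G ^ a ≤ G ^ b :=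
  Nat.pow_le_pow_right hG h

/-- The data of a test satisfy the assumptions. -/
theorem TestData.valid_of {I : ℕ → ℤ} {P n m D i j st L e N : ℕ} (hn : 2 ≤ n) (hD : 1 ≤ D)
    (hi : i < n) (hj : j < n) (hN : n * m ≤ N) (hN' : 1 ≤ N)
    (hx : ∀ a < m, ∀ r < n, I (st + (a * n + r)) = 1 ∨ I (st + (a * n + r)) = -1)
    (hP : st + n * m ≤ P) :
    TestData.Valid ⟨I, P, (n ^ D * N) ^ 16, valueBound (n ^ D * N), n, m, D, i, j, st, L, e⟩ := by
  have h2 : 2 ^ D ≤ n ^ D := Nat.pow_le_pow_left hn D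
  have hD2 : D < 2 ^ D := Nat.lt_two_pow_self
  have hnD : 1 ≤ n ^ D := Nat.one_le_two_pow.trans h2
  set G := n ^ D * N with hGdef
  have hG : n ^ D ≤ G := Nat.le_mul_of_pos_right _ hN'
  have hNG : N ≤ G := Nat.le_mul_of_pos_left _ hnD
  have hG1 : 1 ≤ G := hnD.trans hG
  have hGX : G ≤ G ^ 16 := Nat.le_self_pow (by norm_num) G
  have hm : m ≤ N := (Nat.le_mul_of_pos_left m (by omega)).trans hN
  have hT : (2 ^ D) ^ 16 ≤ G ^ 16 := Nat.pow_le_pow_left (h2.trans hG) 16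
  have hDG : D ≤ G := by omega
  have h17 : G ^ 17 = G * G ^ 16 := by ring
  have hDT : D * (2 ^ D) ^ 16 ≤ G ^ 17 := by rw [h17]; exact Nat.mul_le_mul hDG hT
  have hT1 : 1 ≤ (2 ^ D) ^ 16 := Nat.pow_pos (Nat.pow_pos (by norm_num))
  have hXG : G ^ 16 ≤ G ^ 17 := pow_mono_right hG1 (by norm_num)
  constructor <;> dsimp only
  · omega
  · omega
  · exact hi
  · exact hj
  · exact hx
  · intro a ha r hr
    have : (a + 1) * n ≤ m * n := Nat.mul_le_mul_right _ ha
    have e : m * n = n * m := Nat.mul_comm _ _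
    have e' : (a + 1) * n = a * n + n := by ring
    omega
  · exact hG.trans hGX
  · exact hT
  · omega
  · omega
  · exact le_valueBound (by omega)
  · have hH : (2 ^ D) ^ 9 = 2 ^ (9 * D) := by rw [← pow_mul, mul_comm]
    have hH1 : 2 ^ (9 * D) + 1 ≤ 2 ^ (9 * D + 1) := by
      have := Nat.one_le_two_pow (n := 9 * D); rw [pow_succ]; omega
    unfold TestData.H TestData.T valueBound
    dsimp only
    rw [hH]
    calc 2 ^ (9 * D) * (2 * (2 ^ (9 * D) + 1) ^ (2 ^ D) ^ 16)
        ≤ 2 ^ (9 * D) * (2 * (2 ^ (9 * D + 1)) ^ (2 ^ D) ^ 16) := by gcongr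
      _ = 2 ^ (9 * D + 1 + (9 * D + 1) * (2 ^ D) ^ 16) := by
        rw [pow_add, pow_add, pow_mul _ (9 * D + 1)]; ring
      _ ≤ _ := by
        apply Nat.pow_le_pow_right (by norm_num)
        have : (9 * D + 1) * (2 ^ D) ^ 16 ≤ 10 * (D * (2 ^ D) ^ 16) := by
          rw [← mul_assoc]; exact Nat.mul_le_mul_right _ (by omega)
        have : D ≤ D * (2 ^ D) ^ 16 := Nat.le_mul_of_pos_right _ hT1
        omega
  · have hH : (2 ^ D) ^ 9 ≤ G ^ 9 := Nat.pow_le_pow_left (h2.trans hG) 9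
    unfold TestData.H
    dsimp only
    refine le_valueBound ?_
    calc m * (2 * (2 ^ D) ^ 9) ≤ G * (2 * G ^ 9) := by gcongr; omega
      _ = 2 * G ^ 10 := by ring
      _ ≤ 20 * G ^ 17 := Nat.mul_le_mul (by norm_num) (pow_mono_right hG1 (by norm_num))

theorem eval_firstFree {l : List ℤ} {n m : ℕ} (h0 : initial l 0 = n) (h1 : initial l 1 = m) :
    firstFree.eval (initial l) = ((8 + (n * m + n * n) : ℕ) : ℤ) := by
  simp [firstFree, Expr.eval, h0, h1]

/-- The time for three consecutive blocks is polynomial in `G`. -/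
theorem time_le_pow {c d k G t : ℕ} (hG : 1 ≤ G) (Y : ℕ) (hY : Y ≤ 22 * G ^ 17)
    (ht : t ≤ k * Y + c * Y * (G ^ 16) ^ d) :
    t ≤ (22 * (k + c) + (17 + 16 * d)) * G ^ (22 * (k + c) + (17 + 16 * d)) := by
  have h1 : 1 ≤ G ^ (16 * d) := Nat.pow_pos hG
  calc t ≤ k * Y + c * Y * (G ^ 16) ^ d := ht
    _ ≤ k * (22 * G ^ 17) * G ^ (16 * d) + c * (22 * G ^ 17) * G ^ (16 * d) := by
      rw [← pow_mul]
      refine Nat.add_le_add ?_ (by gcongr)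
      exact (Nat.mul_le_mul_left k hY).trans (Nat.le_mul_of_pos_right _ h1)
    _ = 22 * (k + c) * G ^ (17 + 16 * d) := by rw [pow_add]; ring
    _ ≤ _ := Nat.mul_le_mul (by omega) (pow_mono_right hG (by omega))

/-- The data of the test of a pair. -/
noncomputable def testData (n m D l₂ e i j : ℕ) (input : List ℤ) : TestData :=
  ⟨Function.update (initial input) 5 (8 + (n * m + n * n) : ℕ), 8 + (n * m + n * n),
    (n ^ D * inputSize input) ^ 16, valueBound (n ^ D * inputSize input),
    n, m, D, i, j, 8, 8 * (l₂ + 2), e⟩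

theorem exists_test_halts : ∃ C₀ : ℕ, ∀ (n m D i j l₁ l₂ e : ℕ) (S : List ℤ), 2 ≤ n → 1 ≤ D →
    i < n → j < n → S.length = n * m → (∀ z ∈ S, z = 1 ∨ z = -1) →
    ∀ input : List ℤ, input = [(n : ℤ), m, i, j, D, l₁, l₂, e] ++ S →
    HaltsWithin testProgram input (C₀ * (n ^ D * inputSize input) ^ C₀) fun σ =>
      (testData n m D l₂ e i j input).Outcome (σ 0) := by
  obtain ⟨c, d, hcd⟩ := exists_time_le 5 testMain
  set k₁ := storeCost (.const 5) firstFree with hk₁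
  set k₂ := storeCost (.const 0) (.load (offset 5 27)) with hk₂
  refine ⟨22 * (k₁ + k₂ + c) + (17 + 16 * d), ?_⟩
  intro n m D i j l₁ l₂ e S hn hD hi hj hS hpm input hin
  set N := inputSize input with hN
  have hlen : input.length = 8 + n * m := by rw [hin]; simp [hS]; omega
  have hNl : 8 + n * m ≤ N := hlen ▸ length_le_inputSize input
  set P := 8 + (n * m + n * n) with hPdef
  have hget : ∀ k < n * m, initial input (8 + k) = S.getD k 0 := by
    intro k hk; rw [hin, initial, List.getD_append_right _ _ _ _ (by simp)]; simp
  have hv : (testData n m D l₂ e i j input).Valid := by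
    refine TestData.valid_of hn hD hi hj (by omega) (by omega) (fun a ha r hr => ?_) (by omega)
    have : (a + 1) * n ≤ m * n := Nat.mul_le_mul_right _ ha
    have e' : (a + 1) * n = a * n + n := by ring
    have e'' : m * n = n * m := Nat.mul_comm _ _
    rw [Function.update_of_ne (by omega), hget _ (by omega)]
    rw [List.getD_eq_getElem _ _ (by omega)]
    exact hpm _ (List.getElem_mem _)
  set G := n ^ D * N with hG
  have hnD : n ≤ n ^ D := Nat.le_self_pow (by omega) n
  have hnG : n ≤ G := hnD.trans (Nat.le_mul_of_pos_right _ (by omega))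
  have hNG : N ≤ G := Nat.le_mul_of_pos_left _ (by omega)
  have hG1 : 1 ≤ G := by omega
  have hGG : G * G ≤ G ^ 17 := by rw [← pow_two]; exact pow_mono_right hG1 (by norm_num)
  have hG17 : G ≤ G ^ 17 := Nat.le_self_pow (by norm_num) G
  have hW := bitLen_valueBound_le hG1
  have hNW : 2 ^ (N + 5) ≤ valueBound G := Nat.pow_le_pow_right (by norm_num) (by omega)
  have hinp : ∀ k, |initial input k| ≤ valueBound G := fun k => by
    have h1 := abs_initial_lt input k
    have h2 : 2 ^ N ≤ valueBound G := (Nat.pow_le_pow_right (by norm_num) (by omega)).trans hNW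
    have h3 : ((2 ^ N : ℕ) : ℤ) ≤ valueBound G := by exact_mod_cast h2
    push_cast at h3
    exact h1.le.trans h3
  have hPW : P ≤ valueBound G := by
    refine le_valueBound ?_
    have : n * n ≤ G * G := Nat.mul_le_mul hnG hnG
    omega
  have i0 : initial input 0 = n := by rw [hin]; rfl
  have i1 : initial input 1 = m := by rw [hin]; rfl
  have i2 : initial input 2 = i := by rw [hin]; rfl
  have i3 : initial input 3 = j := by rw [hin]; rfl
  have i4 : initial input 4 = D := by rw [hin]; rfl
  have i6 : initial input 6 = l₂ := by rw [hin]; rfl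
  have i7 : initial input 7 = e := by rw [hin]; rfl
  have hY := bitLen_pos (valueBound G : ℤ)
  obtain ⟨t₁, ht₁, x₁⟩ := exec_store hY (Cmd.bitLen_le_of_abs_le hinp) (.const 5) firstFree
  rw [eval_firstFree i0 i1] at x₁
  have hrep := rep_initial (l := input) (β := 5) (P := P) (by omega) (by omega)
  have hb₁ := abs_update_le hinp 5 (z := (P : ℤ)) (by rw [Nat.abs_cast]; exact_mod_cast hPW)
  have hwp : testMain.wp (Function.update (initial input) 5 (P : ℤ)) P (G ^ 16) (valueBound G)
      (fun s' => (testData n m D l₂ e i j input).Outcome (s'.reg 27)) State.zero := by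
    have hb : ∀ k, k ≠ 5 → Function.update (initial input) 5 (P : ℤ) k = initial input k :=
      fun k hk => Function.update_of_ne hk _ _
    have h8 : |(8 : ℤ) * (l₂ + 2)| ≤ valueBound G := by
      have h1 := abs_initial_lt input 6
      rw [i6, Nat.abs_cast] at h1
      have h2 : (1 : ℤ) ≤ 2 ^ inputSize input := one_le_pow₀ (by norm_num)
      have h3 : ((2 ^ (N + 5) : ℕ) : ℤ) ≤ valueBound G := by exact_mod_cast hNW
      rw [abs_of_nonneg (by positivity)]
      push_cast [pow_add] at h3
      linarith
    have hc8 : (8 : ℤ) ≤ valueBound G := by exact_mod_cast (show 8 ≤ P by omega).trans hPW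
    unfold testMain
    simp only [wp_seq, wp_set, Term.eval, Term.Safe, Int.reduceToNat,
      and_true, Nat.reduceLT, true_and]
    rw [hb 0 (by norm_num), hb 1 (by norm_num), hb 2 (by norm_num), hb 3 (by norm_num),
      hb 4 (by norm_num), hb 6 (by norm_num), hb 7 (by norm_num), i0, i1, i2, i3, i4, i6, i7]
    refine ⟨by omega, i0 ▸ hinp 0, by omega, i1 ▸ hinp 1, by omega,
      i2 ▸ hinp 2, by omega, i3 ▸ hinp 3, by omega, i4 ▸ hinp 4, by omega, h8, by omega,
      i7 ▸ hinp 7, by rw [abs_of_nonneg (by norm_num)]; exact hc8, ?_⟩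
    exact TestData.wp_pairTest hv (by constructor <;> simp [testData]) fun s' _ h => h
  obtain ⟨t₂, σ₂, s₂, x₂, ht₂, r₂, b₂, q₂, -⟩ := exec_of_wp
    ((hv.hW₁ : G ^ 16 ≤ valueBound G)) hwp hrep hb₁
  obtain ⟨t₃, ht₃, x₃⟩ := exec_store hY (Cmd.bitLen_le_of_abs_le b₂) (.const 0)
    (.load (offset 5 27))
  refine ⟨_, _, ?_, .seq x₁ (.seq x₂ x₃), ?_⟩
  · refine time_le_pow hG1 _ hW ?_
    have h := hcd (bitLen (valueBound G)) (G ^ 16) hY (Nat.pow_pos hG1)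
    change t₂ ≤ testMain.time 5 (bitLen (valueBound G)) (G ^ 16) at ht₂
    rw [← hk₁] at ht₁
    rw [← hk₂] at ht₃
    rw [add_mul]
    omega
  · have : ((Expr.load (offset 5 27)).eval σ₂) = s₂.reg 27 := by
      rw [Expr.eval, r₂.eval_offset, r₂.reg 27 (by norm_num)]
    rw [this]
    simpa [Expr.eval] using q₂

end RAM

namespace RAM

open Cmd

/-- The data of the test of a pair in the recovery algorithm. -/
noncomputable def recoveryData (n m D l₂ e i j : ℕ) (input : List ℤ) : TestData :=
  ⟨Function.update (initial input) 3 (8 + (n * m + n * n) : ℕ), 8 + (n * m + n * n),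
    (n ^ D * inputSize input) ^ 16, valueBound (n ^ D * inputSize input),
    n, m, D, i, j, 6, 8 * (l₂ + 2), e⟩

theorem TestData.Outcome.zero_or_one {d : TestData} {v : ℤ} (h : d.Outcome v) : v = 0 ∨ v = 1 := by
  obtain ⟨_, _, _, _, h⟩ := h
  split_ifs at h
  exacts [Or.inr h, Or.inl h]

theorem exec_copyLoop {W : ℕ} (B : ℕ) (k : ℕ) (hB : k < B) : ∀ σ : Memory, σ 0 = B → σ 1 = k →
    (∀ c, |σ c| ≤ W) → B ≤ W → ∃ t σ', Exec copyLoop σ t σ' ∧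
      t ≤ ((Expr.sub (.load (.const 1)) (.const 1)).unitCost +
        storeCost (.load (.const 1)) (.load (.add (.load (.const 0))
          (.mul (.const 8) (.load (.const 1))))) +
        storeCost (.const 1) (.sub (.load (.const 1)) (.const 1))) * bitLen W * (k + 1) ∧
      σ' 0 = B ∧ (∀ c, 2 ≤ c → c ≤ k → σ' c = σ (B + 8 * c)) ∧ (∀ c, k < c → 1 < c → σ' c = σ c) ∧
      ∀ c, |σ' c| ≤ W := by
  have hY := bitLen_pos (W : ℤ)
  induction k with
  | zero =>
    intro σ h0 h1 hb hBW
    have hc := Expr.cost_le hY (Cmd.bitLen_le_of_abs_le hb) (Expr.sub (.load (.const 1)) (.const 1))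
    exact ⟨_, σ, .while_neg (by simp [Expr.eval, h1]),
      hc.trans (by rw [zero_add, mul_one]; exact Nat.mul_le_mul_right _ (by omega)),
      h0, fun c h h' => by omega, fun _ _ _ => rfl, hb⟩
  | succ k ih =>
    intro σ h0 h1 hb hBW
    have hc := Expr.cost_le hY (Cmd.bitLen_le_of_abs_le hb) (Expr.sub (.load (.const 1)) (.const 1))
    rcases Nat.eq_zero_or_pos k with rfl | hk
    · refine ⟨_, σ, .while_neg (by simp [Expr.eval, h1]),
        hc.trans ?_, h0, fun c h h' => by omega, fun _ _ _ => rfl, hb⟩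
      exact (Nat.mul_le_mul_right _ (by omega)).trans (Nat.le_mul_of_pos_right _ (by omega))
    · obtain ⟨t₁, ht₁, x₁⟩ := exec_store hY (Cmd.bitLen_le_of_abs_le hb) (.load (.const 1))
        (.load (.add (.load (.const 0)) (.mul (.const 8) (.load (.const 1)))))
      have e1 : ((Expr.load (.const 1)).eval σ).toNat = k + 1 := by
        simp only [Expr.eval, Int.toNat_one, h1, Int.toNat_natCast]
      have e2 : (Expr.load (.add (.load (.const 0)) (.mul (.const 8) (.load (.const 1))))).eval σ =
          σ (B + 8 * (k + 1)) := by
        simp only [Expr.eval, Int.toNat_one, Int.toNat_zero, h1, h0]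
        congr 1
      rw [e1, e2] at x₁
      have b₁ := abs_update_le hb (k + 1) (hb (B + 8 * (k + 1)))
      obtain ⟨t₂, ht₂, x₂⟩ := exec_store hY (Cmd.bitLen_le_of_abs_le b₁) (.const 1)
        (.sub (.load (.const 1)) (.const 1))
      set σ₁ := Function.update σ (k + 1) (σ (B + 8 * (k + 1))) with hσ₁
      have e3 : (Expr.sub (.load (.const 1)) (.const 1)).eval σ₁ = k := by
        simp only [Expr.eval, Int.toNat_one]
        rw [hσ₁, Function.update_of_ne (by omega), h1]; push_cast; ring
      have e4 : ((Expr.const 1).eval σ₁).toNat = 1 := by simp [Expr.eval]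
      rw [e3, e4] at x₂
      have b₂ := abs_update_le b₁ 1 (z := (k : ℤ)) (by rw [Nat.abs_cast]; exact_mod_cast by omega)
      obtain ⟨t₃, σ₃, x₃, ht₃, g0, g1, g2, b₃⟩ := ih (by omega) (Function.update σ₁ 1 (k : ℤ))
        (by rw [Function.update_of_ne (by omega), hσ₁, Function.update_of_ne (by omega), h0])
        (Function.update_self _ _ _) b₂ hBW
      refine ⟨_, σ₃, .while_pos (by simp [Expr.eval, h1]; omega) (.seq x₁ x₂) x₃, ?_, g0,
        fun c hc hck => ?_, fun c hc hc1 => ?_, b₃⟩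
      · rw [mul_add _ (k + 1) 1, mul_one]
        have := Nat.add_le_add (Nat.add_le_add (Nat.add_le_add hc ht₁) ht₂) ht₃
        rw [← add_assoc]
        refine this.trans (le_of_eq ?_)
        ring
      · rcases Nat.lt_or_ge c (k + 1) with h | h
        · rw [g1 c hc (by omega), Function.update_of_ne (by omega), hσ₁,
            Function.update_of_ne (by omega)]
        · obtain rfl : c = k + 1 := by omega
          rw [g2 (k + 1) (by omega) (by omega), Function.update_of_ne (by omega), hσ₁,
            Function.update_self]
      · rw [g2 c (by omega) hc1, Function.update_of_ne (by omega), hσ₁,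
          Function.update_of_ne (by omega)]

/-- The loop of the recovery algorithm. -/
theorem wp_recovery_loop {n m D l₂ e : ℕ} {input : List ℤ} {s : State}
    (hnX : n ≤ (n ^ D * inputSize input) ^ 16) (hW : 1 ≤ valueBound (n ^ D * inputSize input))
    (hv : ∀ i < n, ∀ j < n, i ≠ j → (recoveryData n m D l₂ e i j input).Valid)
    (h0 : s.reg 0 = n) (h1 : s.reg 1 = m) (h4 : s.reg 4 = D) (h5 : s.reg 5 = (8 * (l₂ + 2) : ℕ))
    (h6 : s.reg 6 = e) (h7 : s.reg 7 = 6) (hz : ∀ k, s.arr 6 k = 0) :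
    (Cmd.loop 2 (.reg 0) <| .loop 3 (.reg 0) <|
      .ite (.mul (.sub (.reg 2) (.reg 3)) (.sub (.reg 2) (.reg 3)))
        (.seq pairTest (.put 6 (.add (.mul (.reg 0) (.reg 2)) (.reg 3)) (.reg 27))) .skip).wp
      (Function.update (initial input) 3 (8 + (n * m + n * n) : ℕ)) (8 + (n * m + n * n))
      ((n ^ D * inputSize input) ^ 16) (valueBound (n ^ D * inputSize input))
      (fun s' => s'.reg 0 = n ∧ ∀ i < n, ∀ j < n, (i = j → s'.arr 6 (n * i + j) = 0) ∧
        (i ≠ j → (recoveryData n m D l₂ e i j input).Outcome (s'.arr 6 (n * i + j)))) s := by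
  have hinj : ∀ i j i' j', j < n → j' < n → n * i + j = n * i' + j' → i = i' ∧ j = j' := by
    intro i j i' j' hj hj' h
    have h2 := congrArg (· % n) h
    simp only [Nat.mul_add_mod, Nat.mod_eq_of_lt hj, Nat.mod_eq_of_lt hj'] at h2
    subst h2
    exact ⟨Nat.eq_of_mul_eq_mul_left (by omega) (by omega : n * i = n * i'), rfl⟩
  set I := Function.update (initial input) 3 ((8 + (n * m + n * n) : ℕ) : ℤ) with hI
  set P := 8 + (n * m + n * n) with hP
  set X := (n ^ D * inputSize input) ^ 16 with hX
  set W := valueBound (n ^ D * inputSize input) with hWdef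
  set body := Cmd.ite (.mul (.sub (.reg 2) (.reg 3)) (.sub (.reg 2) (.reg 3)))
        (.seq pairTest (.put 6 (.add (.mul (.reg 0) (.reg 2)) (.reg 3)) (.reg 27))) .skip with hbody
  have hregs : body.regs ⊆ (List.range 28).drop 8 := by rw [hbody]; decide
  have harrs : body.arrs ⊆ [0, 1, 2, 3, 6] := by rw [hbody]; decide
  have hlow : ∀ r < 8, r ∉ body.regs := fun r hr hm => by
    have := hregs hm
    have h : ∀ q ∈ (List.range 28).drop 8, 8 ≤ q := by decide
    have := h r this
    omega
  let Done (i j : ℕ) (v : ℤ) : Prop :=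
    (i = j → v = 0) ∧ (i ≠ j → (recoveryData n m D l₂ e i j input).Outcome v)
  refine wp_loop (fun k s' => ∀ i < n, ∀ j < n, (i < k → Done i j (s'.arr 6 (n * i + j))) ∧
    (k ≤ i → s'.arr 6 (n * i + j) = 0)) (by norm_num) (fun h => ?_) (by norm_num [Term.Safe]) n
    (by rw [Term.eval, h0]) hnX (fun i _ j _ => ⟨fun h => absurd h (Nat.not_lt_zero i), fun _ => hz _⟩)
    ?_ ?_
  · simp only [regs, List.mem_cons] at h
    exact hlow 2 (by norm_num) (h.resolve_left (by norm_num))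
  · intro k hk s₁ ag₁ inv₁
    have hk₁ : ∀ r < 8, r ≠ 2 → r ≠ 3 → s₁.reg r = s.reg r := fun r hr h2 h3 => ag₁.1 r (by
      simp only [regs, List.mem_cons, not_or]; exact ⟨h2, h3, hlow r hr⟩)
    refine wp_loop (fun l s' => ∀ i < n, ∀ j < n,
      (i < k ∨ i = k ∧ j < l → Done i j (s'.arr 6 (n * i + j))) ∧
      (¬ (i < k ∨ i = k ∧ j < l) → s'.arr 6 (n * i + j) = 0)) (by norm_num)
      (hlow 3 (by norm_num)) (by norm_num [Term.Safe]) n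
      (by rw [Term.eval, State.set_reg, if_neg (by norm_num), hk₁ 0 (by norm_num) (by norm_num)
        (by norm_num), h0]) hnX (fun i hi j hj => ⟨fun h => (inv₁ i hi j hj).1 (by omega),
        fun h => (inv₁ i hi j hj).2 (by omega)⟩) ?_ ?_
    · intro l hl s₂ ag₂ inv₂
      have hk₂ : ∀ r < 8, r ≠ 2 → r ≠ 3 → (s₂.set 3 l).reg r = s.reg r := fun r hr h2 h3 => by
        rw [State.set_reg, if_neg h3, ag₂.1 r (by
          simp only [List.mem_cons, not_or]; exact ⟨h3, hlow r hr⟩), State.set_reg, if_neg h2,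
          hk₁ r hr h2 h3]
      have hr2 : (s₂.set 3 l).reg 2 = k := by
        rw [State.set_reg, if_neg (by norm_num), ag₂.1 2 (by
          simp only [List.mem_cons, not_or]; exact ⟨by norm_num, hlow 2 (by norm_num)⟩)]; simp
      have hr3 : (s₂.set 3 l).reg 3 = l := by simp
      rw [hbody, wp_ite]
      refine ⟨by norm_num [Term.Safe], fun hc => ?_, fun hc => ?_⟩
      · have hne : k ≠ l := by
          rintro rfl; simp only [Term.eval, hr2, hr3, sub_self, mul_zero, lt_self_iff_false] at hc
        rw [wp_seq]
        refine TestData.wp_pairTest (hv k hk l hl hne) ?_ fun s₃ ag₃ h27 => ?_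
        · constructor
          · rw [hk₂ 0 (by norm_num) (by norm_num) (by norm_num), h0]; rfl
          · rw [hk₂ 1 (by norm_num) (by norm_num) (by norm_num), h1]; rfl
          · exact hr2
          · exact hr3
          · rw [hk₂ 4 (by norm_num) (by norm_num) (by norm_num), h4]; rfl
          · rw [hk₂ 5 (by norm_num) (by norm_num) (by norm_num), h5]; rfl
          · rw [hk₂ 6 (by norm_num) (by norm_num) (by norm_num), h6]; rfl
          · rw [hk₂ 7 (by norm_num) (by norm_num) (by norm_num), h7]; rfl
        · have e0 : s₃.reg 0 = n := by
            rw [ag₃.1 0 (by decide), hk₂ 0 (by norm_num) (by norm_num) (by norm_num), h0]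
          have e2 : s₃.reg 2 = k := by rw [ag₃.1 2 (by decide), hr2]
          have e3 : s₃.reg 3 = l := by rw [ag₃.1 3 (by decide), hr3]
          have e6 : s₃.arr 6 = s₂.arr 6 := by rw [ag₃.2 6 (by decide)]; rfl
          have hidx : ((n : ℤ) * k + l).toNat = n * k + l := by
            have : (n : ℤ) * k + l = ((n * k + l : ℕ) : ℤ) := by push_cast; rfl
            rw [this, Int.toNat_natCast]
          rw [wp_put]
          simp only [Term.eval, Term.Safe, e0, e2, e3, hidx, State.put_arr, e6]
          refine ⟨by norm_num, by norm_num, by norm_num, by positivity, ?_, fun i hi j hj => ?_⟩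
          · have hW' : (1 : ℤ) ≤ W := by exact_mod_cast hW
            rcases h27.zero_or_one with h | h <;> rw [h] <;> simp <;> omega
          · by_cases hij : i = k ∧ j = l
            · obtain ⟨rfl, rfl⟩ := hij
              simp only [and_self, if_true]
              exact ⟨fun _ => ⟨fun h => absurd h hne, fun _ => h27⟩,
                fun h => absurd (Or.inr ⟨trivial, Nat.lt_succ_self _⟩) h⟩
            · have : n * i + j ≠ n * k + l := fun h => hij (hinj i j k l hj hl h)
              simp only [this, and_false, if_false]
              exact ⟨fun h => (inv₂ i hi j hj).1 (by omega), fun h => (inv₂ i hi j hj).2 (by omega)⟩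
      · have hkl : k = l := by
          simp only [Term.eval, hr2, hr3] at hc
          by_contra hne
          have : ((k : ℤ) - l) ≠ 0 := by omega
          have := mul_self_pos.mpr this
          omega
        subst hkl
        rw [wp_skip]
        intro i hi j hj
        rw [State.set_arr]
        by_cases hij : i = k ∧ j = k
        · rw [hij.1, hij.2]
          have h := (inv₂ k hk k hk).2 (by omega)
          exact ⟨fun _ => ⟨fun _ => h, fun h => absurd rfl h⟩, fun _ => h⟩
        · exact ⟨fun h => (inv₂ i hi j hj).1 (by omega), fun h => (inv₂ i hi j hj).2 (by omega)⟩
    · intro s₂ _ inv₂ i hi j hj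
      rw [State.set_arr]
      exact ⟨fun h => (inv₂ i hi j hj).1 (by omega), fun h => (inv₂ i hi j hj).2 (by omega)⟩
  · intro s' ag inv
    refine ⟨?_, fun i hi j hj => ?_⟩
    · rw [State.set_reg, if_neg (by norm_num), ag.1 0 (by
        simp only [regs, List.mem_cons, not_or]
        exact ⟨by norm_num, by norm_num, hlow 0 (by norm_num)⟩), h0]
    · rw [State.set_arr]
      exact (inv i hi j hj).1 hi

theorem exists_recovery_halts : ∃ C₀ : ℕ, ∀ (n m D l₁ l₂ e : ℕ) (S : List ℤ), 0 < n → 1 ≤ D →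
    S.length = n * m → (∀ z ∈ S, z = 1 ∨ z = -1) →
    ∀ input : List ℤ, input = [(n : ℤ), m, D, l₁, l₂, e] ++ S →
    HaltsWithin recoveryProgram input (C₀ * (n ^ D * inputSize input) ^ C₀) fun σ =>
      ∀ i < n, ∀ j < n, (i = j → σ (n * i + j) = 0) ∧
        (i ≠ j → (recoveryData n m D l₂ e i j input).Outcome (σ (n * i + j))) := by
  obtain ⟨c, d, hcd⟩ := exists_time_le 3 recoveryMain
  set k₁ := storeCost (.const 3) firstFree with hk₁
  set k₂ := storeCost (.const 1)
    (.sub (.mul (.load (offset 3 0)) (.load (offset 3 0))) (.const 1)) with hk₂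
  set k₃ := storeCost (.const 0) (offset 3 70) with hk₃
  set k₄ := storeCost (.const 1) (.load (.add (.load (.const 0)) (.const 8))) with hk₄
  set k₅ := storeCost (.const 0) (.const 0) with hk₅
  set k₆ := (Expr.sub (.load (.const 1)) (.const 1)).unitCost +
        storeCost (.load (.const 1)) (.load (.add (.load (.const 0))
          (.mul (.const 8) (.load (.const 1))))) +
        storeCost (.const 1) (.sub (.load (.const 1)) (.const 1)) with hk₆
  refine ⟨22 * (k₁ + k₂ + k₃ + k₄ + k₅ + (c + k₆)) + (17 + 16 * (d + 1)), ?_⟩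
  intro n m D l₁ l₂ e S hn hD hS hpm input hin
  set N := inputSize input with hN
  have hlen : input.length = 6 + n * m := by rw [hin]; simp [hS]; omega
  have hNl : 6 + n * m ≤ N := hlen ▸ length_le_inputSize input
  set P := 8 + (n * m + n * n) with hPdef
  have hget : ∀ k < n * m, initial input (6 + k) = S.getD k 0 := by
    intro k hk; rw [hin, initial, List.getD_append_right _ _ _ _ (by simp)]; simp
  have hv : ∀ i < n, ∀ j < n, i ≠ j → (recoveryData n m D l₂ e i j input).Valid := by
    intro i hi j hj hij
    refine TestData.valid_of (by omega) hD hi hj (by omega) (by omega) (fun a ha r hr => ?_)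
      (by omega)
    have : (a + 1) * n ≤ m * n := Nat.mul_le_mul_right _ ha
    have e' : (a + 1) * n = a * n + n := by ring
    have e'' : m * n = n * m := Nat.mul_comm _ _
    rw [Function.update_of_ne (by omega), hget _ (by omega)]
    rw [List.getD_eq_getElem _ _ (by omega)]
    exact hpm _ (List.getElem_mem _)
  set G := n ^ D * N with hG
  have hnD : n ≤ n ^ D := Nat.le_self_pow (by omega) n
  have hnG : n ≤ G := hnD.trans (Nat.le_mul_of_pos_right _ (by omega))
  have hNG : N ≤ G := Nat.le_mul_of_pos_left _ (by omega)
  have hG1 : 1 ≤ G := by omega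
  have hGG' : G * G ≤ G ^ 16 := by rw [← pow_two]; exact pow_mono_right hG1 (by norm_num)
  have hGG : G * G ≤ G ^ 17 := by rw [← pow_two]; exact pow_mono_right hG1 (by norm_num)
  have hGX : G ≤ G ^ 16 := Nat.le_self_pow (by norm_num) G
  have hG17 : G ≤ G ^ 17 := Nat.le_self_pow (by norm_num) G
  have hW := bitLen_valueBound_le hG1
  have hXW : G ^ 16 ≤ valueBound G := le_valueBound (by
    have : G ^ 16 ≤ G ^ 17 := pow_mono_right hG1 (by norm_num)
    omega)
  have hNW : 2 ^ (N + 5) ≤ valueBound G := Nat.pow_le_pow_right (by norm_num) (by omega)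
  have hinp : ∀ k, |initial input k| ≤ valueBound G := fun k => by
    have h1 := abs_initial_lt input k
    have h2 : 2 ^ N ≤ valueBound G := (Nat.pow_le_pow_right (by norm_num) (by omega)).trans hNW
    have h3 : ((2 ^ N : ℕ) : ℤ) ≤ valueBound G := by exact_mod_cast h2
    push_cast at h3
    exact h1.le.trans h3
  have hnn : n * n ≤ G * G := Nat.mul_le_mul hnG hnG
  have hP70 : P + 70 ≤ valueBound G := by
    have h1 : 2 ^ 11 ≤ 2 ^ (N + 5) := Nat.pow_le_pow_right (by norm_num) (by omega)
    have h2 : N + n * n ≤ 2 ^ (N + n * n) := Nat.lt_two_pow_self.le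
    have h3 : 2 ^ (N + n * n) * 2 ^ 7 ≤ valueBound G := by
      rw [← pow_add]
      refine Nat.pow_le_pow_right (by norm_num) ?_
      omega
    have h4 : 1 ≤ 2 ^ (N + n * n) := Nat.one_le_two_pow
    generalize 2 ^ (N + n * n) = E at h2 h3 h4
    norm_num at h3
    omega
  have hPW : P ≤ valueBound G := by omega
  have i0 : initial input 0 = n := by rw [hin]; rfl
  have i1 : initial input 1 = m := by rw [hin]; rfl
  have i2 : initial input 2 = D := by rw [hin]; rfl
  have i4 : initial input 4 = l₂ := by rw [hin]; rfl
  have i5 : initial input 5 = e := by rw [hin]; rfl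
  have hY := bitLen_pos (valueBound G : ℤ)
  obtain ⟨t₁, ht₁, x₁⟩ := exec_store hY (Cmd.bitLen_le_of_abs_le hinp) (.const 3) firstFree
  rw [eval_firstFree i0 i1] at x₁
  have hrep := rep_initial (l := input) (β := 3) (P := P) (by omega) (by omega)
  have hb₁ := abs_update_le hinp 3 (z := (P : ℤ)) (by rw [Nat.abs_cast]; exact_mod_cast hPW)
  have hwp : recoveryMain.wp (Function.update (initial input) 3 (P : ℤ)) P (G ^ 16) (valueBound G)
      (fun s' => s'.reg 0 = n ∧ ∀ i < n, ∀ j < n, (i = j → s'.arr 6 (n * i + j) = 0) ∧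
        (i ≠ j → (recoveryData n m D l₂ e i j input).Outcome (s'.arr 6 (n * i + j))))
      State.zero := by
    have hb : ∀ k, k ≠ 3 → Function.update (initial input) 3 (P : ℤ) k = initial input k :=
      fun k hk => Function.update_of_ne hk _ _
    have h8 : |(8 : ℤ) * (l₂ + 2)| ≤ valueBound G := by
      have h1 := abs_initial_lt input 4
      rw [i4, Nat.abs_cast] at h1
      have h2 : (1 : ℤ) ≤ 2 ^ inputSize input := one_le_pow₀ (by norm_num)
      have h3 : ((2 ^ (N + 5) : ℕ) : ℤ) ≤ valueBound G := by exact_mod_cast hNW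
      rw [abs_of_nonneg (by positivity)]
      push_cast [pow_add] at h3
      linarith
    have hc6 : (6 : ℤ) ≤ valueBound G := by exact_mod_cast (show 6 ≤ P by omega).trans hPW
    unfold recoveryMain
    simp only [wp_seq, wp_set, Term.eval, Term.Safe, Int.reduceToNat,
      and_true, Nat.reduceLT, true_and]
    rw [hb 0 (by norm_num), hb 1 (by norm_num), hb 2 (by norm_num),
      hb 4 (by norm_num), hb 5 (by norm_num), i0, i1, i2, i4, i5]
    refine ⟨by omega, i0 ▸ hinp 0, by omega, i1 ▸ hinp 1, by omega,
      i2 ▸ hinp 2, by omega, h8, by omega,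
      i5 ▸ hinp 5, by rw [abs_of_nonneg (by norm_num)]; exact hc6, ?_⟩
    exact wp_recovery_loop (hnG.trans hGX) Nat.one_le_two_pow hv (by simp) (by simp) (by simp) (by simp)
      (by simp) (by simp) (fun _ => rfl)
  obtain ⟨t₂, σ₂, s₂, x₂, ht₂, r₂, b₂, ⟨q0, q₂⟩, -⟩ := exec_of_wp hXW hwp hrep hb₁
  obtain ⟨t₃, ht₃, x₃⟩ := exec_store hY (Cmd.bitLen_le_of_abs_le b₂) (.const 1)
    (.sub (.mul (.load (offset 3 0)) (.load (offset 3 0))) (.const 1))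
  have hnn1 : 1 ≤ n * n := Nat.mul_pos hn hn
  have e3 : (Expr.sub (.mul (.load (offset 3 0)) (.load (offset 3 0))) (.const 1)).eval σ₂ =
      ((n * n - 1 : ℕ) : ℤ) := by
    simp only [Expr.eval, r₂.eval_offset, r₂.reg 0 (by norm_num), q0]
    push_cast [Nat.cast_sub hnn1]; ring
  have e3' : ((Expr.const 1).eval σ₂).toNat = 1 := by simp [Expr.eval]
  rw [e3, e3'] at x₃
  have b₃ := abs_update_le b₂ 1 (z := ((n * n - 1 : ℕ) : ℤ))
    (by rw [Nat.abs_cast]; exact_mod_cast by omega)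
  set σ₃ := Function.update σ₂ 1 ((n * n - 1 : ℕ) : ℤ) with hσ₃
  obtain ⟨t₄, ht₄, x₄⟩ := exec_store hY (Cmd.bitLen_le_of_abs_le b₃) (.const 0) (offset 3 70)
  have e4 : (offset 3 70).eval σ₃ = ((P + 70 : ℕ) : ℤ) := by
    have : σ₃ 3 = P := by rw [hσ₃, Function.update_of_ne (by norm_num), r₂.ptr]
    simp [offset, Expr.eval, this]
  have e4' : ((Expr.const 0).eval σ₃).toNat = 0 := by simp [Expr.eval]
  rw [e4, e4'] at x₄
  have b₄ := abs_update_le b₃ 0 (z := ((P + 70 : ℕ) : ℤ))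
    (by rw [Nat.abs_cast]; exact_mod_cast hP70)
  set σ₄ := Function.update σ₃ 0 ((P + 70 : ℕ) : ℤ) with hσ₄
  obtain ⟨t₅, σ₅, x₅, ht₅, g0, g1, g2, b₅⟩ := exec_copyLoop (P + 70) (n * n - 1) (by omega) σ₄
    (Function.update_self _ _ _)
    (by rw [hσ₄, Function.update_of_ne (by norm_num), hσ₃, Function.update_self]) b₄ hP70
  obtain ⟨t₆, ht₆, x₆⟩ := exec_store hY (Cmd.bitLen_le_of_abs_le b₅) (.const 1)
    (.load (.add (.load (.const 0)) (.const 8)))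
  have e6 : (Expr.load (.add (.load (.const 0)) (.const 8))).eval σ₅ = σ₅ (P + 70 + 8) := by
    simp only [Expr.eval, Int.toNat_zero, g0]; rfl
  have e6' : ((Expr.const 1).eval σ₅).toNat = 1 := by simp [Expr.eval]
  rw [e6, e6'] at x₆
  have b₆ := abs_update_le b₅ 1 (b₅ (P + 70 + 8))
  obtain ⟨t₇, ht₇, x₇⟩ := exec_store hY (Cmd.bitLen_le_of_abs_le b₆) (.const 0) (.const 0)
  refine ⟨_, _, ?_, .seq x₁ (.seq x₂ (.seq x₃ (.seq x₄ (.seq x₅ (.seq x₆ x₇))))), ?_⟩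
  · refine time_le_pow hG1 _ hW ?_
    have h := hcd (bitLen (valueBound G)) (G ^ 16) hY (Nat.pow_pos hG1)
    have h' : c * bitLen (valueBound G) * (G ^ 16) ^ d ≤
        c * bitLen (valueBound G) * (G ^ 16) ^ (d + 1) :=
      Nat.mul_le_mul_left _ (pow_mono_right (Nat.pow_pos hG1) (by omega))
    have h'' : k₆ * bitLen (valueBound G) * (n * n - 1 + 1) ≤
        k₆ * bitLen (valueBound G) * (G ^ 16) ^ (d + 1) := by
      refine Nat.mul_le_mul_left _ ?_
      rw [Nat.sub_add_cancel hnn1]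
      exact (hnn.trans hGG').trans (Nat.le_self_pow (by omega) _)
    rw [← hk₁] at ht₁
    rw [← hk₂] at ht₃
    rw [← hk₃] at ht₄
    rw [← hk₄] at ht₆
    rw [← hk₅] at ht₇
    rw [← hk₆] at ht₅
    simp only [add_mul] at *
    omega
  · have harr : ∀ k, σ₂ (P + 70 + 8 * k) = s₂.arr 6 k := fun k => r₂.arr 6 (by norm_num) k
    have key : ∀ k < n * n, k ≠ 0 → Function.update (Function.update σ₅ 1 (σ₅ (P + 70 + 8)))
        ((Expr.const 0).eval (Function.update σ₅ 1 (σ₅ (P + 70 + 8)))).toNat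
        ((Expr.const 0).eval (Function.update σ₅ 1 (σ₅ (P + 70 + 8)))) k = s₂.arr 6 k := by
      intro k hk hk0
      have h4 : ∀ c, 1 < c → σ₄ c = σ₂ c := fun c hc => by
        rw [hσ₄, Function.update_of_ne (by omega), hσ₃, Function.update_of_ne (by omega)]
      rw [Function.update_of_ne (by simpa [Expr.eval] using hk0)]
      rcases Nat.lt_or_ge 1 k with h | h
      · rw [Function.update_of_ne (by omega), g1 k h (by omega), h4 _ (by omega), harr]
      · obtain rfl : k = 1 := by omega
        rw [Function.update_self, g2 _ (by omega) (by omega), h4 _ (by omega)]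
        exact harr 1
    intro i hi j hj
    have hlt : n * i + j < n * n := by
      have : n * (i + 1) ≤ n * n := Nat.mul_le_mul_left _ hi
      rw [Nat.mul_add] at this
      omega
    rcases Nat.eq_zero_or_pos (n * i + j) with h | h
    · have hj0 : j = 0 := by omega
      have hi0 : i = 0 := by
        rcases Nat.mul_eq_zero.mp (by omega : n * i = 0) with h' | h'
        · omega
        · exact h'
      subst hj0 hi0
      exact ⟨fun _ => by simp [Expr.eval], fun h => absurd rfl h⟩
    · rw [key _ hlt (by omega)]
      exact q₂ i hi j hj

end RAM

/-! ### The logistic loss -/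

theorem add_deriv_mul_le_of_monotone {g g' : ℝ → ℝ} (hg : ∀ x, HasDerivAt g (g' x) x)
    (hm : Monotone g') (a b : ℝ) : g a + (b - a) * g' a ≤ g b := by
  have hc : Continuous g := continuous_iff_continuousAt.mpr fun x => (hg x).continuousAt
  rcases lt_trichotomy a b with h | rfl | h
  · obtain ⟨c, hc, e⟩ := exists_hasDerivAt_eq_slope g g' h hc.continuousOn fun x _ => hg x
    rw [eq_div_iff (sub_pos.mpr h).ne'] at e
    nlinarith [mul_le_mul_of_nonneg_right (hm hc.1.le) (sub_pos.mpr h).le]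
  · simp
  · obtain ⟨c, hc, e⟩ := exists_hasDerivAt_eq_slope g g' h hc.continuousOn fun x _ => hg x
    rw [eq_div_iff (sub_pos.mpr h).ne'] at e
    nlinarith [mul_le_mul_of_nonneg_right (hm hc.2.le) (sub_pos.mpr h).le]

namespace Real

theorem hasDerivAt_tanh (x : ℝ) : HasDerivAt tanh (1 - tanh x ^ 2) x := by
  have h := (hasDerivAt_sinh x).div (hasDerivAt_cosh x) (cosh_pos x).ne'
  have e : (fun y => sinh y / cosh y) = tanh := funext fun y => (tanh_eq_sinh_div_cosh y).symm
  change HasDerivAt (fun y => sinh y / cosh y) _ x at h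
  rw [e] at h
  convert h using 1
  rw [tanh_eq_sinh_div_cosh]
  have := (cosh_pos x).ne'
  field_simp

theorem hasDerivAt_log_cosh (x : ℝ) : HasDerivAt (fun y => log (cosh y)) (tanh x) x := by
  rw [tanh_eq_sinh_div_cosh]
  exact (hasDerivAt_cosh x).log (cosh_pos x).ne'

theorem continuous_tanh : Continuous tanh :=
  continuous_iff_continuousAt.mpr fun x => (hasDerivAt_tanh x).continuousAt

theorem monotone_tanh : Monotone tanh :=
  monotone_of_deriv_nonneg (fun x => (hasDerivAt_tanh x).differentiableAt) fun x => by
    rw [(hasDerivAt_tanh x).deriv]; linarith [tanh_sq_lt_one x]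

theorem monotone_sub_tanh : Monotone fun x => x - tanh x := by
  have h : ∀ x, HasDerivAt (fun x => x - tanh x) (tanh x ^ 2) x := fun x => by
    have := (hasDerivAt_id x).sub (hasDerivAt_tanh x)
    rwa [sub_sub_cancel] at this
  exact monotone_of_deriv_nonneg (fun x => (h x).differentiableAt) fun x => by
    rw [(h x).deriv]; positivity

theorem log_cosh_tangent (p q : ℝ) : log (cosh p) + (q - p) * tanh p ≤ log (cosh q) :=
  add_deriv_mul_le_of_monotone hasDerivAt_log_cosh monotone_tanh p q

theorem log_cosh_le_quadratic (p q : ℝ) :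
    log (cosh q) ≤ log (cosh p) + (q - p) * tanh p + (q - p) ^ 2 / 2 := by
  have h := add_deriv_mul_le_of_monotone (g := fun x => x ^ 2 / 2 - log (cosh x)) (fun x => by
    have := ((hasDerivAt_id x).pow 2).div_const 2 |>.sub (hasDerivAt_log_cosh x)
    refine this.congr_deriv ?_
    rw [id]; ring) monotone_sub_tanh p q
  nlinarith

/-- The excess of the logistic loss dominates the squared distance of the predictions. -/
theorem sq_tanh_sub_le (p z : ℝ) :
    (tanh p - tanh z) ^ 2 / 2 ≤ log (cosh p) - log (cosh z) - (p - z) * tanh z := by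
  have h1 := log_cosh_tangent z (p - (tanh p - tanh z))
  have h2 := log_cosh_le_quadratic p (p - (tanh p - tanh z))
  nlinarith

theorem abs_log_cosh_sub_le (p q : ℝ) : |log (cosh p) - log (cosh q)| ≤ |p - q| := by
  have h1 := log_cosh_tangent p q
  have h2 := log_cosh_tangent q p
  have h3 : |(q - p) * tanh p| ≤ |p - q| := by
    rw [abs_mul, abs_sub_comm q p]
    exact mul_le_of_le_one_right (abs_nonneg _) (abs_tanh_lt_one p).le
  have h4 : |(p - q) * tanh q| ≤ |p - q| := by
    rw [abs_mul]
    exact mul_le_of_le_one_right (abs_nonneg _) (abs_tanh_lt_one q).le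
  rw [abs_le] at *
  constructor <;> linarith [h3.1, h4.2]

theorem abs_sub_log_two_le_log_cosh (p : ℝ) : |p| - log 2 ≤ log (cosh p) := by
  rw [← log_exp (|p|), ← log_div (exp_pos _).ne' (by norm_num)]
  refine log_le_log (by positivity) ?_
  rw [← cosh_abs, cosh_eq]
  have := exp_pos (-|p|)
  linarith

theorem tanh_le_self {x : ℝ} (hx : 0 ≤ x) : tanh x ≤ x := by
  have : (0 : ℝ) - tanh 0 ≤ x - tanh x := monotone_sub_tanh hx
  rw [tanh_zero] at this
  linarith

theorem le_artanh {x : ℝ} (h0 : 0 ≤ x) (h1 : x < 1) : x ≤ artanh x := by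
  have h := tanh_le_self (artanh_nonneg h0)
  rwa [tanh_artanh ⟨by linarith, h1⟩] at h

theorem artanh_le_two_mul {x : ℝ} (h0 : 0 ≤ x) (h1 : x ≤ 1 / 2) : artanh x ≤ 2 * x := by
  rw [artanh_eq_half_log ⟨by linarith, by linarith⟩]
  have h2 : log ((1 + x) / (1 - x)) ≤ (1 + x) / (1 - x) - 1 :=
    log_le_sub_one_of_pos (div_pos (by linarith) (by linarith))
  have h3 : (1 + x) / (1 - x) - 1 ≤ 4 * x := by
    have : 0 < 1 - x := by linarith
    rw [sub_le_iff_le_add, div_le_iff₀ this]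
    nlinarith
  linarith

end Real

open Real in
/-- The logistic loss of the half-logit `p` for the label `y`. -/
noncomputable def logisticLoss (y p : ℝ) : ℝ := log (cosh p) - y * p

section LogisticLoss

open Real

theorem abs_logisticLoss_sub_le {y : ℝ} (hy : |y| ≤ 1) (p q : ℝ) :
    |logisticLoss y p - logisticLoss y q| ≤ 2 * |p - q| := by
  have h1 := abs_log_cosh_sub_le p q
  have h2 : |y * (p - q)| ≤ |p - q| := by
    rw [abs_mul]; exact mul_le_of_le_one_left (abs_nonneg _) hy
  have h3 : logisticLoss y p - logisticLoss y q =
      (log (cosh p) - log (cosh q)) - y * (p - q) := by unfold logisticLoss; ring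
  rw [h3]
  exact (abs_sub _ _).trans (by linarith)

theorem abs_logisticLoss_le {y p K : ℝ} (hy : |y| ≤ 1) (hp : |p| ≤ K) :
    |logisticLoss y p| ≤ 2 * K := by
  have := abs_logisticLoss_sub_le hy p 0
  simp only [logisticLoss, cosh_zero, log_one, mul_zero, sub_zero] at this ⊢
  linarith

theorem neg_logisticLoss_le {y : ℝ} (hy : |y| ≤ 1) (p : ℝ) : -logisticLoss y p ≤ 1 := by
  have h1 := abs_sub_log_two_le_log_cosh p
  have h2 : y * p ≤ |p| := (le_abs_self _).trans (by
    rw [abs_mul]; exact mul_le_of_le_one_left (abs_nonneg _) hy)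
  have h3 := log_two_lt_d9
  unfold logisticLoss
  linarith

/-- Greedy coordinate descent with steps of fixed size for the logistic loss. -/
theorem greedy_descent (m N : ℕ) (φ : ℕ → ℕ → ℝ) (y : ℕ → ℝ) (θ : ℕ → ℕ × ℝ) (T : ℕ)
    {γ κ B : ℝ} (hγ : 0 < γ) (hκ : 0 ≤ κ) (hB : γ ≤ B) (hT : 0 < T)
    (hφ : ∀ e < N, ∀ a < m, |φ e a| ≤ 1) (hy : ∀ a < m, |y a| ≤ 1)
    (hθ : ∀ t < T, (θ t).1 < N ∧ |(θ t).2| ≤ 1 ∧ ∀ e < N,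
      |∑ a ∈ Finset.range m, φ e a *
        (y a - tanh (γ * ∑ r ∈ Finset.range t, (θ r).2 * φ (θ r).1 a))| ≤
      (θ t).2 * (∑ a ∈ Finset.range m, φ (θ t).1 a *
        (y a - tanh (γ * ∑ r ∈ Finset.range t, (θ r).2 * φ (θ r).1 a))) + κ * m)
    (c : ℕ → ℝ) (hc : ∑ e ∈ Finset.range N, |c e| ≤ B) :
    ∑ a ∈ Finset.range m,
        logisticLoss (y a) (γ * ∑ r ∈ Finset.range T, (θ r).2 * φ (θ r).1 a) -
      ∑ a ∈ Finset.range m, logisticLoss (y a) (∑ e ∈ Finset.range N, c e * φ e a) ≤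
    m * (B / (γ * T) + (γ ^ 2 / 2 + γ * κ) * T) := by
  set p : ℕ → ℕ → ℝ := fun t a => γ * ∑ r ∈ Finset.range t, (θ r).2 * φ (θ r).1 a with hp
  set q : ℕ → ℝ := fun a => ∑ e ∈ Finset.range N, c e * φ e a with hq
  set G : ℕ → ℕ → ℝ := fun t e => ∑ a ∈ Finset.range m, φ e a * (y a - tanh (p t a)) with hG
  set Δ : ℕ → ℝ := fun t => ∑ a ∈ Finset.range m, logisticLoss (y a) (p t a) -
    ∑ a ∈ Finset.range m, logisticLoss (y a) (q a) with hΔ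
  set w : ℝ := γ ^ 2 / 2 + γ * κ with hw
  have hw0 : 0 ≤ w := by positivity
  have hm0 : (0 : ℝ) ≤ m := Nat.cast_nonneg m
  have hB0 : 0 < B := hγ.trans_le hB
  -- the decrease of the loss in one step
  have hdec : ∀ t < T, Δ (t + 1) ≤ Δ t - γ * ((θ t).2 * G t (θ t).1) + m * (γ ^ 2 / 2) := by
    intro t ht
    have h1 : ∀ a ∈ Finset.range m, logisticLoss (y a) (p (t + 1) a) ≤
        logisticLoss (y a) (p t a) - γ * ((θ t).2 * (φ (θ t).1 a * (y a - tanh (p t a)))) +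
          γ ^ 2 / 2 := by
      intro a ha
      have h2 : p (t + 1) a = p t a + γ * ((θ t).2 * φ (θ t).1 a) := by
        simp only [hp, Finset.sum_range_succ]; ring
      have h3 := log_cosh_le_quadratic (p t a) (p (t + 1) a)
      have h4 : |(θ t).2 * φ (θ t).1 a| ≤ 1 := by
        rw [abs_mul]
        exact mul_le_one₀ (hθ t ht).2.1 (abs_nonneg _)
          (hφ _ (hθ t ht).1 a (Finset.mem_range.mp ha))
      have h5 : (γ * ((θ t).2 * φ (θ t).1 a)) ^ 2 ≤ γ ^ 2 := by
        rw [mul_pow]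
        exact mul_le_of_le_one_right (sq_nonneg _) ((sq_le_one_iff_abs_le_one _).mpr h4)
      rw [h2] at h3 ⊢
      unfold logisticLoss
      simp only [add_sub_cancel_left] at h3
      nlinarith
    have h2 := Finset.sum_le_sum h1
    rw [Finset.sum_add_distrib, Finset.sum_sub_distrib, ← Finset.mul_sum, ← Finset.mul_sum] at h2
    simp only [Finset.sum_const, Finset.card_range, nsmul_eq_mul] at h2
    simp only [hΔ, hG]
    linarith
  -- the gap is controlled by the largest correlation
  have hgap : ∀ t < T, Δ t ≤ (B + γ * t) * ((θ t).2 * G t (θ t).1 + κ * m) := by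
    intro t ht
    set M := (θ t).2 * G t (θ t).1 + κ * m with hM
    have hGM : ∀ e < N, |G t e| ≤ M := (hθ t ht).2.2
    have hM0 : 0 ≤ M := (abs_nonneg _).trans (hGM _ (hθ t ht).1)
    have h1 : Δ t ≤ ∑ a ∈ Finset.range m, (q a - p t a) * (y a - tanh (p t a)) := by
      simp only [hΔ]
      rw [← Finset.sum_sub_distrib]
      refine Finset.sum_le_sum fun a _ => ?_
      have := log_cosh_tangent (p t a) (q a)
      unfold logisticLoss
      nlinarith
    have h2 : ∑ a ∈ Finset.range m, q a * (y a - tanh (p t a)) =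
        ∑ e ∈ Finset.range N, c e * G t e := by
      simp only [hq, hG, Finset.sum_mul, Finset.mul_sum]
      rw [Finset.sum_comm]
      exact Finset.sum_congr rfl fun e _ => Finset.sum_congr rfl fun a _ => by ring
    have h3 : ∑ a ∈ Finset.range m, p t a * (y a - tanh (p t a)) =
        γ * ∑ r ∈ Finset.range t, (θ r).2 * G t (θ r).1 := by
      have : ∀ a, p t a * (y a - tanh (p t a)) =
          ∑ r ∈ Finset.range t, γ * ((θ r).2 * (φ (θ r).1 a * (y a - tanh (p t a)))) := by
        intro a
        rw [← Finset.mul_sum]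
        simp only [← mul_assoc]
        rw [← Finset.sum_mul]
        simp only [hp, mul_assoc]
      simp only [this]
      rw [Finset.sum_comm]
      simp only [hG, Finset.mul_sum]
    have h4 : ∑ e ∈ Finset.range N, c e * G t e ≤ B * M := by
      calc ∑ e ∈ Finset.range N, c e * G t e ≤ ∑ e ∈ Finset.range N, |c e| * M := by
            refine Finset.sum_le_sum fun e he => (le_abs_self _).trans ?_
            rw [abs_mul]
            exact mul_le_mul_of_nonneg_left (hGM e (Finset.mem_range.mp he)) (abs_nonneg _)
        _ ≤ B * M := by
            rw [← Finset.sum_mul]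
            exact mul_le_mul_of_nonneg_right hc hM0
    have h5 : -(∑ r ∈ Finset.range t, (θ r).2 * G t (θ r).1) ≤ t * M := by
      rw [← Finset.sum_neg_distrib]
      calc ∑ r ∈ Finset.range t, -((θ r).2 * G t (θ r).1) ≤ ∑ r ∈ Finset.range t, M := by
            refine Finset.sum_le_sum fun r hr => (neg_le_abs _).trans ?_
            have hr' := (Finset.mem_range.mp hr).trans ht
            rw [abs_mul]
            exact (mul_le_of_le_one_left (abs_nonneg _) (hθ r hr').2.1).trans
              (hGM _ (hθ r hr').1)
        _ = t * M := by simp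
    have h6 : ∑ a ∈ Finset.range m, (q a - p t a) * (y a - tanh (p t a)) =
        ∑ e ∈ Finset.range N, c e * G t e - γ * ∑ r ∈ Finset.range t, (θ r).2 * G t (θ r).1 := by
      rw [← h2, ← h3, ← Finset.sum_sub_distrib]
      exact Finset.sum_congr rfl fun a _ => by ring
    nlinarith
  have hind : ∀ t ≤ T, Δ t * (B + γ * t - γ) ≤ m * (B - γ) + m * w * t * (B + γ * t - γ) := by
    intro t
    induction t with
    | zero =>
      intro _
      have h1 : Δ 0 ≤ m := by
        simp only [hΔ, hp, Finset.range_zero, Finset.sum_empty, mul_zero, logisticLoss, cosh_zero,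
          log_one, sub_zero, Finset.sum_const_zero, zero_sub]
        rw [← Finset.sum_neg_distrib]
        refine (Finset.sum_le_sum fun a ha =>
          neg_logisticLoss_le (hy a (Finset.mem_range.mp ha)) (q a)).trans (by simp)
      simp only [Nat.cast_zero, mul_zero, zero_mul, add_zero]
      exact mul_le_mul_of_nonneg_right h1 (by linarith)
    | succ t ih =>
      intro ht
      have h1 := ih (by omega)
      have h2 := hdec t (by omega)
      have h3 := hgap t (by omega)
      set S := B + γ * t with hS
      have hS0 : 0 < S := by positivity
      have h4 : S * Δ (t + 1) ≤ S * (Δ t - γ * ((θ t).2 * G t (θ t).1) + m * (γ ^ 2 / 2)) :=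
        mul_le_mul_of_nonneg_left h2 hS0.le
      have h5 := mul_le_mul_of_nonneg_left h3 hγ.le
      push_cast
      have h6 : B + γ * ((t : ℝ) + 1) - γ = S := by rw [hS]; ring
      rw [h6]
      have h7 : S * Δ (t + 1) ≤ Δ t * (S - γ) + m * w * S := by
        rw [hw]; nlinarith
      have h8 : 0 ≤ m * w * t * γ := by positivity
      nlinarith
  have hfin := hind T le_rfl
  have hT1 : (1 : ℝ) ≤ T := by exact_mod_cast hT
  set S := B + γ * T - γ with hS
  have hST : γ * T ≤ S := by rw [hS]; linarith
  have hγT : 0 < γ * T := by positivity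
  have hS0 : 0 < S := hγT.trans_le hST
  have h1 : Δ T ≤ (m * B + m * w * T * S) / S := by
    rw [le_div_iff₀ hS0]
    nlinarith
  have h2 : (m * B + m * w * T * S) / S = m * (B / S + w * T) := by
    field_simp
  have h3 : B / S ≤ B / (γ * T) := div_le_div_of_nonneg_left hB0.le hγT hST
  rw [h2] at h1
  exact h1.trans (mul_le_mul_of_nonneg_left (by linarith) hm0)

end LogisticLoss

/-! ### The predictors computed by the program -/

namespace RAM.TestData

open Real

variable {d : TestData}

/-- The step size of the coordinate descent. -/
noncomputable def step (d : TestData) : ℝ := artanh (1 / d.H)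

/-- The half-logits after `t` steps. -/
noncomputable def logit (d : TestData) (q : ℕ) (θ : ℕ → ℕ × ℤ) (t a : ℕ) : ℝ :=
  d.step * ∑ r ∈ Finset.range t, ((θ r).2 : ℝ) * (d.phi q a (θ r).1 d.D : ℝ)

theorem one_div_H_le (hd : d.Valid) : 1 / (d.H : ℝ) ≤ 1 / 2 := by
  have : (2 : ℝ) ≤ d.H := by exact_mod_cast two_le_H hd
  exact one_div_le_one_div_of_le (by norm_num) this

theorem step_bound (hd : d.Valid) : 1 / (d.H : ℝ) ≤ d.step ∧ d.step ≤ 2 / d.H := by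
  have h := one_div_H_le hd
  have h0 : 0 ≤ 1 / (d.H : ℝ) := by positivity
  refine ⟨le_artanh h0 (by linarith), (artanh_le_two_mul h0 h).trans (le_of_eq (by ring))⟩

theorem exp_two_mul_step (hd : d.Valid) : exp (2 * d.step) = (d.H + 1) / (d.H - 1) := by
  have h := one_div_H_le hd
  have h0 : 0 ≤ 1 / (d.H : ℝ) := by positivity
  have h2 : (2 : ℝ) ≤ d.H := by exact_mod_cast two_le_H hd
  rw [two_mul, exp_add, step, exp_artanh ⟨by linarith, by linarith⟩,
    mul_self_sqrt (div_nonneg (by linarith) (by linarith))]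
  have h3 : (d.H : ℝ) - 1 ≠ 0 := by linarith
  have h4 : (d.H : ℝ) ≠ 0 := by linarith
  have h5 : 1 - 1 / (d.H : ℝ) ≠ 0 := by linarith
  field_simp

theorem up_eq (hd : d.Valid) {q a t : ℕ} {θ : ℕ → ℕ × ℤ} (ha : a < d.m)
    (hθ : ∀ r < t, (θ r).2 = 1 ∨ (θ r).2 = -1) :
    (d.up q θ t a : ℝ) = d.down q θ t a * exp (2 * d.logit q θ t a) := by
  have h2 : (2 : ℝ) ≤ d.H := by exact_mod_cast two_le_H hd
  have hs := exp_two_mul_step hd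
  have key : ∀ b : ℤ, (b = 1 ∨ b = -1) →
      (d.H + b : ℝ) = (d.H - b) * exp (2 * (d.step * b)) := by
    have h3 : (d.H : ℝ) - 1 ≠ 0 := by linarith
    have h4 : (d.H : ℝ) + 1 ≠ 0 := by linarith
    rintro b (rfl | rfl)
    · rw [Int.cast_one, mul_one, hs]; field_simp
    · rw [Int.cast_neg, Int.cast_one, mul_neg, mul_one, mul_neg, exp_neg, hs]; field_simp; ring
  rw [up, down, logit]
  push_cast
  rw [Finset.mul_sum, Finset.mul_sum, exp_sum, ← Finset.prod_mul_distrib]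
  refine Finset.prod_congr rfl fun r hr => ?_
  have h1 := abs_phi hd ha q (θ r).1 d.D
  have h5 := key ((θ r).2 * d.phi q a (θ r).1 d.D) (by
    rcases hθ r (Finset.mem_range.mp hr) with h | h <;>
    rcases eq_or_eq_neg_of_abs_eq h1 with h' | h' <;> simp [h, h'])
  push_cast at h5
  exact h5

theorem tanh_logit (hd : d.Valid) {q a t : ℕ} {θ : ℕ → ℕ × ℤ} (ha : a < d.m)
    (hθ : ∀ r < t, (θ r).2 = 1 ∨ (θ r).2 = -1) :
    tanh (d.logit q θ t a) =
      ((d.up q θ t a : ℝ) - d.down q θ t a) / (d.up q θ t a + d.down q θ t a) := by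
  have h1 : (0 : ℝ) < d.down q θ t a := by exact_mod_cast (down_bounds hd (q := q) ha hθ).1
  rw [up_eq hd ha hθ, tanh_eq, two_mul, exp_add, exp_neg]
  have h2 := exp_pos (d.logit q θ t a)
  field_simp

theorem abs_pred_sub_le (hd : d.Valid) {q a t : ℕ} {θ : ℕ → ℕ × ℤ} (ha : a < d.m)
    (hθ : ∀ r < t, (θ r).2 = 1 ∨ (θ r).2 = -1) :
    |(d.pred (d.up q θ t) (d.down q θ t) a : ℝ) - d.H * tanh (d.logit q θ t a)| ≤ 1 := by
  have h1 := (down_bounds hd (q := q) ha hθ).1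
  have h2 := (up_bounds hd (q := q) ha hθ).1
  rw [tanh_logit hd ha hθ, pred]
  set N := (d.H : ℤ) * (d.up q θ t a - d.down q θ t a) with hN
  set S := d.up q θ t a + d.down q θ t a with hS
  have hS0 : 0 < S := by omega
  have h3 := Int.mul_ediv_add_emod N S
  have h4 := Int.emod_nonneg N hS0.ne'
  have h5 := Int.emod_lt_of_pos N hS0
  have hS0' : (0 : ℝ) < S := by exact_mod_cast hS0
  have h6 : (d.H : ℝ) * (((d.up q θ t a : ℝ) - d.down q θ t a) /
      (d.up q θ t a + d.down q θ t a)) = N / S := by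
    rw [hN, hS]; push_cast; ring
  rw [h6]
  have h7 : (S : ℝ) * (N / S : ℤ) + (N % S : ℤ) = N := by exact_mod_cast h3
  have h8 : (0 : ℝ) ≤ (N % S : ℤ) := by exact_mod_cast h4
  have h9 : ((N % S : ℤ) : ℝ) ≤ S := by exact_mod_cast h5.le
  have h10 : (N : ℝ) / S = (N / S : ℤ) + (N % S : ℤ) / S := by
    rw [← h7]; field_simp
  rw [h10, abs_le]
  have h11 : ((N % S : ℤ) : ℝ) / S ≤ 1 := (div_le_one hS0').mpr h9
  have h12 : 0 ≤ ((N % S : ℤ) : ℝ) / S := div_nonneg h8 hS0'.le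
  constructor <;> linarith

theorem abs_corr_sub_le (hd : d.Valid) {q t e : ℕ} {θ : ℕ → ℕ × ℤ}
    (hθ : ∀ r < t, (θ r).2 = 1 ∨ (θ r).2 = -1) :
    |(d.corr q (d.up q θ t) (d.down q θ t) e d.m : ℝ) - d.H * ∑ a ∈ Finset.range d.m,
      (d.phi q a e d.D : ℝ) * ((d.x a d.i : ℝ) - tanh (d.logit q θ t a))| ≤ d.m := by
  rw [corr]
  push_cast
  rw [Finset.mul_sum, ← Finset.sum_sub_distrib]
  refine (Finset.abs_sum_le_sum_abs _ _).trans ?_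
  refine (Finset.sum_le_sum (g := fun _ => (1 : ℝ)) fun a ha => ?_).trans (by simp)
  have ha' := Finset.mem_range.mp ha
  have h1 := abs_pred_sub_le hd (q := q) ha' hθ
  have h2 : |(d.phi q a e d.D : ℝ)| = 1 := by exact_mod_cast abs_phi hd ha' q e d.D
  have h3 : (d.phi q a e d.D : ℝ) * ((d.x a d.i : ℝ) * d.H -
      d.pred (d.up q θ t) (d.down q θ t) a) -
      d.H * (d.phi q a e d.D * ((d.x a d.i : ℝ) - tanh (d.logit q θ t a))) =
      -(d.phi q a e d.D * (d.pred (d.up q θ t) (d.down q θ t) a -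
        d.H * tanh (d.logit q θ t a))) := by ring
  rw [h3, abs_neg, abs_mul, h2, one_mul]
  exact h1

theorem Greedy.sum_logisticLoss_le (hd : d.Valid) {q : ℕ} {θ : ℕ → ℕ × ℤ}
    (hθ : d.Greedy q θ d.T) {B : ℝ} (hB : 1 ≤ B) (c : ℕ → ℝ)
    (hc : ∑ e ∈ Finset.range (d.n ^ d.D), |c e| ≤ B) :
    ∑ a ∈ Finset.range d.m, logisticLoss (d.x a d.i) (d.logit q θ d.T a) -
      ∑ a ∈ Finset.range d.m, logisticLoss (d.x a d.i)
        (∑ e ∈ Finset.range (d.n ^ d.D), c e * d.phi q a e d.D) ≤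
    d.m * (B * d.H / d.T + 6 * d.T / d.H ^ 2) := by
  have h2 : (2 : ℝ) ≤ d.H := by exact_mod_cast two_le_H hd
  have hH : (0 : ℝ) < d.H := by linarith
  obtain ⟨hs1, hs2⟩ := step_bound hd
  have hs0 : 0 < d.step := (by positivity : 0 < 1 / (d.H : ℝ)).trans_le hs1
  have hT : 0 < d.T := by unfold T; positivity
  have hT' : (0 : ℝ) < d.T := by exact_mod_cast hT
  have hs3 : 2 / (d.H : ℝ) ≤ 1 := (div_le_one hH).mpr h2
  have h := greedy_descent d.m (d.n ^ d.D) (fun e a => (d.phi q a e d.D : ℝ))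
    (fun a => (d.x a d.i : ℝ)) (fun r => ((θ r).1, ((θ r).2 : ℝ))) d.T (γ := d.step)
    (κ := 2 / d.H) (B := B) hs0 (by positivity) (by linarith) hT
    (fun e _ a ha => by
      have := abs_phi hd ha q e d.D
      have h' : |(d.phi q a e d.D : ℝ)| = 1 := by exact_mod_cast this
      exact h'.le)
    (fun a ha => by rcases hd.hx a ha d.i hd.hi with h | h <;> simp [h])
    (fun t ht => by
      obtain ⟨g1, g2, g3⟩ := hθ t ht
      have hpm : ∀ r < t, (θ r).2 = 1 ∨ (θ r).2 = -1 := fun r hr => (hθ r (hr.trans ht)).2.1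
      have hbb : |((θ t).2 : ℝ)| = 1 := by rcases g2 with h | h <;> simp [h]
      refine ⟨g1, hbb.le, fun e he => ?_⟩
      have k1 := abs_corr_sub_le hd (q := q) (e := e) hpm
      have k2 := abs_corr_sub_le hd (q := q) (e := (θ t).1) hpm
      have k3 : |(d.corr q (d.up q θ t) (d.down q θ t) e d.m : ℝ)| ≤
          (θ t).2 * d.corr q (d.up q θ t) (d.down q θ t) (θ t).1 d.m := by exact_mod_cast g3 e he
      set G : ℕ → ℝ := fun e => ∑ a ∈ Finset.range d.m,
        (d.phi q a e d.D : ℝ) * ((d.x a d.i : ℝ) - tanh (d.logit q θ t a)) with hG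
      change |G e| ≤ ((θ t).2 : ℝ) * G (θ t).1 + 2 / d.H * d.m
      have k4 : d.H * |G e| ≤ |(d.corr q (d.up q θ t) (d.down q θ t) e d.m : ℝ)| + d.m := by
        have := abs_sub_abs_le_abs_sub (d.H * G e)
          (d.corr q (d.up q θ t) (d.down q θ t) e d.m : ℝ)
        rw [abs_mul, abs_of_pos hH, abs_sub_comm] at this
        linarith
      have k5 : ((θ t).2 : ℝ) * d.corr q (d.up q θ t) (d.down q θ t) (θ t).1 d.m ≤
          (θ t).2 * (d.H * G (θ t).1) + d.m := by
        have : ((θ t).2 : ℝ) * (d.corr q (d.up q θ t) (d.down q θ t) (θ t).1 d.m -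
            d.H * G (θ t).1) ≤ d.m := by
          refine (le_abs_self _).trans ?_
          rw [abs_mul, hbb, one_mul]
          exact k2
        linarith
      have k6 : d.H * |G e| ≤ d.H * (((θ t).2 : ℝ) * G (θ t).1 + 2 / d.H * d.m) := by
        have : (d.H : ℝ) * (((θ t).2 : ℝ) * G (θ t).1 + 2 / d.H * d.m) =
            (θ t).2 * (d.H * G (θ t).1) + 2 * d.m := by field_simp
        rw [this]
        linarith
      exact le_of_mul_le_mul_left k6 hH) c hc
  refine h.trans (mul_le_mul_of_nonneg_left (add_le_add ?_ ?_) (Nat.cast_nonneg _))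
  · rw [div_le_div_iff₀ (by positivity) hT']
    have : 1 ≤ d.H * d.step := by rwa [div_le_iff₀' hH] at hs1
    nlinarith [mul_nonneg (by linarith : (0 : ℝ) ≤ B) hT'.le]
  · rw [mul_div_right_comm]
    refine mul_le_mul_of_nonneg_right ?_ hT'.le
    have h4 : d.step ^ 2 ≤ (2 / d.H) ^ 2 := pow_le_pow_left₀ hs0.le hs2 2
    have h5 : d.step * (2 / d.H) ≤ (2 / d.H) * (2 / d.H) :=
      mul_le_mul_of_nonneg_right hs2 (by positivity)
    have h6 : (6 : ℝ) / d.H ^ 2 = (2 / d.H) ^ 2 / 2 + (2 / d.H) * (2 / d.H) := by ring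
    rw [h6]
    linarith

theorem abs_stat_sub_le (hd : d.Valid) {q q' t : ℕ} {θ θ' : ℕ → ℕ × ℤ}
    (hθ : ∀ r < t, (θ r).2 = 1 ∨ (θ r).2 = -1) (hθ' : ∀ r < t, (θ' r).2 = 1 ∨ (θ' r).2 = -1) :
    |(d.stat (d.up q θ t) (d.down q θ t) (d.up q' θ' t) (d.down q' θ' t) d.m : ℝ) -
      d.H * (∑ a ∈ Finset.range d.m, |tanh (d.logit q θ t a) - tanh (d.logit q' θ' t a)|)| ≤
    2 * d.m := by
  have hH : (0 : ℝ) ≤ d.H := Nat.cast_nonneg _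
  rw [stat]
  push_cast
  rw [Finset.mul_sum, ← Finset.sum_sub_distrib]
  refine (Finset.abs_sum_le_sum_abs _ _).trans ?_
  refine (Finset.sum_le_sum (g := fun _ => (2 : ℝ)) fun a ha => ?_).trans (by simp [mul_comm])
  have ha' := Finset.mem_range.mp ha
  have h1 := abs_pred_sub_le hd (q := q) ha' hθ
  have h2 := abs_pred_sub_le hd (q := q') ha' hθ'
  rw [← abs_of_nonneg hH, ← abs_mul, mul_sub]
  refine (abs_abs_sub_abs_le _ _).trans ?_
  rw [sub_sub_sub_comm]
  exact (abs_sub _ _).trans (by linarith)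

end RAM.TestData

/-! ### Chebyshev expansion of the hyperbolic tangent -/

namespace Complex

theorem normSq_cosh (w : ℂ) :
    normSq (cosh w) = Real.sinh w.re ^ 2 + Real.cos w.im ^ 2 := by
  have h : cosh w = Real.cosh w.re * Real.cos w.im + (Real.sinh w.re * Real.sin w.im : ℝ) * I := by
    conv_lhs => rw [← re_add_im w]
    rw [cosh_add, cosh_mul_I, sinh_mul_I]
    push_cast; ring
  rw [h, ← ofReal_mul, normSq_add_mul_I]
  have h1 := Real.cosh_sq w.re
  have h2 := Real.sin_sq_add_cos_sq w.im
  linear_combination Real.cos w.im ^ 2 * h1 + Real.sinh w.re ^ 2 * h2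

theorem normSq_sinh (w : ℂ) :
    normSq (sinh w) = Real.sinh w.re ^ 2 + Real.sin w.im ^ 2 := by
  have h : sinh w = Real.sinh w.re * Real.cos w.im + (Real.cosh w.re * Real.sin w.im : ℝ) * I := by
    conv_lhs => rw [← re_add_im w]
    rw [sinh_add, cosh_mul_I, sinh_mul_I]
    push_cast; ring
  rw [h, ← ofReal_mul, normSq_add_mul_I]
  have h1 := Real.cosh_sq w.re
  have h2 := Real.sin_sq_add_cos_sq w.im
  linear_combination Real.sin w.im ^ 2 * h1 + Real.sinh w.re ^ 2 * h2

theorem sin_sq_le_cos_sq {y : ℝ} (hy : |y| ≤ 1 / 2) :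
    0 < Real.cos y ^ 2 ∧ Real.sin y ^ 2 ≤ Real.cos y ^ 2 := by
  have h1 := Real.one_sub_sq_div_two_le_cos (x := y)
  have h2 := Real.sin_sq_add_cos_sq y
  have h3 : y ^ 2 ≤ (1 / 2) ^ 2 := sq_le_sq' (by linarith [abs_le.mp hy]) (abs_le.mp hy).2
  constructor <;> nlinarith

theorem cosh_ne_zero_of_abs_im_le {w : ℂ} (hw : |w.im| ≤ 1 / 2) : cosh w ≠ 0 := by
  rw [← normSq_pos, normSq_cosh]
  have := (sin_sq_le_cos_sq hw).1
  positivity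

theorem norm_tanh_le_one {w : ℂ} (hw : |w.im| ≤ 1 / 2) : ‖tanh w‖ ≤ 1 := by
  have h0 := norm_pos_iff.mpr (cosh_ne_zero_of_abs_im_le hw)
  rw [tanh_eq_sinh_div_cosh, norm_div, div_le_one h0, ← abs_norm, ← abs_norm (cosh w),
    ← sq_le_sq, ← normSq_eq_norm_sq, ← normSq_eq_norm_sq, normSq_cosh, normSq_sinh]
  linarith [(sin_sq_le_cos_sq hw).2]

theorem abs_im_add_inv_le {Λ ρ : ℝ} (hΛ : 1 ≤ Λ) (hρ : ρ = 1 + 1 / (2 * Λ)) {z : ℂ} (b : ℝ)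
    (h1 : ρ⁻¹ ≤ ‖z‖) (h2 : ‖z‖ ≤ ρ) : |(b + Λ * ((z + z⁻¹) / 2) : ℂ).im| ≤ 1 / 2 := by
  have hρ1 : 1 < ρ := by rw [hρ]; simp; linarith
  have hz : 0 < ‖z‖ := (inv_pos.mpr (by linarith)).trans_le h1
  set R := ‖z‖ with hR
  have e : (b + Λ * ((z + z⁻¹) / 2) : ℂ).im = Λ / 2 * (z.im * (1 - (R ^ 2)⁻¹)) := by
    have : ((z + z⁻¹) / 2).im = (z.im * (1 - (R ^ 2)⁻¹)) / 2 := by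
      rw [div_ofNat_im, add_im, inv_im, normSq_eq_norm_sq, ← hR]; ring
    rw [add_im, ofReal_im, im_ofReal_mul, this]; ring
  rw [e, abs_mul, abs_mul, abs_of_pos (by linarith : 0 < Λ / 2)]
  have h3 : |z.im| ≤ R := abs_im_le_norm z
  have h4 : R * |1 - (R ^ 2)⁻¹| ≤ ρ - ρ⁻¹ := by
    have e1 : R * |1 - (R ^ 2)⁻¹| = |R - R⁻¹| := by
      rw [← abs_of_pos hz, ← abs_mul, abs_of_pos hz]
      congr 1
      field_simp
    rw [e1, abs_le]
    have h5 : R⁻¹ ≤ ρ := by rwa [inv_le_comm₀ hz (by linarith)]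
    have h6 : ρ⁻¹ ≤ R⁻¹ := inv_anti₀ hz h2
    constructor <;> linarith
  have h7 : Λ * (ρ - ρ⁻¹) ≤ 1 := by
    have : 0 < ρ := by linarith
    rw [hρ] at this ⊢
    have hΛ0 : 0 < Λ := by linarith
    have e2 : (1 + 1 / (2 * Λ))⁻¹ = 2 * Λ / (2 * Λ + 1) := by field_simp
    rw [e2]
    have e3 : Λ * (1 + 1 / (2 * Λ) - 2 * Λ / (2 * Λ + 1)) = (4 * Λ + 1) / (2 * (2 * Λ + 1)) := by
      field_simp; ring
    rw [e3, div_le_one (by positivity)]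
    linarith
  have h8 : |z.im| * |1 - (R ^ 2)⁻¹| ≤ ρ - ρ⁻¹ :=
    (mul_le_mul_of_nonneg_right h3 (abs_nonneg _)).trans h4
  nlinarith

/-- The Laurent coefficients of `z ↦ tanh (b + Λ (z + 1 / z) / 2)` on the unit circle. -/
noncomputable def tanhLaurent (Λ b : ℝ) (k : ℤ) : ℂ :=
  (2 * Real.pi * I : ℂ)⁻¹ • ∮ z in C(0, 1), tanh (b + Λ * ((z + z⁻¹) / 2)) * z ^ (-k - 1)

theorem norm_tanhLaurent_le_zpow {Λ ρ R : ℝ} (hΛ : 1 ≤ Λ) (hρ : ρ = 1 + 1 / (2 * Λ)) (b : ℝ)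
    (k : ℤ) (h1 : ρ⁻¹ ≤ R) (h2 : R ≤ ρ) : ‖tanhLaurent Λ b k‖ ≤ R ^ (-k) := by
  have hρ1 : 1 < ρ := by rw [hρ]; simp; linarith
  have hρi : ρ⁻¹ ≤ 1 := inv_le_one_of_one_le₀ hρ1.le
  have hR : 0 < R := (inv_pos.mpr (by linarith)).trans_le h1
  have hd : ∀ z : ℂ, ρ⁻¹ ≤ ‖z‖ → ‖z‖ ≤ ρ →
      DifferentiableAt ℂ (fun z : ℂ => tanh (b + Λ * ((z + z⁻¹) / 2)) * z ^ (-k - 1)) z := by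
    intro z hz1 hz2
    have hz : z ≠ 0 := norm_pos_iff.mp ((inv_pos.mpr (by linarith)).trans_le hz1)
    have hc := cosh_ne_zero_of_abs_im_le (abs_im_add_inv_le hΛ hρ b hz1 hz2)
    have hw : DifferentiableAt ℂ (fun z : ℂ => (b + Λ * ((z + z⁻¹) / 2) : ℂ)) z := by
      have := differentiableAt_inv (𝕜 := ℂ) hz
      fun_prop
    simp only [tanh_eq_sinh_div_cosh]
    refine DifferentiableAt.mul ?_ (differentiableAt_zpow.mpr (Or.inl hz))
    exact (differentiable_sinh.differentiableAt.comp z hw).div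
      (differentiable_cosh.differentiableAt.comp z hw) hc
  have hshift : ∀ r s : ℝ, ρ⁻¹ ≤ r → r ≤ s → s ≤ ρ →
      (∮ z in C(0, s), tanh (b + Λ * ((z + z⁻¹) / 2)) * z ^ (-k - 1)) =
        ∮ z in C(0, r), tanh (b + Λ * ((z + z⁻¹) / 2)) * z ^ (-k - 1) := by
    intro r s hr hrs hs
    refine circleIntegral_eq_of_differentiable_on_annulus_off_countable
      ((inv_pos.mpr (by linarith)).trans_le hr) hrs Set.countable_empty (fun z hz => ?_)
      fun z hz => ?_
    · refine (hd z ?_ ?_).continuousAt.continuousWithinAt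
      · have := hz.2
        simp only [Metric.mem_ball, dist_zero_right, not_lt] at this
        exact hr.trans this
      · have := hz.1
        simp only [Metric.mem_closedBall, dist_zero_right] at this
        exact this.trans hs
    · refine hd z ?_ ?_
      · have := hz.1.2
        simp only [Metric.mem_closedBall, dist_zero_right, not_le] at this
        exact hr.trans this.le
      · have := hz.1.1
        simp only [Metric.mem_ball, dist_zero_right] at this
        exact this.le.trans hs
  have hR1 : (∮ z in C(0, 1), tanh (b + Λ * ((z + z⁻¹) / 2)) * z ^ (-k - 1)) =
      ∮ z in C(0, R), tanh (b + Λ * ((z + z⁻¹) / 2)) * z ^ (-k - 1) := by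
    rcases le_total R 1 with h | h
    · exact hshift R 1 h1 h hρ1.le
    · exact (hshift 1 R hρi h h2).symm
  rw [tanhLaurent, hR1]
  refine (circleIntegral.norm_two_pi_i_inv_smul_integral_le_of_norm_le_const hR.le
    (C := R ^ (-k - 1)) fun z hz => ?_).trans (le_of_eq ?_)
  · have hz' : ‖z‖ = R := by simpa using hz
    rw [norm_mul, norm_zpow, hz']
    exact mul_le_of_le_one_left (by positivity)
      (norm_tanh_le_one (abs_im_add_inv_le hΛ hρ b (hz' ▸ h1) (hz' ▸ h2)))
  · rw [zpow_sub_one₀ hR.ne']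
    field_simp

theorem tanhLaurent_eq (Λ b : ℝ) (k : ℤ) : tanhLaurent Λ b k =
    (1 / (2 * Real.pi) : ℝ) • ∫ t in (0 : ℝ)..2 * Real.pi,
      exp (-(k * t * I)) * (Real.tanh (b + Λ * Real.cos t) : ℂ) := by
  have e : ∀ t : ℝ, deriv (circleMap 0 1) t •
      (tanh (b + Λ * ((circleMap 0 1 t + (circleMap 0 1 t)⁻¹) / 2)) *
        circleMap 0 1 t ^ (-k - 1)) =
      I * (exp (-(k * t * I)) * (Real.tanh (b + Λ * Real.cos t) : ℂ)) := by
    intro t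
    have h1 : circleMap 0 1 t = exp (t * I) := by simp [circleMap]
    have h2 : (exp (t * I) + (exp (t * I))⁻¹) / 2 = cos t := by
      rw [← exp_neg, cos, neg_mul]
    rw [deriv_circleMap, h1, h2, ← exp_int_mul, smul_eq_mul]
    have h3 : exp (t * I) * exp ((-k - 1 : ℤ) * (t * I)) = exp (-(k * t * I)) := by
      rw [← exp_add]; congr 1; push_cast; ring
    rw [← h3]
    push_cast
    ring
  rw [tanhLaurent, circleIntegral]
  simp only [e]
  rw [intervalIntegral.integral_const_mul, smul_eq_mul, ← mul_assoc, real_smul]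
  congr 1
  push_cast
  have := Real.pi_ne_zero
  field_simp

theorem continuous_tanhLaurent (Λ : ℝ) (k : ℤ) : Continuous fun b => tanhLaurent Λ b k := by
  simp only [tanhLaurent_eq]
  have h := Real.continuous_tanh
  have h' : Continuous fun b : ℝ => ∫ t in (0 : ℝ)..2 * Real.pi,
      exp (-(k * t * I)) * (Real.tanh (b + Λ * Real.cos t) : ℂ) :=
    intervalIntegral.continuous_parametric_intervalIntegral_of_continuous'
      (by unfold Function.uncurry; fun_prop) _ _
  exact h'.const_smul (1 / (2 * Real.pi) : ℝ)

theorem norm_tanhLaurent_le {Λ ρ : ℝ} (hΛ : 1 ≤ Λ) (hρ : ρ = 1 + 1 / (2 * Λ)) (b : ℝ) (k : ℕ) :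
    ‖tanhLaurent Λ b k‖ ≤ ρ⁻¹ ^ k ∧ ‖tanhLaurent Λ b (-k)‖ ≤ ρ⁻¹ ^ k := by
  have hρ1 : 1 < ρ := by rw [hρ]; simp; linarith
  have hρi : ρ⁻¹ ≤ ρ := (inv_le_one_of_one_le₀ hρ1.le).trans hρ1.le
  constructor
  · refine (norm_tanhLaurent_le_zpow hΛ hρ b k hρi le_rfl).trans (le_of_eq ?_)
    rw [zpow_neg, zpow_natCast, inv_pow]
  · refine (norm_tanhLaurent_le_zpow hΛ hρ b (-k) le_rfl hρi).trans (le_of_eq ?_)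
    rw [neg_neg, zpow_natCast]

theorem hasSum_tanhLaurent {Λ : ℝ} (hΛ : 1 ≤ Λ) (b t : ℝ) :
    HasSum (fun k : ℤ => tanhLaurent Λ b k * exp (k * t * I))
      (Real.tanh (b + Λ * Real.cos t) : ℂ) := by
  have : Fact (0 < 2 * Real.pi) := ⟨Real.two_pi_pos⟩
  let f : C(AddCircle (2 * Real.pi), ℂ) :=
    ⟨fun θ => (Real.tanh (b + Λ * Real.Angle.cos θ) : ℂ),
      continuous_ofReal.comp (Real.continuous_tanh.comp
        (continuous_const.add (continuous_const.mul Real.Angle.continuous_cos)))⟩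
  have hf : ∀ x : ℝ, f (x : AddCircle (2 * Real.pi)) = (Real.tanh (b + Λ * Real.cos x) : ℂ) :=
    fun x => by
      change (Real.tanh (b + Λ * Real.Angle.cos (x : Real.Angle)) : ℂ) = _
      rw [Real.Angle.cos_coe]
  have hπ : (2 * Real.pi : ℂ) ≠ 0 := by
    have := Real.pi_ne_zero
    simp [this]
  have hexp : ∀ (k : ℤ) (x : ℝ), fourier k (x : AddCircle (2 * Real.pi)) = exp (k * x * I) := by
    intro k x
    rw [fourier_coe_apply]
    congr 1
    push_cast
    field_simp
  have hc : ∀ k, fourierCoeff f k = tanhLaurent Λ b k := by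
    intro k
    rw [fourierCoeff_eq_intervalIntegral f k 0, tanhLaurent_eq, zero_add]
    simp only [hexp, hf, smul_eq_mul]
    push_cast
    simp only [neg_mul]
  have hρ1 : (1 : ℝ) < 1 + 1 / (2 * Λ) := by simp; linarith
  have hsum : Summable (fourierCoeff f) := by
    have hg : Summable fun k : ℕ => (1 + 1 / (2 * Λ))⁻¹ ^ k :=
      summable_geometric_of_lt_one (by positivity) (inv_lt_one_of_one_lt₀ hρ1)
    refine Summable.of_nat_of_neg (Summable.of_norm_bounded hg fun k => ?_)
      (Summable.of_norm_bounded hg fun k => ?_)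
    · rw [hc]; exact (norm_tanhLaurent_le hΛ rfl b k).1
    · rw [hc]; exact (norm_tanhLaurent_le hΛ rfl b k).2
  have := has_pointwise_sum_fourier_series_of_summable hsum (t : AddCircle (2 * Real.pi))
  rw [hf] at this
  simpa only [hc, hexp, smul_eq_mul] using this

end Complex

/-- The coefficients of the expansion of `s ↦ tanh (b + s)` in the Chebyshev polynomials
of `s / Λ`. -/
noncomputable def tanhChebyshev (Λ : ℝ) (k : ℕ) (b : ℝ) : ℝ :=
  (Complex.tanhLaurent Λ b k + Complex.tanhLaurent Λ b (-k)).re -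
    if k = 0 then (Complex.tanhLaurent Λ b 0).re else 0

/-- The coefficients of the expansion of `s ↦ (log cosh (b + s + w) - log cosh (b + s - w)) / 2` in
the Chebyshev polynomials of `s / Λ`. -/
noncomputable def logCoshChebyshev (Λ : ℝ) (k : ℕ) (b w : ℝ) : ℝ :=
  (∫ u in -w..w, tanhChebyshev Λ k (b + u)) / 2

section Chebyshev

open Real

theorem continuous_tanhChebyshev (Λ : ℝ) (k : ℕ) : Continuous (tanhChebyshev Λ k) := by
  unfold tanhChebyshev
  have h1 := Complex.continuous_tanhLaurent Λ k
  have h2 := Complex.continuous_tanhLaurent Λ (-k)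
  have h3 := Complex.continuous_tanhLaurent Λ 0
  split_ifs
  · exact (Complex.continuous_re.comp (h1.add h2)).sub (Complex.continuous_re.comp h3)
  · exact (Complex.continuous_re.comp (h1.add h2)).sub continuous_const

theorem abs_tanhChebyshev_le {Λ ρ : ℝ} (hΛ : 1 ≤ Λ) (hρ : ρ = 1 + 1 / (2 * Λ)) (k : ℕ) (b : ℝ) :
    |tanhChebyshev Λ k b| ≤ 2 * ρ⁻¹ ^ k := by
  obtain ⟨h1, h2⟩ := Complex.norm_tanhLaurent_le hΛ hρ b k
  unfold tanhChebyshev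
  split_ifs with hk
  · subst hk
    have h3 := Complex.abs_re_le_norm (Complex.tanhLaurent Λ b 0)
    simp only [Nat.cast_zero, neg_zero, pow_zero, Complex.add_re, add_sub_cancel_right] at *
    linarith
  · rw [sub_zero]
    exact (Complex.abs_re_le_norm _).trans ((norm_add_le _ _).trans (by linarith))

theorem hasSum_tanhChebyshev {Λ : ℝ} (hΛ : 1 ≤ Λ) (b t : ℝ) :
    HasSum (fun k : ℕ => tanhChebyshev Λ k b * cos (k * t)) (tanh (b + Λ * cos t)) := by
  have h1 := Complex.hasSum_tanhLaurent hΛ b t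
  have h2 := Complex.hasSum_tanhLaurent hΛ b (-t)
  rw [cos_neg] at h2
  have h3 := ((h1.add h2).mul_left (1 / 2)).nat_add_neg
  have h4 := Complex.hasSum_re h3
  have h5 := h4.sub (hasSum_ite_eq (0 : ℕ) (Complex.tanhLaurent Λ b 0).re)
  have e : ∀ k : ℤ, (1 / 2 : ℂ) * (Complex.tanhLaurent Λ b k * Complex.exp (k * t * Complex.I) +
      Complex.tanhLaurent Λ b k * Complex.exp (k * (-t : ℝ) * Complex.I)) =
      Complex.tanhLaurent Λ b k * (cos (k * t) : ℝ) := by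
    intro k
    rw [Complex.ofReal_cos, Complex.cos]
    push_cast
    have : (k : ℂ) * -t * Complex.I = -(k * t) * Complex.I := by ring
    rw [this]
    ring
  simp only [e] at h5
  have e1 : (fun k : ℕ => tanhChebyshev Λ k b * cos (k * t)) = fun k : ℕ =>
      (Complex.tanhLaurent Λ b k * (cos ((k : ℤ) * t) : ℝ) +
        Complex.tanhLaurent Λ b (-k) * (cos ((-k : ℤ) * t) : ℝ)).re -
      if k = 0 then (Complex.tanhLaurent Λ b 0).re else 0 := by
    funext k
    unfold tanhChebyshev
    rw [Int.cast_neg, neg_mul, cos_neg, ← add_mul, Complex.re_mul_ofReal, Int.cast_natCast]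
    split_ifs with hk
    · subst hk; simp
    · simp
  have e2 : tanh (b + Λ * cos t) = (1 / 2 * ((tanh (b + Λ * cos t) : ℂ) + tanh (b + Λ * cos t)) +
      Complex.tanhLaurent Λ b 0 * (cos ((0 : ℤ) * t) : ℝ)).re -
        (Complex.tanhLaurent Λ b 0).re := by
    generalize tanh (b + Λ * cos t) = v
    rw [← two_mul, ← mul_assoc, Int.cast_zero, zero_mul, cos_zero]
    norm_num
  rw [← e1, ← e2] at h5
  exact h5

/-- Approximation of the hyperbolic tangent by partial sums of the Chebyshev series. -/
theorem abs_sum_tanhChebyshev_sub_le {Λ ρ : ℝ} (hΛ : 1 ≤ Λ) (hρ : ρ = 1 + 1 / (2 * Λ)) (n : ℕ)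
    {s : ℝ} (hs : |s| ≤ Λ) (b : ℝ) :
    |∑ k ∈ Finset.range n, tanhChebyshev Λ k b * (Polynomial.Chebyshev.T ℝ k).eval (s / Λ) -
      tanh (b + s)| ≤ 6 * Λ * ρ⁻¹ ^ n := by
  have hΛ0 : 0 < Λ := by linarith
  have hs' := abs_le.mp hs
  set t := arccos (s / Λ) with ht
  have hcos : cos t = s / Λ :=
    cos_arccos (by rw [le_div_iff₀ hΛ0]; linarith) (by rw [div_le_one hΛ0]; linarith)
  have hsum := hasSum_tanhChebyshev hΛ b t
  have e1 : Λ * cos t = s := by rw [hcos]; field_simp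
  rw [e1] at hsum
  have hρ1 : 1 < ρ := by rw [hρ]; simp; linarith
  have hρ0 : 0 < ρ := by linarith
  have h := norm_sub_le_of_geometric_bound_of_hasSum (r := ρ⁻¹) (C := 2)
    (inv_lt_one_of_one_lt₀ hρ1) (fun k => ?_) hsum n
  · rw [norm_eq_abs] at h
    have e2 : ∀ k : ℕ, (Polynomial.Chebyshev.T ℝ k).eval (s / Λ) = cos (k * t) := fun k => by
      rw [← hcos, Polynomial.Chebyshev.T_real_cos]; simp
    simp only [e2]
    refine h.trans ?_
    have e3 : 1 - ρ⁻¹ = 1 / (2 * Λ + 1) := by rw [hρ]; field_simp; ring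
    rw [e3, div_div_eq_mul_div, div_one]
    have : 0 < ρ⁻¹ ^ n := by positivity
    nlinarith
  · rw [norm_mul]
    refine (mul_le_of_le_one_right (norm_nonneg _) (abs_cos_le_one _)).trans ?_
    exact abs_tanhChebyshev_le hΛ hρ k b

theorem integral_tanh_add (s w : ℝ) :
    ∫ u in -w..w, tanh (s + u) = log (cosh (s + w)) - log (cosh (s - w)) := by
  have h : ∀ u ∈ Set.uIcc (-w) w, HasDerivAt (fun u => log (cosh (s + u))) (tanh (s + u)) u :=
    fun u _ => by simpa using (hasDerivAt_log_cosh (s + u)).comp_const_add s u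
  rw [intervalIntegral.integral_eq_sub_of_hasDerivAt h
    ((continuous_tanh.comp (by fun_prop)).intervalIntegrable _ _), sub_eq_add_neg s w]

theorem abs_logCoshChebyshev_le {Λ : ℝ} (hΛ : 1 ≤ Λ) (k : ℕ) (b w : ℝ) :
    |logCoshChebyshev Λ k b w| ≤ 2 * |w| := by
  have hρ1 : (1 : ℝ) < 1 + 1 / (2 * Λ) := by simp; linarith
  have h := intervalIntegral.norm_integral_le_of_norm_le_const (a := -w) (b := w) (C := 2)
    (f := fun u => tanhChebyshev Λ k (b + u)) fun u _ =>
      (abs_tanhChebyshev_le hΛ rfl k (b + u)).trans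
        (mul_le_of_le_one_right (by norm_num)
          (pow_le_one₀ (by positivity) (inv_le_one_of_one_le₀ hρ1.le)))
  rw [sub_neg_eq_add, ← two_mul, abs_mul, abs_of_pos (by norm_num : (0 : ℝ) < 2), norm_eq_abs] at h
  unfold logCoshChebyshev
  rw [abs_div, abs_of_pos (by norm_num : (0 : ℝ) < 2)]
  linarith

theorem abs_sum_logCoshChebyshev_sub_le {Λ ρ : ℝ} (hΛ : 1 ≤ Λ) (hρ : ρ = 1 + 1 / (2 * Λ)) (n : ℕ)
    {s : ℝ} (hs : |s| ≤ Λ) (b w : ℝ) :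
    |∑ k ∈ Finset.range n, logCoshChebyshev Λ k b w *
        (Polynomial.Chebyshev.T ℝ k).eval (s / Λ) -
      (log (cosh (b + s + w)) - log (cosh (b + s - w))) / 2| ≤ |w| * (6 * Λ * ρ⁻¹ ^ n) := by
  rw [← integral_tanh_add]
  have hc : ∀ k, Continuous fun u => tanhChebyshev Λ k (b + u) := fun k =>
    (continuous_tanhChebyshev Λ k).comp (by fun_prop)
  have ht : Continuous fun u => tanh (b + s + u) := continuous_tanh.comp (by fun_prop)
  have hi : ∀ k : ℕ, Continuous fun u => tanhChebyshev Λ k (b + u) *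
      (Polynomial.Chebyshev.T ℝ k).eval (s / Λ) := fun k => (hc k).mul continuous_const
  have e1 : ∑ k ∈ Finset.range n, logCoshChebyshev Λ k b w *
      (Polynomial.Chebyshev.T ℝ k).eval (s / Λ) =
      (∫ u in -w..w, ∑ k ∈ Finset.range n, tanhChebyshev Λ k (b + u) *
        (Polynomial.Chebyshev.T ℝ k).eval (s / Λ)) / 2 := by
    rw [intervalIntegral.integral_finsetSum (fun k _ => (hi k).intervalIntegrable _ _),
      Finset.sum_div]
    refine Finset.sum_congr rfl fun k _ => ?_
    rw [intervalIntegral.integral_mul_const, logCoshChebyshev]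
    ring
  rw [e1, ← sub_div, ← intervalIntegral.integral_sub
    ((continuous_finsetSum _ fun k _ => hi k).intervalIntegrable _ _)
    (ht.intervalIntegrable _ _)]
  have h := intervalIntegral.norm_integral_le_of_norm_le_const (a := -w) (b := w)
    (C := 6 * Λ * ρ⁻¹ ^ n)
    (f := fun u => ∑ k ∈ Finset.range n, tanhChebyshev Λ k (b + u) *
        (Polynomial.Chebyshev.T ℝ k).eval (s / Λ) - tanh (b + s + u)) fun u _ => by
      rw [add_right_comm]
      exact abs_sum_tanhChebyshev_sub_le hΛ hρ n hs (b + u)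
  rw [sub_neg_eq_add, ← two_mul, abs_mul, abs_of_pos (by norm_num : (0 : ℝ) < 2), norm_eq_abs] at h
  rw [abs_div, abs_of_pos (by norm_num : (0 : ℝ) < 2)]
  linarith

theorem inv_pow_le_two_rpow {Λ ρ : ℝ} (hΛ : 1 ≤ Λ) (hρ : ρ = 1 + 1 / (2 * Λ)) (n : ℕ) :
    ρ⁻¹ ^ n ≤ 2 ^ (-(n / (2 * Λ) : ℝ)) := by
  have hΛ0 : 0 < Λ := by linarith
  have hρ0 : 0 < ρ := by rw [hρ]; positivity
  have h1 : 2 ≤ ρ ^ (2 * Λ) := by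
    have := one_add_mul_self_le_rpow_one_add (s := 1 / (2 * Λ)) (p := 2 * Λ)
      (by have : 0 ≤ 1 / (2 * Λ) := by positivity
          linarith) (by linarith)
    rw [← hρ] at this
    refine le_trans (le_of_eq ?_) this
    field_simp; ring
  rw [inv_pow, rpow_neg (by norm_num)]
  refine inv_anti₀ (by positivity) ?_
  refine (rpow_le_rpow (by norm_num) h1 (by positivity)).trans (le_of_eq ?_)
  rw [← rpow_mul hρ0.le, ← rpow_natCast]
  congr 1
  field_simp

end Chebyshev

/-! ### Polynomials with bounded coefficients -/

/-- The function `F` is a homogeneous polynomial of degree `d` in the functions `ξ r`, and the sum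
of the absolute values of its coefficients is at most `B`. -/
def IsBoundedForm {Ω : Type*} {n : ℕ} (ξ : Fin n → Ω → ℝ) (d : ℕ) (B : ℝ) (F : Ω → ℝ) : Prop :=
  ∃ c : (Fin d → Fin n) → ℝ, ∑ e, |c e| ≤ B ∧ ∀ ω, F ω = ∑ e, c e * ∏ t, ξ (e t) ω

namespace IsBoundedForm

variable {Ω : Type*} {n d : ℕ} {ξ : Fin n → Ω → ℝ} {B B' : ℝ} {F G : Ω → ℝ}

theorem mono (h : IsBoundedForm ξ d B F) (hB : B ≤ B') : IsBoundedForm ξ d B' F :=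
  let ⟨c, hc, hF⟩ := h
  ⟨c, hc.trans hB, hF⟩

theorem add (hF : IsBoundedForm ξ d B F) (hG : IsBoundedForm ξ d B' G) :
    IsBoundedForm ξ d (B + B') (fun ω => F ω + G ω) := by
  obtain ⟨c, hc, hF⟩ := hF
  obtain ⟨c', hc', hG⟩ := hG
  refine ⟨fun e => c e + c' e, ?_, fun ω => ?_⟩
  · refine (Finset.sum_le_sum fun e _ => abs_add_le (c e) (c' e)).trans ?_
    rw [Finset.sum_add_distrib]
    exact add_le_add hc hc'
  · simp only [hF, hG]
    rw [← Finset.sum_add_distrib]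
    exact Finset.sum_congr rfl fun e _ => (add_mul _ _ _).symm

theorem const_mul (hF : IsBoundedForm ξ d B F) (a : ℝ) :
    IsBoundedForm ξ d (|a| * B) (fun ω => a * F ω) := by
  obtain ⟨c, hc, hF⟩ := hF
  refine ⟨fun e => a * c e, ?_, fun ω => ?_⟩
  · simp only [abs_mul, ← Finset.mul_sum]
    exact mul_le_mul_of_nonneg_left hc (abs_nonneg a)
  · simp only [hF, Finset.mul_sum, mul_assoc]

theorem zero : IsBoundedForm ξ d 0 (fun _ => 0) := ⟨fun _ => 0, by simp, by simp⟩

theorem sum {ι : Type*} (s : Finset ι) {B : ι → ℝ} {F : ι → Ω → ℝ}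
    (h : ∀ k ∈ s, IsBoundedForm ξ d (B k) (F k)) :
    IsBoundedForm ξ d (∑ k ∈ s, B k) (fun ω => ∑ k ∈ s, F k ω) := by
  classical
  induction s using Finset.induction_on with
  | empty => simpa using zero
  | insert a s ha ih =>
    simp only [Finset.sum_insert ha]
    exact (h a (Finset.mem_insert_self a s)).add
      (ih fun k hk => h k (Finset.mem_insert_of_mem hk))

theorem linear_mul (hF : IsBoundedForm ξ d B F) {w : Fin n → ℝ} (hw : ∑ r, |w r| ≤ 1) :
    IsBoundedForm ξ (d + 1) B (fun ω => (∑ r, w r * ξ r ω) * F ω) := by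
  obtain ⟨c, hc, hF⟩ := hF
  have hsum : ∀ f : (Fin (d + 1) → Fin n) → ℝ,
      ∑ e, f e = ∑ r, ∑ e : Fin d → Fin n, f (Fin.cons r e) := by
    intro f
    rw [← Fintype.sum_prod_type']
    exact (Fintype.sum_equiv (Fin.consEquiv fun _ => Fin n) _ _ fun _ => rfl).symm
  refine ⟨fun e => w (e 0) * c (Fin.tail e), ?_, fun ω => ?_⟩
  · rw [hsum]
    simp only [Fin.cons_zero, Fin.tail_cons, abs_mul, ← Finset.mul_sum, ← Finset.sum_mul]
    exact (mul_le_of_le_one_left (Finset.sum_nonneg fun _ _ => abs_nonneg _) hw).trans hc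
  · simp only [hF]
    rw [hsum, Finset.sum_mul]
    refine Finset.sum_congr rfl fun r _ => ?_
    rw [Finset.mul_sum]
    refine Finset.sum_congr rfl fun e _ => ?_
    rw [Fin.prod_univ_succ]
    simp only [Fin.cons_zero, Fin.cons_succ, Fin.tail_cons]
    ring

theorem of_le {i : Fin n} (hi : ∀ ω, ξ i ω = 1) (hF : IsBoundedForm ξ d B F) {d' : ℕ}
    (h : d ≤ d') : IsBoundedForm ξ d' B F := by
  induction d', h using Nat.le_induction with
  | base => exact hF
  | succ k _ ih =>
    have := ih.linear_mul (w := Pi.single i 1) (by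
      rw [Finset.sum_eq_single i (fun r _ hr => by simp [hr]) (by simp)]; simp)
    convert this using 2 with ω
    rw [Finset.sum_eq_single i (fun r _ hr => by simp [hr]) (by simp)]
    simp [hi]

theorem const {i : Fin n} (hi : ∀ ω, ξ i ω = 1) (a : ℝ) : IsBoundedForm ξ d |a| (fun _ => a) :=
  of_le (d := 0) hi ⟨fun _ => a, by simp, by simp⟩ (Nat.zero_le d)

theorem chebyshev {i : Fin n} (hi : ∀ ω, ξ i ω = 1) {w : Fin n → ℝ} (hw : ∑ r, |w r| ≤ 1)
    (k : ℕ) : IsBoundedForm ξ k (3 ^ k)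
      (fun ω => (Polynomial.Chebyshev.T ℝ k).eval (∑ r, w r * ξ r ω)) := by
  induction k using Nat.twoStepInduction with
  | zero => simpa using const (ξ := ξ) (d := 0) hi 1
  | one =>
    have := (const (ξ := ξ) (d := 0) hi 1).linear_mul hw
    simp only [abs_one, mul_one, zero_add] at this
    simpa using this.mono (by norm_num)
  | more k h1 h2 =>
    have h3 := ((h2.linear_mul hw).const_mul 2).add
      ((h1.of_le hi (Nat.le_add_right k 2)).const_mul (-1))
    have e : ∀ ω, (Polynomial.Chebyshev.T ℝ ((k + 2 : ℕ) : ℤ)).eval (∑ r, w r * ξ r ω) =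
        2 * ((∑ r, w r * ξ r ω) * (Polynomial.Chebyshev.T ℝ ((k + 1 : ℕ) : ℤ)).eval
          (∑ r, w r * ξ r ω)) +
        -1 * (Polynomial.Chebyshev.T ℝ (k : ℤ)).eval (∑ r, w r * ξ r ω) := by
      intro ω
      push_cast
      rw [Polynomial.Chebyshev.T_add_two]
      simp only [Polynomial.eval_sub, Polynomial.eval_mul, Polynomial.eval_ofNat,
        Polynomial.eval_X]
      ring
    simp only [e]
    refine h3.mono ?_
    have : (0 : ℝ) < 3 ^ k := by positivity
    rw [abs_neg, abs_one, abs_of_pos (by norm_num : (0 : ℝ) < 2), pow_succ, pow_add]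
    linarith

/-- The coefficients indexed by natural numbers instead of sequences of digits. -/
theorem exists_coeff (h : IsBoundedForm ξ d B F) (hn : 0 < n) :
    ∃ c : ℕ → ℝ, ∑ e ∈ Finset.range (n ^ d), |c e| ≤ B ∧ ∀ ω, F ω =
      ∑ e ∈ Finset.range (n ^ d), c e *
        ∏ t ∈ Finset.range d, ξ ⟨e / n ^ t % n, Nat.mod_lt _ hn⟩ ω := by
  obtain ⟨c, hc, hF⟩ := h
  refine ⟨fun e => if h : e < n ^ d then c (finFunctionFinEquiv.symm ⟨e, h⟩) else 0, ?_,
    fun ω => ?_⟩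
  · rw [Finset.sum_range]
    simp only [Fin.is_lt, dite_true, Fin.eta]
    rwa [Equiv.sum_comp finFunctionFinEquiv.symm fun e => |c e|]
  · rw [Finset.sum_range, hF]
    simp only [Fin.is_lt, dite_true, Fin.eta]
    rw [← Equiv.sum_comp finFunctionFinEquiv.symm]
    refine Finset.sum_congr rfl fun e _ => ?_
    rw [Finset.prod_range]
    rfl

end IsBoundedForm

/-! ### Conditional laws of the visible units -/

theorem spin_sq (b : Bool) : (spin b : ℝ) * spin b = 1 := by cases b <;> simp [spin]

theorem abs_spin (b : Bool) : |(spin b : ℝ)| = 1 := by cases b <;> simp [spin]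

theorem spin_not (b : Bool) : (spin (!b) : ℝ) = -spin b := by cases b <;> simp [spin]

section Flip

variable {n : ℕ}

/-- The configuration with the spin of `i` flipped. -/
def flipSpin (i : Fin n) (x : Fin n → Bool) : Fin n → Bool := Function.update x i (!x i)

@[simp] theorem flipSpin_self (i : Fin n) (x : Fin n → Bool) : flipSpin i x i = !x i := by simp [flipSpin]

theorem flipSpin_ne {i r : Fin n} (h : r ≠ i) (x : Fin n → Bool) : flipSpin i x r = x r := by
  simp [flipSpin, h]

@[simp] theorem flipSpin_flipSpin (i : Fin n) (x : Fin n → Bool) : flipSpin i (flipSpin i x) = x := by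
  ext r
  by_cases h : r = i
  · subst h; simp
  · rw [flipSpin_ne h, flipSpin_ne h]

theorem flipSpin_comm (i j : Fin n) (x : Fin n → Bool) : flipSpin i (flipSpin j x) = flipSpin j (flipSpin i x) := by
  ext r
  by_cases h : r = i
  · subst h
    by_cases h' : r = j
    · subst h'; rfl
    · simp [flipSpin_ne h']
  · by_cases h' : r = j
    · subst h'; simp [flipSpin_ne h]
    · simp [flipSpin_ne h, flipSpin_ne h']

theorem sum_flipSpin (i : Fin n) (f : (Fin n → Bool) → ℝ) : ∑ x, f (flipSpin i x) = ∑ x, f x :=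
  Equiv.sum_comp (Function.Involutive.toPerm (flipSpin i) (flipSpin_flipSpin i)) f

theorem eq_or_eq_flipSpin {i : Fin n} {x y : Fin n → Bool} (h : ∀ r, r ≠ i → y r = x r) :
    y = x ∨ y = flipSpin i x := by
  by_cases hi : y i = x i
  · left; ext r; by_cases hr : r = i
    · subst hr; rw [hi]
    · rw [h r hr]
  · right; ext r; by_cases hr : r = i
    · subst hr; simp; cases h1 : x r <;> cases h2 : y r <;> simp_all
    · rw [h r hr, flipSpin_ne hr]

theorem flipSpin_ne_self (i : Fin n) (x : Fin n → Bool) : flipSpin i x ≠ x := fun h => by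
  have := congrFun h i
  simp at this

end Flip

namespace RBM

open Real

variable {n k : ℕ} (R : RBM n k)

theorem sum_weight (x : Fin n → Bool) : ∑ h, R.weight x h =
    exp (∑ i, R.b₁ i * (spin (x i) : ℝ)) *
      ∏ j, (2 * cosh (R.b₂ j + ∑ i, R.W i j * (spin (x i) : ℝ))) := by
  have h1 : ∀ h : Fin k → Bool, R.weight x h = exp (∑ i, R.b₁ i * (spin (x i) : ℝ)) *
      ∏ j, exp ((spin (h j) : ℝ) * (R.b₂ j + ∑ i, R.W i j * (spin (x i) : ℝ))) := by
    intro h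
    rw [weight, ← exp_sum, ← exp_add, Finset.sum_comm]
    congr 1
    have : ∀ j, (spin (h j) : ℝ) * (R.b₂ j + ∑ i, R.W i j * (spin (x i) : ℝ)) =
        (∑ i, R.W i j * (spin (x i) : ℝ) * (spin (h j) : ℝ)) + R.b₂ j * (spin (h j) : ℝ) := by
      intro j
      rw [← Finset.sum_mul]; ring
    simp only [this, Finset.sum_add_distrib]
    ring
  have h2 : ∀ a : ℝ, 2 * cosh a = ∑ b : Bool, exp ((spin b : ℝ) * a) := by
    intro a
    rw [cosh_eq]
    simp [spin]
    ring
  simp only [h1, h2]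
  rw [← Finset.mul_sum, Finset.prod_univ_sum, Fintype.piFinset_univ]

/-- The field acting on the hidden unit `j`, without the contribution of the visible unit `i`. -/
noncomputable def rest (i : Fin n) (j : Fin k) (x : Fin n → Bool) : ℝ :=
  R.b₂ j + ∑ r ∈ Finset.univ.erase i, R.W r j * (spin (x r) : ℝ)

/-- Half the conditional log-odds of the visible unit `i`. -/
noncomputable def halfLogit (i : Fin n) (x : Fin n → Bool) : ℝ :=
  R.b₁ i + ∑ j, (log (cosh (R.rest i j x + R.W i j)) - log (cosh (R.rest i j x - R.W i j))) / 2

theorem rest_congr {i : Fin n} {x y : Fin n → Bool} (h : ∀ r, r ≠ i → y r = x r) (j : Fin k) :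
    R.rest i j y = R.rest i j x := by
  unfold rest
  congr 1
  exact Finset.sum_congr rfl fun r hr => by rw [h r (Finset.ne_of_mem_erase hr)]

theorem halfLogit_congr {i : Fin n} {x y : Fin n → Bool} (h : ∀ r, r ≠ i → y r = x r) :
    R.halfLogit i y = R.halfLogit i x := by
  simp only [halfLogit, R.rest_congr h]

theorem halfLogit_flip_self (i : Fin n) (x : Fin n → Bool) :
    R.halfLogit i (flipSpin i x) = R.halfLogit i x :=
  R.halfLogit_congr fun _ h => flipSpin_ne h x

theorem prob_flip (i : Fin n) (x : Fin n → Bool) :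
    R.prob (flipSpin i x) = R.prob x * exp (-2 * ((spin (x i) : ℝ) * R.halfLogit i x)) := by
  have hfield : ∀ (y : Fin n → Bool) (j : Fin k),
      R.b₂ j + ∑ r, R.W r j * (spin (y r) : ℝ) = R.rest i j y + R.W i j * (spin (y i) : ℝ) := by
    intro y j
    rw [rest, ← Finset.add_sum_erase _ _ (Finset.mem_univ i)]; ring
  have hb : ∑ r, R.b₁ r * (spin (flipSpin i x r) : ℝ) =
      ∑ r, R.b₁ r * (spin (x r) : ℝ) - 2 * (R.b₁ i * (spin (x i) : ℝ)) := by
    rw [← Finset.add_sum_erase _ _ (Finset.mem_univ i),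
      ← Finset.add_sum_erase _ (fun r => R.b₁ r * (spin (x r) : ℝ)) (Finset.mem_univ i),
      flipSpin_self, spin_not, Finset.sum_congr rfl fun r hr => by
        rw [flipSpin_ne (Finset.ne_of_mem_erase hr)]]
    ring
  have hc : ∀ j, cosh (R.rest i j x - R.W i j * (spin (x i) : ℝ)) =
      cosh (R.rest i j x + R.W i j * (spin (x i) : ℝ)) *
        exp (-2 * ((spin (x i) : ℝ) * ((log (cosh (R.rest i j x + R.W i j)) -
          log (cosh (R.rest i j x - R.W i j))) / 2))) := by
    intro j
    have e1 := exp_log (cosh_pos (R.rest i j x + R.W i j))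
    have e2 := exp_log (cosh_pos (R.rest i j x - R.W i j))
    cases x i
    · simp only [spin, Bool.false_eq_true, if_false, Int.cast_neg, Int.cast_one, mul_neg, mul_one,
        sub_neg_eq_add, ← sub_eq_add_neg]
      have : -2 * (-1 * ((log (cosh (R.rest i j x + R.W i j)) -
          log (cosh (R.rest i j x - R.W i j))) / 2)) = log (cosh (R.rest i j x + R.W i j)) -
          log (cosh (R.rest i j x - R.W i j)) := by ring
      rw [this, exp_sub, e1, e2, mul_div_cancel₀ _ (cosh_pos _).ne']
    · simp only [spin, if_true, Int.cast_one, mul_one]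
      have : -2 * (1 * ((log (cosh (R.rest i j x + R.W i j)) -
          log (cosh (R.rest i j x - R.W i j))) / 2)) = log (cosh (R.rest i j x - R.W i j)) -
          log (cosh (R.rest i j x + R.W i j)) := by ring
      rw [this, exp_sub, e1, e2, mul_div_cancel₀ _ (cosh_pos _).ne']
  rw [prob, prob, sum_weight, sum_weight, hb, exp_sub]
  simp only [hfield, flipSpin_self, spin_not, mul_neg, ← sub_eq_add_neg]
  rw [Finset.prod_congr rfl fun j _ => by
    rw [R.rest_congr (fun r h => flipSpin_ne h x) j, hc j, ← mul_assoc],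
    Finset.prod_mul_distrib, ← exp_sum, halfLogit, mul_add, mul_add, exp_add, Finset.mul_sum,
    Finset.mul_sum]
  have : exp (-2 * ((spin (x i) : ℝ) * R.b₁ i)) = (exp (2 * (R.b₁ i * (spin (x i) : ℝ))))⁻¹ := by
    rw [← exp_neg]; congr 1; ring
  rw [this]
  field_simp

/-- The conditional probability of the spin `x i`. -/
theorem two_mul_prob (i : Fin n) (x : Fin n → Bool) : 2 * R.prob x =
    (R.prob x + R.prob (flipSpin i x)) * (1 + (spin (x i) : ℝ) * tanh (R.halfLogit i x)) := by
  have key : ∀ z : ℝ, (1 + exp (-2 * z)) * (1 + tanh z) = 2 := by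
    intro z
    rw [tanh_eq, neg_mul, two_mul, neg_add, exp_add, exp_neg]
    have := exp_pos z
    field_simp
    ring
  have h : tanh ((spin (x i) : ℝ) * R.halfLogit i x) =
      (spin (x i) : ℝ) * tanh (R.halfLogit i x) := by
    cases x i <;> simp [spin]
  rw [prob_flip, ← h]
  linear_combination (-R.prob x) * key ((spin (x i) : ℝ) * R.halfLogit i x)

theorem prob_mul_tanh (i : Fin n) (x : Fin n → Bool) :
    (R.prob x + R.prob (flipSpin i x)) * tanh (R.halfLogit i x) =
      (spin (x i) : ℝ) * (R.prob x - R.prob (flipSpin i x)) := by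
  have h := R.two_mul_prob i x
  have h1 := spin_sq (x i)
  linear_combination (-(spin (x i) : ℝ)) * h - (R.prob x + R.prob (flipSpin i x)) *
    tanh (R.halfLogit i x) * h1

theorem sum_prob_spin (i : Fin n) {F : (Fin n → Bool) → ℝ} (hF : ∀ x, F (flipSpin i x) = F x) :
    ∑ x, R.prob x * ((spin (x i) : ℝ) * F x) =
      ∑ x, R.prob x * (tanh (R.halfLogit i x) * F x) := by
  have h1 := sum_flipSpin i fun x => R.prob x * ((spin (x i) : ℝ) * F x)
  have h2 := sum_flipSpin i fun x => R.prob x * (tanh (R.halfLogit i x) * F x)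
  simp only [hF, R.halfLogit_flip_self, flipSpin_self, spin_not] at h1 h2
  have h3 : ∑ x, R.prob x * ((spin (x i) : ℝ) * F x) +
      ∑ x, R.prob (flipSpin i x) * (-(spin (x i) : ℝ) * F x) =
      ∑ x, R.prob x * (tanh (R.halfLogit i x) * F x) +
      ∑ x, R.prob (flipSpin i x) * (tanh (R.halfLogit i x) * F x) := by
    rw [← Finset.sum_add_distrib, ← Finset.sum_add_distrib]
    refine Finset.sum_congr rfl fun x _ => ?_
    linear_combination (-F x) * R.prob_mul_tanh i x
  linarith

/-- The expected logistic loss of a predictor of the spin of `i`. -/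
noncomputable def risk (i : Fin n) (p : (Fin n → Bool) → ℝ) : ℝ :=
  ∑ x, R.prob x * logisticLoss (spin (x i)) (p x)

theorem sq_sum_prob_abs_le (i : Fin n) {p : (Fin n → Bool) → ℝ} (hp : ∀ x, p (flipSpin i x) = p x) :
    (∑ x, R.prob x * |tanh (p x) - tanh (R.halfLogit i x)|) ^ 2 ≤
      2 * (R.risk i p - R.risk i (R.halfLogit i)) := by
  have h1 : ∀ q : (Fin n → Bool) → ℝ, (∀ x, q (flipSpin i x) = q x) →
      R.risk i q = ∑ x, R.prob x * (log (cosh (q x)) - tanh (R.halfLogit i x) * q x) := by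
    intro q hq
    have := R.sum_prob_spin i hq
    simp only [risk, logisticLoss, mul_sub, Finset.sum_sub_distrib]
    rw [this]
  rw [h1 p hp, h1 _ (R.halfLogit_flip_self i), ← Finset.sum_sub_distrib]
  have h2 : (∑ x, R.prob x * |tanh (p x) - tanh (R.halfLogit i x)|) ^ 2 ≤
      (∑ x, R.prob x) * ∑ x, R.prob x * |tanh (p x) - tanh (R.halfLogit i x)| ^ 2 := by
    refine Finset.sum_sq_le_sum_mul_sum_of_sq_le_mul _ (fun x _ => (R.prob_pos x).le)
      (fun x _ => mul_nonneg (R.prob_pos x).le (sq_nonneg _)) fun x _ => le_of_eq (by ring)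
  rw [R.sum_prob, one_mul] at h2
  refine h2.trans ?_
  rw [Finset.mul_sum]
  refine Finset.sum_le_sum fun x _ => ?_
  have h3 := sq_tanh_sub_le (p x) (R.halfLogit i x)
  rw [sq_abs]
  have h4 := mul_le_mul_of_nonneg_left h3 (R.prob_pos x).le
  nlinarith

theorem abs_risk_sub_le (i : Fin n) {p q : (Fin n → Bool) → ℝ} {ε : ℝ}
    (h : ∀ x, |p x - q x| ≤ ε) : |R.risk i p - R.risk i q| ≤ 2 * ε := by
  rw [risk, risk, ← Finset.sum_sub_distrib]
  refine (Finset.abs_sum_le_sum_abs _ _).trans ?_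
  calc ∑ x, |R.prob x * logisticLoss (spin (x i)) (p x) -
        R.prob x * logisticLoss (spin (x i)) (q x)| ≤ ∑ x, R.prob x * (2 * ε) := by
        refine Finset.sum_le_sum fun x _ => ?_
        rw [← mul_sub, abs_mul, abs_of_pos (R.prob_pos x)]
        refine mul_le_mul_of_nonneg_left ?_ (R.prob_pos x).le
        exact (abs_logisticLoss_sub_le (abs_spin _).le _ _).trans
          (mul_le_mul_of_nonneg_left (h x) (by norm_num))
    _ = 2 * ε := by rw [← Finset.sum_mul, R.sum_prob, one_mul]

end RBM

namespace RBM

open Real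

variable {n k : ℕ} (R : RBM n k)

theorem marginal_congr {S : Finset (Fin n)} {x y : Fin n → Bool} (h : ∀ v ∈ S, x v = y v) :
    R.marginal S x = R.marginal S y := by
  unfold marginal
  congr 1
  ext z
  simp only [Finset.mem_filter, Finset.mem_univ, true_and]
  exact forall₂_congr fun v hv => by rw [h v hv]

theorem marginal_univ (x : Fin n → Bool) : R.marginal Finset.univ x = R.prob x := by
  have : (Finset.univ.filter fun y : Fin n → Bool => ∀ v ∈ Finset.univ, y v = x v) = {x} := by
    ext y
    simp only [Finset.mem_filter, Finset.mem_univ, true_and, Finset.mem_singleton, forall_true_left]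
    exact ⟨fun h => funext h, fun h v => by rw [h]⟩
  rw [marginal, this, Finset.sum_singleton]

theorem marginal_erase (i : Fin n) (x : Fin n → Bool) :
    R.marginal (Finset.univ.erase i) x = R.prob x + R.prob (flipSpin i x) := by
  have : (Finset.univ.filter fun y : Fin n → Bool => ∀ v ∈ Finset.univ.erase i, y v = x v) =
      {x, flipSpin i x} := by
    ext y
    simp only [Finset.mem_filter, Finset.mem_univ, true_and, Finset.mem_insert,
      Finset.mem_singleton, Finset.mem_erase, and_true]
    refine ⟨fun h => eq_or_eq_flipSpin h, ?_⟩
    rintro (rfl | rfl) v hv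
    · rfl
    · exact flipSpin_ne hv x
  rw [marginal, this, Finset.sum_pair (flipSpin_ne_self i x).symm]

theorem marginal_erase_erase {i j : Fin n} (hij : i ≠ j) (x : Fin n → Bool) :
    R.marginal ((Finset.univ.erase i).erase j) x = (R.prob x + R.prob (flipSpin i x)) +
      (R.prob (flipSpin j x) + R.prob (flipSpin i (flipSpin j x))) := by
  have : (Finset.univ.filter fun y : Fin n → Bool =>
      ∀ v ∈ (Finset.univ.erase i).erase j, y v = x v) =
      {x, flipSpin i x} ∪ {flipSpin j x, flipSpin i (flipSpin j x)} := by
    ext y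
    simp only [Finset.mem_filter, Finset.mem_univ, true_and, Finset.mem_insert, Finset.mem_union,
      Finset.mem_singleton, Finset.mem_erase, and_true]
    constructor
    · intro h
      by_cases hj : y j = x j
      · refine Or.inl (eq_or_eq_flipSpin fun r hr => ?_)
        by_cases hrj : r = j
        · rw [hrj, hj]
        · exact h r ⟨hrj, hr⟩
      · refine Or.inr (eq_or_eq_flipSpin fun r hr => ?_)
        by_cases hrj : r = j
        · subst hrj
          rw [flipSpin_self]
          cases h1 : y r <;> cases h2 : x r <;> simp_all
        · rw [flipSpin_ne hrj]; exact h r ⟨hrj, hr⟩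
    · rintro ((rfl | rfl) | (rfl | rfl)) v ⟨hv, hv'⟩
      · rfl
      · exact flipSpin_ne hv' x
      · exact flipSpin_ne hv x
      · rw [flipSpin_ne hv', flipSpin_ne hv]
  rw [marginal, this, Finset.sum_union, Finset.sum_pair (flipSpin_ne_self i _).symm,
    Finset.sum_pair (flipSpin_ne_self i _).symm]
  rw [Finset.disjoint_left]
  intro y hy hy'
  simp only [Finset.mem_insert, Finset.mem_singleton] at hy hy'
  have h1 : y j = x j := by
    rcases hy with rfl | rfl
    · rfl
    · exact flipSpin_ne hij.symm x
  have h2 : y j = !x j := by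
    rcases hy' with rfl | rfl
    · simp
    · rw [flipSpin_ne hij.symm]; simp
  rw [h1] at h2
  cases h3 : x j <;> simp [h3] at h2

/-- If `j` is not a two-hop neighbor of `i`, then the conditional law of the spin of `i` does not
depend on the spin of `j`. -/
theorem halfLogit_flip_of_not_twoHopNeighbors {i j : Fin n} (hij : i ≠ j)
    (h : ¬ R.TwoHopNeighbors i j) (x : Fin n → Bool) :
    R.halfLogit i (flipSpin j x) = R.halfLogit i x := by
  have hsep : R.Separates i (Finset.univ.erase i) := by
    refine ⟨Finset.notMem_erase i _, fun y => ?_⟩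
    rw [Finset.insert_erase (Finset.mem_univ i), marginal_univ]
  obtain ⟨S, -, hS⟩ := exists_minimal_le_of_wellFoundedLT (R.Separates i) _ hsep
  have hj : j ∉ S := fun hj => h ⟨S, hS, hj⟩
  have h1 := hS.prop.2
  have hpos : ∀ y, 0 < R.marginal S y := fun y =>
    Finset.sum_pos (fun z _ => R.prob_pos z) ⟨y, by simp⟩
  have key : ∀ y, R.marginal S y * (1 + (spin (y i) : ℝ) * tanh (R.halfLogit i y)) =
      2 * R.marginal (insert i S) y := by
    intro y
    have h2 := h1 y
    rw [marginal_erase] at h2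
    have h3 := R.two_mul_prob i y
    have h4 : 0 < R.prob y + R.prob (flipSpin i y) := add_pos (R.prob_pos _) (R.prob_pos _)
    refine mul_left_cancel₀ h4.ne' ?_
    linear_combination 2 * h2 - R.marginal S y * h3
  have h2 := key x
  have h3 := key (flipSpin j x)
  have e1 : R.marginal S (flipSpin j x) = R.marginal S x :=
    R.marginal_congr fun v hv => flipSpin_ne (by rintro rfl; exact hj hv) x
  have e2 : R.marginal (insert i S) (flipSpin j x) = R.marginal (insert i S) x :=
    R.marginal_congr fun v hv => flipSpin_ne (fun h => by
      subst h
      rcases Finset.mem_insert.mp hv with h | h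
      · exact hij h.symm
      · exact hj h) x
  rw [e1, e2, flipSpin_ne hij] at h3
  apply tanh_injective
  have h4 := spin_sq (x i)
  have h5 : (spin (x i) : ℝ) * tanh (R.halfLogit i (flipSpin j x)) =
      (spin (x i) : ℝ) * tanh (R.halfLogit i x) := by
    have := mul_left_cancel₀ (hpos x).ne' (h3.trans h2.symm)
    linarith
  calc tanh (R.halfLogit i (flipSpin j x)) = (spin (x i) : ℝ) *
        ((spin (x i) : ℝ) * tanh (R.halfLogit i (flipSpin j x))) := by rw [← mul_assoc, h4, one_mul]
    _ = tanh (R.halfLogit i x) := by rw [h5, ← mul_assoc, h4, one_mul]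

theorem condMutualInfo_comm (i j : Fin n) : R.condMutualInfo j i = R.condMutualInfo i j := by
  unfold condMutualInfo
  refine Finset.sum_congr rfl fun x _ => ?_
  rw [Finset.erase_right_comm, mul_comm (R.marginal (Finset.univ.erase i) x)]

theorem sum_prob_flip_add (i : Fin n) {F : (Fin n → Bool) → ℝ} (hF : ∀ x, F (flipSpin i x) = F x) :
    ∑ x, (R.prob x + R.prob (flipSpin i x)) * F x = 2 * ∑ x, R.prob x * F x := by
  have := sum_flipSpin i fun x => R.prob x * F x
  simp only [hF] at this
  simp only [add_mul, Finset.sum_add_distrib]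
  rw [this]; ring

/-- The conditional law of the spin `x i` given the other spins, and its logarithm. -/
theorem log_one_add_spin_mul_tanh (b : Bool) (z : ℝ) :
    log (1 + (spin b : ℝ) * tanh z) = (spin b : ℝ) * z - log (cosh z) := by
  have h : 1 + (spin b : ℝ) * tanh z = exp ((spin b : ℝ) * z) / cosh z := by
    rw [tanh_eq_sinh_div_cosh]
    have := (cosh_pos z).ne'
    cases b
    · simp only [spin, Bool.false_eq_true, if_false, Int.cast_neg, Int.cast_one, neg_mul, one_mul]
      rw [← cosh_sub_sinh]; field_simp; ring
    · simp only [spin, if_true, Int.cast_one, one_mul]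
      rw [← cosh_add_sinh]; field_simp
  rw [h, log_div (exp_pos _).ne' (cosh_pos z).ne', log_exp]

theorem condMutualInfo_le_log_two {i j : Fin n} (hij : i ≠ j) : R.condMutualInfo i j ≤ log 2 := by
  have hpos := R.prob_pos
  have h1 : ∀ x, R.prob x * log (R.prob x * R.marginal ((Finset.univ.erase i).erase j) x /
      (R.marginal (Finset.univ.erase j) x * R.marginal (Finset.univ.erase i) x)) ≤
      R.prob x * (log 2 - 1) + R.prob x * (R.marginal ((Finset.univ.erase i).erase j) x /
        (2 * R.marginal (Finset.univ.erase j) x)) := by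
    intro x
    rw [marginal_erase_erase R hij, marginal_erase, marginal_erase, ← mul_add]
    refine mul_le_mul_of_nonneg_left ?_ (hpos x).le
    set N := (R.prob x + R.prob (flipSpin i x)) +
      (R.prob (flipSpin j x) + R.prob (flipSpin i (flipSpin j x))) with hN
    have hN0 : 0 < N := add_pos (add_pos (hpos _) (hpos _)) (add_pos (hpos _) (hpos _))
    have hj0 : 0 < R.prob x + R.prob (flipSpin j x) := add_pos (hpos _) (hpos _)
    have hi0 : 0 < R.prob x + R.prob (flipSpin i x) := add_pos (hpos _) (hpos _)
    have e1 : log (R.prob x * N / ((R.prob x + R.prob (flipSpin j x)) *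
        (R.prob x + R.prob (flipSpin i x)))) ≤ log (N / (R.prob x + R.prob (flipSpin j x))) := by
      refine log_le_log (by have := hpos x; positivity) ?_
      rw [div_le_div_iff₀ (mul_pos hj0 hi0) hj0]
      nlinarith [mul_pos (mul_pos (hpos (flipSpin i x)) hN0) hj0]
    have e2 : log (N / (R.prob x + R.prob (flipSpin j x))) =
        log 2 + log (N / (2 * (R.prob x + R.prob (flipSpin j x)))) := by
      rw [← log_mul (by norm_num) (by positivity)]
      congr 1
      field_simp
    have e3 := log_le_sub_one_of_pos (div_pos hN0 (mul_pos two_pos hj0))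
    linarith
  have h2 : ∑ x, R.prob x * (R.marginal ((Finset.univ.erase i).erase j) x /
        (2 * R.marginal (Finset.univ.erase j) x)) = 1 := by
    have h3 := R.sum_prob_flip_add j (F := fun x => R.marginal ((Finset.univ.erase i).erase j) x /
        (2 * R.marginal (Finset.univ.erase j) x)) fun x => by
      rw [R.marginal_congr (S := (Finset.univ.erase i).erase j) fun v hv =>
        flipSpin_ne (Finset.ne_of_mem_erase hv) x,
        R.marginal_congr (S := Finset.univ.erase j) fun v hv =>
        flipSpin_ne (Finset.ne_of_mem_erase hv) x]
    have h4 : ∑ x, (R.prob x + R.prob (flipSpin j x)) *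
        (R.marginal ((Finset.univ.erase i).erase j) x /
        (2 * R.marginal (Finset.univ.erase j) x)) = 2 := by
      have : ∀ x, (R.prob x + R.prob (flipSpin j x)) *
        (R.marginal ((Finset.univ.erase i).erase j) x /
        (2 * R.marginal (Finset.univ.erase j) x)) = ((R.prob x + R.prob (flipSpin i x)) +
      (R.prob (flipSpin j x) + R.prob (flipSpin i (flipSpin j x)))) / 2 := by
        intro x
        have hj0 : 0 < R.prob x + R.prob (flipSpin j x) := add_pos (hpos _) (hpos _)
        rw [marginal_erase_erase R hij, marginal_erase]
        field_simp
      simp only [this]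
      rw [← Finset.sum_div, Finset.sum_add_distrib, Finset.sum_add_distrib,
        Finset.sum_add_distrib, sum_flipSpin j fun x => R.prob (flipSpin i x),
        sum_flipSpin i R.prob, sum_flipSpin j R.prob, R.sum_prob]
      norm_num
    linarith
  calc R.condMutualInfo i j ≤ _ := Finset.sum_le_sum fun x _ => h1 x
    _ = log 2 := by rw [Finset.sum_add_distrib, h2, ← Finset.sum_mul, R.sum_prob]; ring

/-- The conditional mutual information is small if the conditional expectation of the spin of `i`
is close to a function not depending on the spins of `i` and `j`. -/
theorem condMutualInfo_le {i j : Fin n} (hij : i ≠ j) {K : ℝ} (hK : ∀ x, |R.halfLogit i x| ≤ K)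
    {g : (Fin n → Bool) → ℝ} (hgi : ∀ x, g (flipSpin i x) = g x)
    (hgj : ∀ x, g (flipSpin j x) = g x) :
    R.condMutualInfo i j ≤ 4 * K * ∑ x, R.prob x * |g x - tanh (R.halfLogit i x)| := by
  have hpos := R.prob_pos
  set t : (Fin n → Bool) → ℝ := fun x => tanh (R.halfLogit i x) with ht
  set M : (Fin n → Bool) → ℝ := fun x => R.prob x + R.prob (flipSpin i x) with hM
  have hM0 : ∀ x, 0 < M x := fun x => add_pos (hpos _) (hpos _)
  set N : (Fin n → Bool) → ℝ := fun x => M x + M (flipSpin j x) with hN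
  have hN0 : ∀ x, 0 < N x := fun x => add_pos (hM0 _) (hM0 _)
  set u : (Fin n → Bool) → ℝ := fun x => (M x * t x + M (flipSpin j x) * t (flipSpin j x)) / N x
    with hu
  have hti : ∀ x, t (flipSpin i x) = t x := fun x => by simp only [ht, R.halfLogit_flip_self]
  have hMi : ∀ x, M (flipSpin i x) = M x := fun x => by
    simp only [hM, flipSpin_flipSpin]; ring
  have hui : ∀ x, u (flipSpin i x) = u x := fun x => by
    simp only [hu, hN, hMi, hti, ← flipSpin_comm i j]
  have huj : ∀ x, u (flipSpin j x) = u x := fun x => by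
    simp only [hu, hN, flipSpin_flipSpin]
    rw [add_comm (M (flipSpin j x) * _), add_comm (M (flipSpin j x))]
  have hK0 : 0 ≤ K := (abs_nonneg _).trans (hK fun _ => true)
  have htK : ∀ x, |t x| ≤ tanh K := by
    intro x
    have := abs_le.mp (hK x)
    rw [abs_le, ← tanh_neg]
    exact ⟨monotone_tanh this.1, monotone_tanh this.2⟩
  have huK : ∀ x, |u x| ≤ tanh K := by
    intro x
    simp only [hu]
    rw [abs_div, abs_of_pos (hN0 x), div_le_iff₀ (hN0 x)]
    refine (abs_add_le _ _).trans ?_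
    rw [abs_mul, abs_mul, abs_of_pos (hM0 _), abs_of_pos (hM0 _)]
    have h1 := mul_le_mul_of_nonneg_left (htK x) (hM0 x).le
    have h2 := mul_le_mul_of_nonneg_left (htK (flipSpin j x)) (hM0 (flipSpin j x)).le
    simp only [hN]
    linarith
  have hK1 := tanh_lt_one K
  set v : (Fin n → Bool) → ℝ := fun x => artanh (u x) with hv
  have huv : ∀ x, tanh (v x) = u x := fun x => by
    have := abs_le.mp (huK x)
    exact tanh_artanh ⟨by linarith, by linarith⟩
  have hvK : ∀ x, |v x| ≤ K := by
    intro x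
    have h1 := abs_le.mp (huK x)
    rw [abs_le]
    constructor
    · have h2 : artanh (tanh (-K)) ≤ artanh (u x) :=
        artanh_le_artanh (neg_one_lt_tanh _) (by linarith) (by rw [tanh_neg]; exact h1.1)
      rwa [artanh_tanh] at h2
    · have h2 : artanh (u x) ≤ artanh (tanh K) := artanh_le_artanh (by linarith) hK1 h1.2
      rwa [artanh_tanh] at h2
  have hvi : ∀ x, v (flipSpin i x) = v x := fun x => by simp only [hv, hui]
  -- the mutual information as an expectation
  have h1 : R.condMutualInfo i j = ∑ x, R.prob x * ((spin (x i) : ℝ) * (R.halfLogit i x - v x) -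
      (log (cosh (R.halfLogit i x)) - log (cosh (v x)))) := by
    refine Finset.sum_congr rfl fun x _ => ?_
    congr 1
    have e1 : R.prob x * N x / ((R.prob x + R.prob (flipSpin j x)) * M x) =
        (1 + (spin (x i) : ℝ) * tanh (R.halfLogit i x)) / (1 + (spin (x i) : ℝ) * tanh (v x)) := by
      have k1 := R.two_mul_prob i x
      have k2 := R.two_mul_prob i (flipSpin j x)
      rw [flipSpin_ne hij] at k2
      have k3 : (R.prob x + R.prob (flipSpin j x)) * 2 = N x * (1 + (spin (x i) : ℝ) * u x) := by
        have : N x * u x = M x * t x + M (flipSpin j x) * t (flipSpin j x) := by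
          simp only [hu]; field_simp [(hN0 x).ne']
        simp only [hN, hM, ht] at this ⊢
        linear_combination k1 + k2 - (spin (x i) : ℝ) * this
      have k4 : 0 < 1 + (spin (x i) : ℝ) * u x := by
        have : 0 < N x * (1 + (spin (x i) : ℝ) * u x) := by
          rw [← k3]; have := hpos x; have := hpos (flipSpin j x); positivity
        exact (mul_pos_iff_of_pos_left (hN0 x)).mp this
      have k5 : 0 < R.prob x + R.prob (flipSpin j x) := add_pos (hpos _) (hpos _)
      rw [huv, div_eq_div_iff (mul_pos k5 (hM0 x)).ne' k4.ne']
      simp only [hM] at *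
      linear_combination (N x * (1 + (spin (x i) : ℝ) * u x) / 2) * k1 -
        (R.prob x + R.prob (flipSpin i x)) * (1 + (spin (x i) : ℝ) * tanh (R.halfLogit i x)) / 2 * k3
    have e2 : ∀ (b : Bool) (z : ℝ), 1 + (spin b : ℝ) * tanh z ≠ 0 := by
      intro b z
      have h1 := neg_one_lt_tanh z
      have h2 := tanh_lt_one z
      cases b <;> simp [spin] <;> linarith
    rw [marginal_erase_erase R hij, marginal_erase, marginal_erase]
    change log (R.prob x * N x / ((R.prob x + R.prob (flipSpin j x)) * M x)) = _
    rw [e1, log_div (e2 _ _) (e2 _ _), log_one_add_spin_mul_tanh, log_one_add_spin_mul_tanh]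
    ring
  have h2 : ∑ x, R.prob x * ((spin (x i) : ℝ) * (R.halfLogit i x - v x) -
      (log (cosh (R.halfLogit i x)) - log (cosh (v x)))) =
      ∑ x, R.prob x * (t x * (R.halfLogit i x - v x) -
      (log (cosh (R.halfLogit i x)) - log (cosh (v x)))) := by
    have := R.sum_prob_spin i (F := fun x => R.halfLogit i x - v x) fun x => by
      rw [R.halfLogit_flip_self, hvi]
    simp only [mul_sub (R.prob _), Finset.sum_sub_distrib]
    simp only [mul_sub, Finset.sum_sub_distrib] at this
    simp only [ht, mul_sub, Finset.sum_sub_distrib]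
    rw [this]
  have h3 : ∀ x, t x * (R.halfLogit i x - v x) -
      (log (cosh (R.halfLogit i x)) - log (cosh (v x))) ≤ 2 * K * |t x - u x| := by
    intro x
    have k1 := log_cosh_tangent (v x) (R.halfLogit i x)
    rw [huv] at k1
    have k2 : (t x - u x) * (R.halfLogit i x - v x) ≤ |t x - u x| * (2 * K) := by
      refine (le_abs_self _).trans ?_
      rw [abs_mul]
      refine mul_le_mul_of_nonneg_left ?_ (abs_nonneg _)
      exact (abs_sub _ _).trans (by linarith [hK x, hvK x])
    linarith
  have h4 : ∑ x, R.prob x * |u x - g x| ≤ ∑ x, R.prob x * |g x - t x| := by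
    have k1 := R.sum_prob_flip_add i (F := fun x => |g x - t x|) fun x => by rw [hgi, hti]
    have k2 := R.sum_prob_flip_add i (F := fun x => |u x - g x|) fun x => by rw [hgi, hui]
    have k3 : ∀ F : (Fin n → Bool) → ℝ, 2 * ∑ x, M x * F x =
        ∑ x, (M x * F x + M (flipSpin j x) * F (flipSpin j x)) := by
      intro F
      rw [Finset.sum_add_distrib, sum_flipSpin j fun x => M x * F x]; ring
    have k4 := k3 fun x => |g x - t x|
    have k5 := k3 fun x => |u x - g x|
    have k6 : ∑ x, (M x * |u x - g x| + M (flipSpin j x) * |u (flipSpin j x) - g (flipSpin j x)|) ≤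
        ∑ x, (M x * |g x - t x| + M (flipSpin j x) * |g (flipSpin j x) - t (flipSpin j x)|) := by
      refine Finset.sum_le_sum fun x _ => ?_
      rw [huj, hgj, ← add_mul, ← abs_of_pos (hM0 x), ← abs_of_pos (hM0 (flipSpin j x)),
        ← abs_mul, ← abs_mul]
      rw [abs_of_pos (hM0 x), abs_of_pos (hM0 (flipSpin j x))]
      change N x * _ ≤ _
      rw [← abs_of_pos (hN0 x), ← abs_mul]
      have : N x * (u x - g x) = -(M x * (g x - t x) +
          M (flipSpin j x) * (g x - t (flipSpin j x))) := by
        simp only [hu, mul_sub]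
        rw [mul_div_cancel₀ _ (hN0 x).ne']
        simp only [hN]; ring
      rw [this, abs_neg]
      exact abs_add_le _ _
    simp only [hM] at *
    linarith
  rw [h1, h2]
  calc _ ≤ ∑ x, R.prob x * (2 * K * (|g x - t x| + |u x - g x|)) := by
        refine Finset.sum_le_sum fun x _ => mul_le_mul_of_nonneg_left ((h3 x).trans ?_) (hpos x).le
        refine mul_le_mul_of_nonneg_left ?_ (by positivity)
        have := abs_sub_le (u x) (g x) (t x)
        rw [abs_sub_comm (t x)]; linarith
    _ = 2 * K * (∑ x, R.prob x * |g x - t x| + ∑ x, R.prob x * |u x - g x|) := by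
        rw [← Finset.sum_add_distrib, Finset.mul_sum]
        exact Finset.sum_congr rfl fun x _ => by ring
    _ ≤ 4 * K * ∑ x, R.prob x * |g x - t x| := by nlinarith

end RBM

theorem Real.abs_le_one_add_abs_mul_abs_tanh (w : ℝ) : |w| ≤ (1 + |w|) * |tanh w| := by
  have key : ∀ w : ℝ, 0 ≤ w → w ≤ (1 + w) * tanh w := by
    intro w hw
    have h1 := add_one_le_exp (2 * w)
    have h2 := exp_pos w
    have h3 : tanh w * (exp (2 * w) + 1) = exp (2 * w) - 1 := by
      rw [tanh_eq, two_mul, exp_add, exp_neg]; field_simp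
    have h4 : 0 < exp (2 * w) + 1 := by positivity
    refine le_of_mul_le_mul_right ?_ h4
    rw [mul_assoc, h3]
    nlinarith
  rcases le_total 0 w with h | h
  · have : 0 ≤ tanh w := by rw [← tanh_zero]; exact monotone_tanh h
    rw [abs_of_nonneg h, abs_of_nonneg this]
    exact key w h
  · have : tanh w ≤ 0 := by rw [← tanh_zero]; exact monotone_tanh h
    have h1 := key (-w) (by linarith)
    rw [abs_of_nonpos h, abs_of_nonpos this]
    rwa [tanh_neg] at h1

/-- The spins of a configuration, with the spins of `i` and `q` replaced by `1`. -/
noncomputable def maskedSpin {n : ℕ} (i q r : Fin n) (x : Fin n → Bool) : ℝ :=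
  if r = i ∨ r = q then 1 else (spin (x r) : ℝ)

theorem abs_maskedSpin {n : ℕ} (i q r : Fin n) (x : Fin n → Bool) : |maskedSpin i q r x| = 1 := by
  unfold maskedSpin
  split_ifs
  · simp
  · exact abs_spin _

namespace RBM

open Real

variable {n k : ℕ} (R : RBM n k)

theorem abs_halfLogit_le (i : Fin n) (x : Fin n → Bool) :
    |R.halfLogit i x| ≤ |R.b₁ i| + ∑ j, |R.W i j| := by
  refine (abs_add_le _ _).trans (add_le_add le_rfl ((Finset.abs_sum_le_sum_abs _ _).trans
    (Finset.sum_le_sum fun j _ => ?_)))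
  have h := abs_log_cosh_sub_le (R.rest i j x + R.W i j) (R.rest i j x - R.W i j)
  have e : R.rest i j x + R.W i j - (R.rest i j x - R.W i j) = 2 * R.W i j := by ring
  rw [e, abs_mul, abs_of_pos (two_pos : (0 : ℝ) < 2)] at h
  rw [abs_div, abs_of_pos (two_pos : (0 : ℝ) < 2)]
  linarith

section Bounded

variable {R} {lam₁ lam₂ : ℝ}

theorem IsBounded.abs_W_le (hR : R.IsBounded lam₁ lam₂) (i : Fin n) (j : Fin k) : |R.W i j| ≤ lam₂ :=
  (Finset.single_le_sum (f := fun r => |R.W r j|) (fun _ _ => abs_nonneg _)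
    (Finset.mem_univ i)).trans (hR.2 j)

theorem IsBounded.nonneg (hR : R.IsBounded lam₁ lam₂) (i : Fin n) : 0 ≤ lam₁ :=
  le_trans (add_nonneg (Finset.sum_nonneg fun _ _ => abs_nonneg _) (abs_nonneg _)) (hR.1 i)

theorem IsBounded.abs_add_sum_le (hR : R.IsBounded lam₁ lam₂) (i : Fin n) {L : ℝ} (hL : lam₂ ≤ L)
    (hL0 : 0 ≤ L) :
    |R.b₁ i| + ∑ j, |R.W i j| ≤ (1 + L) * lam₁ := by
  have h1 : ∑ j, |R.W i j| ≤ (1 + L) * ∑ j, |tanh (R.W i j)| := by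
    rw [Finset.mul_sum]
    refine Finset.sum_le_sum fun j _ => (abs_le_one_add_abs_mul_abs_tanh _).trans ?_
    refine mul_le_mul_of_nonneg_right ?_ (abs_nonneg _)
    linarith [hR.abs_W_le i j]
  have h2 := mul_le_mul_of_nonneg_left (hR.1 i) (by linarith : 0 ≤ 1 + L)
  have h3 := abs_nonneg (R.b₁ i)
  nlinarith

theorem IsBounded.sum_abs_W_mul_le (hR : R.IsBounded lam₁ lam₂) (i : Fin n) {L E : ℝ}
    (hL : lam₂ ≤ L) (hL2 : 2 ≤ L) (hE : lam₁ * L ≤ E) (hE1 : 1 ≤ E) : (∑ j, |R.W i j|) * L ≤ 3 * E ^ 2 := by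
  have h0 := hR.nonneg i
  rcases le_or_gt (1 / 2) lam₁ with h | h
  · have h1 := hR.abs_add_sum_le i hL (by linarith)
    have h2 := abs_nonneg (R.b₁ i)
    have h3 : ∑ j, |R.W i j| ≤ 3 / 2 * E := by nlinarith
    have h4 : L ≤ 2 * E := by nlinarith
    have h5 : 0 ≤ ∑ j, |R.W i j| := Finset.sum_nonneg fun _ _ => abs_nonneg _
    nlinarith
  · have h1 : ∑ j, |R.W i j| ≤ 2 * lam₁ := by
      calc ∑ j, |R.W i j| ≤ ∑ j, 2 * |tanh (R.W i j)| := by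
            refine Finset.sum_le_sum fun j _ => ?_
            have h2 := abs_le_one_add_abs_mul_abs_tanh (R.W i j)
            have h3 : |tanh (R.W i j)| ≤ lam₁ :=
              (Finset.single_le_sum (f := fun j => |tanh (R.W i j)|) (fun _ _ => abs_nonneg _)
                (Finset.mem_univ j)).trans (by linarith [hR.1 i, abs_nonneg (R.b₁ i)])
            nlinarith [abs_nonneg (R.W i j)]
        _ ≤ 2 * lam₁ := by
            rw [← Finset.mul_sum]
            linarith [hR.1 i, abs_nonneg (R.b₁ i)]
    nlinarith

end Bounded

theorem halfLogit_mask {i q : Fin n}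
    (hq : ∀ x, R.halfLogit i (flipSpin q x) = R.halfLogit i x) (x : Fin n → Bool) :
    R.halfLogit i (fun r => if r = i ∨ r = q then true else x r) = R.halfLogit i x := by
  have h1 : R.halfLogit i (fun r => if r = i ∨ r = q then true else x r) =
      R.halfLogit i (Function.update x q true) := by
    refine R.halfLogit_congr fun r hr => ?_
    by_cases h : r = q
    · subst h; simp
    · simp [h, hr]
  rw [h1]
  rcases eq_or_eq_flipSpin (i := q) (x := x) (y := Function.update x q true)
    (fun r hr => by simp [hr]) with h | h
  · rw [h]
  · rw [h, hq]

/-- The conditional log-odds are approximated by polynomials with bounded coefficients. -/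
theorem exists_isBoundedForm {i q : Fin n} {L ρ : ℝ} (hL : 1 ≤ L)
    (hρ : ρ = 1 + 1 / (2 * L)) (hW : ∀ j, ∑ r, |R.W r j| ≤ L)
    (hq : ∀ x, R.halfLogit i (flipSpin q x) = R.halfLogit i x) (D : ℕ) :
    ∃ F : (Fin n → Bool) → ℝ,
      IsBoundedForm (maskedSpin i q) D (|R.b₁ i| + (∑ j, |R.W i j|) * 3 ^ (D + 1)) F ∧
      ∀ x, |F x - R.halfLogit i x| ≤ (∑ j, |R.W i j|) * (6 * L * ρ⁻¹ ^ (D + 1)) := by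
  have hL0 : 0 < L := by linarith
  have hi : ∀ x, maskedSpin i q i x = 1 := fun x => by simp [maskedSpin]
  have hw : ∀ j, ∑ r, |R.W r j / L| ≤ 1 := by
    intro j
    simp only [abs_div, abs_of_pos hL0]
    rw [← Finset.sum_div, div_le_one hL0]
    exact hW j
  set s : Fin k → (Fin n → Bool) → ℝ := fun j x => ∑ r, R.W r j * maskedSpin i q r x with hs
  have hsL : ∀ j x, s j x / L = ∑ r, R.W r j / L * maskedSpin i q r x := by
    intro j x
    simp only [hs, Finset.sum_div]
    exact Finset.sum_congr rfl fun r _ => by ring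
  have hsabs : ∀ j x, |s j x| ≤ L := by
    intro j x
    refine (Finset.abs_sum_le_sum_abs _ _).trans ((Finset.sum_le_sum fun r _ => ?_).trans (hW j))
    rw [abs_mul, abs_maskedSpin, mul_one]
  have hz : ∀ x, R.halfLogit i x = R.b₁ i + ∑ j,
      (log (cosh (R.b₂ j - R.W i j + s j x + R.W i j)) -
        log (cosh (R.b₂ j - R.W i j + s j x - R.W i j))) / 2 := by
    intro x
    rw [← R.halfLogit_mask hq x, halfLogit]
    congr 1
    refine Finset.sum_congr rfl fun j _ => ?_
    have : R.rest i j (fun r => if r = i ∨ r = q then true else x r) =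
        R.b₂ j - R.W i j + s j x := by
      simp only [rest, hs]
      rw [← Finset.add_sum_erase _ _ (Finset.mem_univ i), hi, mul_one]
      have : ∀ r, (spin (if r = i ∨ r = q then true else x r) : ℝ) = maskedSpin i q r x := by
        intro r
        unfold maskedSpin
        split_ifs <;> simp [spin]
      simp only [this]
      ring
    rw [this]
  refine ⟨fun x => R.b₁ i + ∑ j, ∑ t ∈ Finset.range (D + 1),
    logCoshChebyshev L t (R.b₂ j - R.W i j) (R.W i j) *
      (Polynomial.Chebyshev.T ℝ t).eval (s j x / L), ?_, fun x => ?_⟩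
  · refine ((IsBoundedForm.const hi (R.b₁ i)).add (IsBoundedForm.sum Finset.univ
      (B := fun j => ∑ t ∈ Finset.range (D + 1), 2 * |R.W i j| * 3 ^ t) fun j _ =>
      IsBoundedForm.sum (Finset.range (D + 1)) (B := fun t => 2 * |R.W i j| * 3 ^ t)
        fun t ht => ?_)).mono (add_le_add le_rfl ?_)
    · have h := ((IsBoundedForm.chebyshev hi (hw j) t).of_le hi
        (Nat.lt_succ_iff.mp (Finset.mem_range.mp ht))).const_mul
          (logCoshChebyshev L t (R.b₂ j - R.W i j) (R.W i j))
      simp only [hsL]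
      exact h.mono (mul_le_mul_of_nonneg_right (abs_logCoshChebyshev_le hL _ _ _) (by positivity))
    · rw [Finset.sum_mul]
      refine Finset.sum_le_sum fun j _ => ?_
      rw [← Finset.mul_sum, mul_comm 2, mul_assoc]
      refine mul_le_mul_of_nonneg_left ?_ (abs_nonneg _)
      rw [geom_sum_eq (by norm_num)]
      have : (0 : ℝ) < 3 ^ (D + 1) := by positivity
      linarith
  · rw [hz, add_sub_add_left_eq_sub, ← Finset.sum_sub_distrib, Finset.sum_mul]
    refine (Finset.abs_sum_le_sum_abs _ _).trans (Finset.sum_le_sum fun j _ => ?_)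
    exact abs_sum_logCoshChebyshev_sub_le hL hρ (D + 1) (hsabs j x) _ _

end RBM

/-! ### Concentration of empirical means -/

namespace RBM

open Real ProbabilityTheory

variable {n k : ℕ} (R : RBM n k)

instance (m : ℕ) : IsProbabilityMeasure (R.sampleLaw m) := by
  unfold sampleLaw; infer_instance

theorem integral_law (f : (Fin n → Bool) → ℝ) :
    ∫ x, f x ∂(R.law.toMeasure) = ∑ x, R.prob x * f x := by
  rw [PMF.integral_eq_sum]
  refine Finset.sum_congr rfl fun x _ => ?_
  rw [law, PMF.ofFintype_apply, ENNReal.toReal_ofReal (R.prob_pos x).le, smul_eq_mul]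

/-- Hoeffding's inequality for the samples of a machine. -/
theorem sampleLaw_real_le (m : ℕ) {g : (Fin n → Bool) → ℝ} {K ε : ℝ} (hK : 0 < K)
    (hg : ∀ x, |g x| ≤ K) (hε : 0 ≤ ε) :
    (R.sampleLaw m).real {X | m * ε ≤ ∑ a, g (X a) - m * ∑ x, R.prob x * g x} ≤
      exp (-(m * ε ^ 2 / (2 * K ^ 2))) := by
  set E := ∑ x, R.prob x * g x with hE
  have hmeas : Measurable g := measurable_of_finite g
  have hsub : HasSubgaussianMGF (fun x => g x - E) ((‖K - -K‖₊ / 2) ^ 2) R.law.toMeasure := by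
    have h := hasSubgaussianMGF_of_mem_Icc (μ := R.law.toMeasure) (X := g) (a := -K) (b := K)
      hmeas.aemeasurable (Filter.Eventually.of_forall fun x => abs_le.mp (hg x))
    rwa [integral_law] at h
  have hindep : iIndepFun (fun a (X : Fin m → Fin n → Bool) => g (X a) - E) (R.sampleLaw m) :=
    iIndepFun_pi (X := fun _ x => g x - E) fun _ => (measurable_of_finite _).aemeasurable
  have hsub' : ∀ a ∈ (Finset.univ : Finset (Fin m)),
      HasSubgaussianMGF (fun X : Fin m → Fin n → Bool => g (X a) - E) ((‖K - -K‖₊ / 2) ^ 2)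
        (R.sampleLaw m) := by
    intro a _
    have hmp : MeasurePreserving (Function.eval a) (R.sampleLaw m) R.law.toMeasure :=
      measurePreserving_eval (fun _ => R.law.toMeasure) a
    rw [← hmp.map_eq] at hsub
    exact hsub.of_map hmp.measurable.aemeasurable
  have h := HasSubgaussianMGF.measure_sum_ge_le_of_iIndepFun hindep hsub'
    (ε := m * ε) (by positivity)
  have e1 : {X : Fin m → Fin n → Bool | m * ε ≤ ∑ a, g (X a) - m * E} =
      {X | m * ε ≤ ∑ a, (g (X a) - E)} := by
    ext X
    simp [Finset.sum_sub_distrib]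
  rw [e1]
  refine h.trans (le_of_eq ?_)
  congr 1
  have e2 : ((‖K - -K‖₊ / 2 : NNReal) : ℝ) = K := by
    rw [NNReal.coe_div, coe_nnnorm, sub_neg_eq_add, ← two_mul, norm_mul, Real.norm_of_nonneg hK.le]
    simp
  simp only [Finset.sum_const, Finset.card_univ, Fintype.card_fin, nsmul_eq_mul]
  push_cast
  rw [NNReal.coe_div, coe_nnnorm] at e2
  simp only [NNReal.coe_ofNat] at e2
  rw [e2]
  rcases Nat.eq_zero_or_pos m with rfl | hm
  · simp
  · have : (0 : ℝ) < m := by exact_mod_cast hm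
    field_simp

/-- Empirical means of finitely many functions are simultaneously close to the expectations. -/
theorem sampleLaw_real_exists_le (m : ℕ) {ι : Type*} [Fintype ι]
    {g : ι → (Fin n → Bool) → ℝ} {K ε : ℝ} (hK : 0 < K)
    (hg : ∀ e x, |g e x| ≤ K) (hε : 0 ≤ ε) :
    (R.sampleLaw m).real {X | ∃ e, m * ε < |∑ a, g e (X a) - m * ∑ x, R.prob x * g e x|} ≤
      2 * Fintype.card ι * exp (-(m * ε ^ 2 / (2 * K ^ 2))) := by
  have hsub : {X : Fin m → Fin n → Bool |
      ∃ e, m * ε < |∑ a, g e (X a) - m * ∑ x, R.prob x * g e x|} ⊆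
      ⋃ e : ι, ({X | m * ε ≤ ∑ a, g e (X a) - m * ∑ x, R.prob x * g e x} ∪
        {X | m * ε ≤ ∑ a, -g e (X a) - m * ∑ x, R.prob x * -g e x}) := by
    rintro X ⟨e, he⟩
    refine Set.mem_iUnion.mpr ⟨e, ?_⟩
    rcases lt_abs.mp he with h | h
    · exact Or.inl h.le
    · refine Or.inr ?_
      simp only [Set.mem_ofPred_eq, mul_neg, Finset.sum_neg_distrib]
      linarith
  refine (measureReal_mono hsub).trans ((measureReal_iUnion_fintype_le _).trans ?_)
  calc _ ≤ ∑ _e : ι, (2 * exp (-(m * ε ^ 2 / (2 * K ^ 2)))) := by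
        refine Finset.sum_le_sum fun e _ => (measureReal_union_le _ _).trans ?_
        have h1 := R.sampleLaw_real_le m hK (hg e) hε
        have h2 := R.sampleLaw_real_le m (g := fun x => -g e x) hK
          (fun x => by rw [abs_neg]; exact hg e x) hε
        linarith
    _ = _ := by
        rw [Finset.sum_const, Finset.card_univ, nsmul_eq_mul]; ring

end RBM

/-! ### The choice of the parameters -/

section Parameters

open Real

variable {L U : ℝ} {D Q : ℕ}

theorem exp_le_two_rpow {U : ℝ} (hU : 0 ≤ U) : exp U ≤ 2 ^ (2 * U) := by
  rw [rpow_def_of_pos two_pos, exp_le_exp]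
  nlinarith [log_two_gt_d9]

/-- The threshold of the test in terms of the degree. -/
theorem threshold_bounds (hL : 2 ≤ L) (hU : 1 ≤ U) (hD : 200 * L * U ≤ D) (hQ : L ≤ Q)
    (hQ' : Q ≤ 5 / 2 * L) :
    ∃ Y : ℝ, (2 : ℝ) ^ (D / (8 * Q)) ≤ Y ∧ 256 * exp U ≤ Y ∧ Y ^ 4 = 2 ^ (D / (2 * L)) ∧
      Y ^ 4 ≤ 2 ^ D ∧ 16 * exp U ≤ 2 ^ (D / (8 * Q)) := by
  have hL0 : 0 < L := by linarith
  have hQ0 : (0 : ℝ) < Q := by linarith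
  have hD0 : (0 : ℝ) ≤ D := Nat.cast_nonneg D
  have hE := exp_le_two_rpow (by linarith : 0 ≤ U)
  have hE2 : ∀ a : ℝ, 2 ^ a * exp U ≤ 2 ^ (2 * U + a) := fun a => by
    rw [rpow_add two_pos, mul_comm]
    exact mul_le_mul_of_nonneg_right hE (by positivity)
  refine ⟨2 ^ (D / (8 * L)), ?_, ?_, ?_, ?_, ?_⟩
  · rw [← rpow_natCast]
    refine rpow_le_rpow_of_exponent_le (by norm_num) ?_
    refine (Nat.cast_div_le).trans ?_
    push_cast
    exact div_le_div_of_nonneg_left hD0 (by positivity) (by linarith)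
  · have h := hE2 8
    have e : (2 : ℝ) ^ (8 : ℝ) = 256 := by norm_num
    rw [e] at h
    refine h.trans (rpow_le_rpow_of_exponent_le (by norm_num) ?_)
    rw [le_div_iff₀ (by positivity)]
    nlinarith
  · rw [← rpow_natCast, ← rpow_mul (by norm_num)]
    congr 1
    push_cast
    field_simp
    ring
  · rw [← rpow_natCast, ← rpow_natCast, ← rpow_mul (by norm_num)]
    refine rpow_le_rpow_of_exponent_le (by norm_num) ?_
    push_cast
    rw [div_mul_eq_mul_div, div_le_iff₀ (by positivity)]
    nlinarith
  · have h := hE2 4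
    have e : (2 : ℝ) ^ (4 : ℝ) = 16 := by norm_num
    rw [e] at h
    refine h.trans ?_
    rw [← rpow_natCast]
    refine rpow_le_rpow_of_exponent_le (by norm_num) ?_
    have h1 : (D : ℝ) < (8 * Q) * ((D / (8 * Q) : ℕ) + 1) := by
      have hq : 0 < 8 * Q := by
        have : 0 < Q := by exact_mod_cast hQ0
        omega
      have := Nat.lt_mul_div_succ D hq
      exact_mod_cast this
    have h2 : 10 * U ≤ ((D / (8 * Q) : ℕ) : ℝ) + 1 := by
      by_contra hc
      push Not at hc
      have h3 : (8 * Q : ℝ) * (((D / (8 * Q) : ℕ) : ℝ) + 1) ≤ 20 * L * (10 * U) :=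
        mul_le_mul (by linarith) hc.le (by positivity) (by positivity)
      nlinarith
    linarith

theorem parameter_bounds (hL : 2 ≤ L) (hU : 1 ≤ U) (hD : 200 * L * U ≤ D) (hQ : L ≤ Q)
    (hQ' : Q ≤ 5 / 2 * L) :
    (64 ≤ (2 : ℝ) ^ D ∧ exp U ≤ (2 : ℝ) ^ D) ∧
    2 * (2 * ((2 : ℝ) ^ D)⁻¹ + 7 * ((2 : ℝ) ^ D)⁻¹ ^ 2 +
      2 * (18 * exp U ^ 2 * 2 ^ (-(D / (2 * L))))) ≤ (1 / (16 * (2 : ℝ) ^ (D / (8 * Q)))) ^ 2 ∧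
    3 * ((2 : ℝ) ^ D)⁻¹ ≤ 1 / (4 * (2 : ℝ) ^ (D / (8 * Q))) ∧
    16 * exp U ≤ (2 : ℝ) ^ (D / (8 * Q)) := by
  obtain ⟨Y, h1, h2, h3, h4, h5⟩ := threshold_bounds hL hU hD hQ hQ'
  have hE : 2 ≤ exp U := by linarith [add_one_le_exp U]
  set E := exp U with hEdef
  set A := (2 : ℝ) ^ D with hA
  set Z := (2 : ℝ) ^ (D / (8 * Q)) with hZ
  have hZ0 : 0 < Z := by positivity
  have hY0 : 0 < Y := by linarith
  have hA0 : 0 < A := by positivity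
  have hAi : A⁻¹ ≤ (Y ^ 4)⁻¹ := inv_anti₀ (by positivity) h4
  have hAi0 : 0 < A⁻¹ := by positivity
  have hY1 : 512 ≤ Y := by linarith
  have hYA : Y ≤ A := (le_self_pow₀ (by linarith) (by norm_num)).trans h4
  have hAi1 : A⁻¹ ≤ 1 := inv_le_one_of_one_le₀ (by linarith)
  refine ⟨⟨by linarith, by linarith⟩, ?_, ?_, h5⟩
  · rw [rpow_neg two_pos.le, ← h3]
    have e1 : (1 / (16 * Z)) ^ 2 = (Z ^ 2)⁻¹ / 256 := by rw [one_div, inv_pow, mul_pow, mul_inv]; ring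
    have e2 : (Y ^ 2)⁻¹ ≤ (Z ^ 2)⁻¹ := inv_anti₀ (by positivity) (pow_le_pow_left₀ hZ0.le h1 2)
    have e3 : A⁻¹ ^ 2 ≤ A⁻¹ := by nlinarith
    have e4 : 1 ≤ E ^ 2 := by nlinarith
    have e5 : 90 * 256 * E ^ 2 * (Y ^ 4)⁻¹ ≤ (Y ^ 2)⁻¹ := by
      have : Y ^ 4 = Y ^ 2 * Y ^ 2 := by ring
      rw [this, mul_inv, ← mul_assoc]
      refine mul_le_of_le_one_left (by positivity) ?_
      rw [← div_eq_mul_inv, div_le_one (by positivity)]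
      nlinarith
    have e6 : 0 < (Y ^ 4)⁻¹ := by positivity
    have e7 : (Y ^ 4)⁻¹ ≤ E ^ 2 * (Y ^ 4)⁻¹ := le_mul_of_one_le_left e6.le e4
    rw [e1]
    nlinarith
  · have e1 : (4 * Y)⁻¹ ≤ 1 / (4 * Z) := by
      rw [one_div]; exact inv_anti₀ (by positivity) (by linarith)
    have e2 : 3 * (Y ^ 4)⁻¹ ≤ (4 * Y)⁻¹ := by
      rw [← div_eq_mul_inv, inv_eq_one_div, div_le_div_iff₀ (by positivity) (by positivity)]
      have : 12 ≤ Y ^ 3 := by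
        have : 12 ^ 3 ≤ Y ^ 3 := pow_le_pow_left₀ (by norm_num) (by linarith) 3
        linarith
      nlinarith [mul_le_mul_of_nonneg_right this hY0.le]
    linarith

end Parameters

/-! ### The predictors as functions of a configuration -/

section Predictor

open Real

variable {n : ℕ}

/-- A product of masked spins, the factors being given by the digits of `e`. -/
noncomputable def feature (i q : Fin n) (D e : ℕ) (x : Fin n → Bool) : ℝ :=
  ∏ t ∈ Finset.range D, maskedSpin i q ⟨e / n ^ t % n, Nat.mod_lt _ i.pos⟩ x

/-- The half-logits given by a sequence of signed features. -/
noncomputable def predictor (i q : Fin n) (D : ℕ) (γ : ℝ) {T : ℕ}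
    (θ : Fin T → Fin (n ^ D) × Bool) (x : Fin n → Bool) : ℝ :=
  γ * ∑ r, (spin (θ r).2 : ℝ) * feature i q D (θ r).1 x

theorem abs_feature (i q : Fin n) (D e : ℕ) (x : Fin n → Bool) : |feature i q D e x| = 1 := by
  rw [feature, Finset.abs_prod]
  exact Finset.prod_eq_one fun t _ => abs_maskedSpin _ _ _ _

theorem maskedSpin_flip {i q : Fin n} {v : Fin n} (hv : v = i ∨ v = q) (r : Fin n)
    (x : Fin n → Bool) : maskedSpin i q r (flipSpin v x) = maskedSpin i q r x := by
  unfold maskedSpin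
  split_ifs with h
  · rfl
  · rw [flipSpin_ne]
    rintro rfl
    exact h hv

theorem predictor_flip {i q : Fin n} {v : Fin n} (hv : v = i ∨ v = q) (D : ℕ) (γ : ℝ) {T : ℕ}
    (θ : Fin T → Fin (n ^ D) × Bool) (x : Fin n → Bool) :
    predictor i q D γ θ (flipSpin v x) = predictor i q D γ θ x := by
  simp only [predictor, feature, maskedSpin_flip hv]

theorem abs_predictor_le (i q : Fin n) (D : ℕ) {γ : ℝ} (hγ : 0 ≤ γ) {T : ℕ}
    (θ : Fin T → Fin (n ^ D) × Bool) (x : Fin n → Bool) : |predictor i q D γ θ x| ≤ γ * T := by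
  rw [predictor, abs_mul, abs_of_nonneg hγ]
  refine mul_le_mul_of_nonneg_left ((Finset.abs_sum_le_sum_abs _ _).trans ?_) hγ
  simp only [abs_mul, abs_spin, abs_feature]
  simp

end Predictor

namespace RAM.TestData

open Real

variable {n m : ℕ}

/-- The data of the test hold the given samples. -/
structure Matches (d : TestData) (i j : Fin n) (X : Fin m → Fin n → Bool) : Prop where
  hn : d.n = n
  hm : d.m = m
  hi : d.i = i
  hj : d.j = j
  hx : ∀ (a : Fin m) (r : Fin n), d.x a r = spin (X a r)

variable {d : TestData} {i j : Fin n} {X : Fin m → Fin n → Bool}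

theorem Matches.phi_eq (h : d.Matches i j X) (q : Fin n) (a : Fin m) (e : ℕ) :
    (d.phi q a e d.D : ℝ) = feature i q d.D e (X a) := by
  rw [phi, feature]
  push_cast
  refine Finset.prod_congr rfl fun t _ => ?_
  have hlt : e / n ^ t % n < n := Nat.mod_lt _ i.pos
  simp only [h.hn, h.hi, maskedSpin, Fin.ext_iff]
  split_ifs
  · simp
  · exact_mod_cast h.hx a ⟨e / n ^ t % n, hlt⟩

theorem Greedy.exists_predictor (h : d.Matches i j X) {q : Fin n} {θ : ℕ → ℕ × ℤ}
    (hθ : d.Greedy q θ d.T) : ∃ θ' : Fin d.T → Fin (n ^ d.D) × Bool,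
      ∀ a : Fin m, d.logit q θ d.T a = predictor i q d.D d.step θ' (X a) := by
  refine ⟨fun r => (⟨(θ r).1, h.hn ▸ (hθ r r.2).1⟩, decide ((θ r).2 = 1)), fun a => ?_⟩
  rw [logit, predictor, Finset.sum_range]
  congr 1
  refine Finset.sum_congr rfl fun r _ => ?_
  rw [h.phi_eq]
  congr 1
  rcases (hθ r r.2).2.1 with h' | h' <;> simp [h', spin]

theorem Matches.sum_range (h : d.Matches i j X) (f : ℕ → ℝ) :
    ∑ a ∈ Finset.range d.m, f a = ∑ a : Fin m, f a := by
  rw [h.hm, Finset.sum_range]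

/-- The greedy predictor has almost the smallest empirical loss among the polynomials with bounded
coefficients. -/
theorem Greedy.sum_logisticLoss_predictor_le (h : d.Matches i j X) (hd : d.Valid) {q : Fin n}
    {θ : ℕ → ℕ × ℤ} (hθ : d.Greedy q θ d.T) {θ' : Fin d.T → Fin (n ^ d.D) × Bool}
    (hθ' : ∀ a : Fin m, d.logit q θ d.T a = predictor i q d.D d.step θ' (X a))
    {F : (Fin n → Bool) → ℝ} (hF : IsBoundedForm (maskedSpin i q) d.D ((2 ^ d.D) ^ 5) F) :
    ∑ a, logisticLoss (spin (X a i)) (predictor i q d.D d.step θ' (X a)) ≤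
      ∑ a, logisticLoss (spin (X a i)) (F (X a)) + m * (7 * ((2 : ℝ) ^ d.D)⁻¹ ^ 2) := by
  obtain ⟨c, hc, hFc⟩ := hF.exists_coeff i.pos
  have hA : (1 : ℝ) ≤ 2 ^ d.D := one_le_pow₀ (by norm_num)
  have hg := hθ.sum_logisticLoss_le hd (B := (2 ^ d.D) ^ 5) (one_le_pow₀ hA) c (by
    rw [h.hn]; exact hc)
  rw [h.sum_range, h.sum_range] at hg
  have e1 : ∀ a : Fin m, ∑ e ∈ Finset.range (d.n ^ d.D), c e * (d.phi q a e d.D : ℝ) = F (X a) := by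
    intro a
    rw [hFc, h.hn]
    exact Finset.sum_congr rfl fun e _ => by rw [h.phi_eq]; rfl
  have e2 : ∀ a : Fin m, (d.x a d.i : ℝ) = spin (X a i) := fun a => by
    rw [h.hi]; exact_mod_cast h.hx a i
  simp only [e1, e2, hθ', h.hm] at hg
  have e3 : (2 ^ d.D) ^ 5 * (d.H : ℝ) / d.T + 6 * d.T / d.H ^ 2 =
      7 * ((2 : ℝ) ^ d.D)⁻¹ ^ 2 := by
    simp only [H, T]
    push_cast
    field_simp
    ring
  rw [e3] at hg
  linarith

end RAM.TestData

theorem IsBoundedForm.abs_le {Ω : Type*} {n d : ℕ} {ξ : Fin n → Ω → ℝ} {B : ℝ} {F : Ω → ℝ}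
    (h : IsBoundedForm ξ d B F) (hξ : ∀ r ω, |ξ r ω| = 1) (ω : Ω) : |F ω| ≤ B := by
  obtain ⟨c, hc, hF⟩ := h
  rw [hF]
  refine (Finset.abs_sum_le_sum_abs _ _).trans ((Finset.sum_le_sum fun e _ => ?_).trans hc)
  rw [abs_mul, Finset.abs_prod, Finset.prod_eq_one fun t _ => hξ _ ω, mul_one]

namespace RBM

open Real RAM

variable {n k m : ℕ} (R : RBM n k)

/-- The empirical means of the losses of all predictors, of the losses of two given functions, and
of the distances of the predictors are close to their expectations. -/
structure GoodSamples (i j : Fin n) (D : ℕ) (γ : ℝ) (T : ℕ) (ε : ℝ)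
    (F : Bool → (Fin n → Bool) → ℝ) (X : Fin m → Fin n → Bool) : Prop where
  loss : ∀ (b : Bool) (θ : Fin T → Fin (n ^ D) × Bool),
    |∑ a, logisticLoss (spin (X a i)) (predictor i (cond b j i) D γ θ (X a)) -
      m * R.risk i (predictor i (cond b j i) D γ θ)| ≤ m * ε
  form : ∀ b, |∑ a, logisticLoss (spin (X a i)) (F b (X a)) - m * R.risk i (F b)| ≤ m * ε
  dist : ∀ θ θ' : Fin T → Fin (n ^ D) × Bool,
    |∑ a, |tanh (predictor i i D γ θ (X a)) - tanh (predictor i j D γ θ' (X a))| -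
      m * (∑ x, R.prob x *
        |tanh (predictor i i D γ θ x) - tanh (predictor i j D γ θ' x)|)| ≤ m * ε

theorem sampleLaw_not_goodSamples_le (i j : Fin n) (D : ℕ) {γ : ℝ} (hγ : 0 ≤ γ) (T : ℕ)
    {ε K : ℝ} (hε : 0 ≤ ε) (hK : 2 ≤ K) (hK' : 2 * (γ * T) ≤ K)
    {F : Bool → (Fin n → Bool) → ℝ} (hF : ∀ b x, 2 * |F b x| ≤ K) :
    (R.sampleLaw m).real {X | ¬ R.GoodSamples i j D γ T ε F X} ≤
      10 * ((n ^ D * 2 : ℝ) ^ T) ^ 2 * exp (-(m * ε ^ 2 / (2 * K ^ 2))) := by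
  let Θ := Fin T → Fin (n ^ D) × Bool
  let g : (Bool × Θ) ⊕ Bool ⊕ (Θ × Θ) → (Fin n → Bool) → ℝ := Sum.elim
    (fun p x => logisticLoss (spin (x i)) (predictor i (cond p.1 j i) D γ p.2 x)) <| Sum.elim
    (fun b x => logisticLoss (spin (x i)) (F b x))
    fun p x => |tanh (predictor i i D γ p.1 x) - tanh (predictor i j D γ p.2 x)|
  have hg : ∀ e x, |g e x| ≤ K := by
    rintro (p | b | p) x
    · exact (abs_logisticLoss_le (abs_spin _).le (abs_predictor_le _ _ _ hγ _ _)).trans hK'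
    · exact (abs_logisticLoss_le (abs_spin _).le le_rfl).trans (hF b x)
    · refine le_trans ?_ hK
      simp only [g, Sum.elim_inr, abs_abs]
      refine (abs_sub _ _).trans ?_
      linarith [(abs_tanh_lt_one (predictor i i D γ p.1 x)).le,
        (abs_tanh_lt_one (predictor i j D γ p.2 x)).le]
  have h := R.sampleLaw_real_exists_le m (by linarith : 0 < K) hg hε
  have hsub : {X : Fin m → Fin n → Bool | ¬ R.GoodSamples i j D γ T ε F X} ⊆
      {X | ∃ e, m * ε < |∑ a, g e (X a) - m * ∑ x, R.prob x * g e x|} := by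
    intro X hX
    by_contra hne
    simp only [Set.mem_ofPred_eq, not_exists, not_lt] at hne
    exact hX ⟨fun b θ => hne (Sum.inl (b, θ)), fun b => hne (Sum.inr (Sum.inl b)),
      fun θ θ' => hne (Sum.inr (Sum.inr (θ, θ')))⟩
  refine (measureReal_mono hsub).trans (h.trans ?_)
  refine mul_le_mul_of_nonneg_right ?_ (exp_pos _).le
  have hcard : (Fintype.card Θ : ℝ) = (n ^ D * 2) ^ T := by simp [Θ]
  have hn : (1 : ℝ) ≤ n := by exact_mod_cast i.pos
  have h1 : 1 ≤ (n ^ D * 2 : ℝ) ^ T := by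
    refine one_le_pow₀ ?_
    have := one_le_pow₀ hn (n := D)
    linarith
  simp only [Fintype.card_sum, Fintype.card_prod, Fintype.card_bool]
  push_cast
  rw [hcard]
  nlinarith

variable {R} {d : TestData} {i j : Fin n} {X : Fin m → Fin n → Bool}
  {F : Bool → (Fin n → Bool) → ℝ} {ε εF τ : ℝ}

/-- On good samples, the greedy predictor is close to the conditional expectation of the spin. -/
theorem GoodSamples.sum_prob_abs_le (hg : R.GoodSamples i j d.D d.step d.T ε F X) (hm : 0 < m)
    (h : d.Matches i j X) (hd : d.Valid) (b : Bool) {θ : ℕ → ℕ × ℤ}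
    (hθ : d.Greedy (cond b j i : Fin n) θ d.T) {θ' : Fin d.T → Fin (n ^ d.D) × Bool}
    (hθ' : ∀ a : Fin m, d.logit (cond b j i : Fin n) θ d.T a =
      predictor i (cond b j i) d.D d.step θ' (X a))
    (hF : IsBoundedForm (maskedSpin i (cond b j i)) d.D ((2 ^ d.D) ^ 5) (F b))
    (hFz : ∀ x, |F b x - R.halfLogit i x| ≤ εF) (hτ : 0 ≤ τ)
    (hε : 2 * (2 * ε + 7 * ((2 : ℝ) ^ d.D)⁻¹ ^ 2 + 2 * εF) ≤ τ ^ 2) :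
    ∑ x, R.prob x * |tanh (predictor i (cond b j i) d.D d.step θ' x) -
      tanh (R.halfLogit i x)| ≤ τ := by
  have hm' : (0 : ℝ) < m := by exact_mod_cast hm
  have h1 := TestData.Greedy.sum_logisticLoss_predictor_le h hd (q := cond b j i) hθ hθ' hF
  have h2 := abs_le.mp (hg.loss b θ')
  have h3 := abs_le.mp (hg.form b)
  have h4 : R.risk i (predictor i (cond b j i) d.D d.step θ') ≤ R.risk i (F b) +
      (2 * ε + 7 * ((2 : ℝ) ^ d.D)⁻¹ ^ 2) := by
    refine le_of_mul_le_mul_left ?_ hm'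
    linarith [h2.1, h3.2]
  have h5 := abs_le.mp (R.abs_risk_sub_le i hFz)
  have h6 := R.sq_sum_prob_abs_le i fun x =>
    predictor_flip (q := cond b j i) (Or.inl rfl) d.D d.step θ' x
  refine abs_le_of_sq_le_sq' ?_ hτ |>.2
  linarith [h5.2]

end RBM

namespace RBM

open Real RAM

variable {n k m : ℕ} {R : RBM n k} {d : TestData} {i j : Fin n} {X : Fin m → Fin n → Bool}
  {F : Bool → (Fin n → Bool) → ℝ} {εF : ℝ} {v : ℤ}

/-- On good samples, the statistic of the test is close to its expectation. -/
theorem GoodSamples.abs_stat_sub_le (hg : R.GoodSamples i j d.D d.step d.T ((2 : ℝ) ^ d.D)⁻¹ F X)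
    (h : d.Matches i j X) (hd : d.Valid) {θ θ' : ℕ → ℕ × ℤ}
    (hθ : d.Greedy i θ d.T) (hθ' : d.Greedy j θ' d.T) {p p' : Fin d.T → Fin (n ^ d.D) × Bool}
    (hp : ∀ a : Fin m, d.logit i θ d.T a = predictor i i d.D d.step p (X a))
    (hp' : ∀ a : Fin m, d.logit j θ' d.T a = predictor i j d.D d.step p' (X a)) :
    |(d.stat (d.up i θ d.T) (d.down i θ d.T) (d.up j θ' d.T) (d.down j θ' d.T) m : ℝ) -
      m * d.H * (∑ x, R.prob x *
        |tanh (predictor i i d.D d.step p x) - tanh (predictor i j d.D d.step p' x)|)| ≤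
    m * d.H * (3 * ((2 : ℝ) ^ d.D)⁻¹) := by
  have h1 := TestData.abs_stat_sub_le hd (q := i) (q' := j) (t := d.T)
    (fun r hr => (hθ r hr).2.1) fun r hr => (hθ' r hr).2.1
  rw [h.sum_range, h.hm] at h1
  simp only [hp, hp'] at h1
  have h2 := hg.dist p p'
  set A : ℝ := 2 ^ d.D with hA
  have hA1 : 1 ≤ A := one_le_pow₀ (by norm_num)
  have hH : (d.H : ℝ) = A ^ 9 := by simp [TestData.H, hA]
  have hm : (0 : ℝ) ≤ m := Nat.cast_nonneg m
  have h3 : (1 : ℝ) ≤ d.H * A⁻¹ := by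
    rw [hH, ← div_eq_mul_inv, one_le_div (by positivity)]
    exact le_self_pow₀ hA1 (by norm_num)
  have h4 := mul_le_mul_of_nonneg_left h2 (Nat.cast_nonneg d.H : (0 : ℝ) ≤ d.H)
  rw [← abs_of_nonneg (Nat.cast_nonneg d.H : (0 : ℝ) ≤ d.H), ← abs_mul,
    abs_of_nonneg (Nat.cast_nonneg d.H : (0 : ℝ) ≤ d.H)] at h4
  rw [abs_le] at h1 h4 ⊢
  have h5 := mul_le_mul_of_nonneg_left h3 hm
  constructor <;> nlinarith

/-- On good samples, the test does not reject if the conditional expectation of the spin of `i`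
does not depend on the spin of `j`. -/
theorem GoodSamples.outcome_eq_zero
    (hg : R.GoodSamples i j d.D d.step d.T ((2 : ℝ) ^ d.D)⁻¹ F X)
    (h : d.Matches i j X) (hd : d.Valid) (he : 1 ≤ d.e)
    (hF : ∀ b, IsBoundedForm (maskedSpin i (cond b j i)) d.D ((2 ^ d.D) ^ 5) (F b))
    (hFz : ∀ b x, |F b x - R.halfLogit i x| ≤ εF)
    (hτ : 2 * (2 * ((2 : ℝ) ^ d.D)⁻¹ + 7 * ((2 : ℝ) ^ d.D)⁻¹ ^ 2 + 2 * εF) ≤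
      (1 / (16 * (d.Z : ℝ))) ^ 2)
    (hZ : 3 * ((2 : ℝ) ^ d.D)⁻¹ ≤ 1 / (4 * (d.Z : ℝ))) (hv : d.Outcome v) : v = 0 := by
  obtain ⟨θ, θ', hθ, hθ', rfl⟩ := hv
  refine if_neg (not_lt.mpr (mul_nonpos_of_nonneg_of_nonpos (by omega) (sub_nonpos.mpr ?_)))
  rw [h.hm, h.hi, h.hj]
  rw [h.hi] at hθ
  rw [h.hj] at hθ'
  rcases Nat.eq_zero_or_pos m with rfl | hm
  · simp [TestData.stat]
  obtain ⟨p, hp⟩ := TestData.Greedy.exists_predictor h hθ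
  obtain ⟨p', hp'⟩ := TestData.Greedy.exists_predictor h hθ'
  have hZ0 : (0 : ℝ) < d.Z := by simp [TestData.Z]
  have h1 := hg.sum_prob_abs_le hm h hd false hθ hp (hF false) (hFz false) (by positivity) hτ
  have h2 := hg.sum_prob_abs_le hm h hd true hθ' hp' (hF true) (hFz true) (by positivity) hτ
  have h3 := (abs_le.mp (hg.abs_stat_sub_le h hd hθ hθ' hp hp')).2
  have h4 : ∑ x, R.prob x * |tanh (predictor i i d.D d.step p x) -
      tanh (predictor i j d.D d.step p' x)| ≤ 1 / (16 * d.Z) + 1 / (16 * d.Z) := by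
    refine le_trans ?_ (add_le_add h1 h2)
    rw [← Finset.sum_add_distrib]
    refine Finset.sum_le_sum fun x _ => ?_
    rw [← mul_add]
    refine mul_le_mul_of_nonneg_left ?_ (R.prob_pos x).le
    refine (abs_sub_le _ (tanh (R.halfLogit i x)) _).trans ?_
    rw [abs_sub_comm (tanh (R.halfLogit i x))]
    rfl
  have hmH : (0 : ℝ) ≤ m * d.H := by positivity
  have h5 := mul_le_mul_of_nonneg_left h4 hmH
  have h6 := mul_le_mul_of_nonneg_left hZ hmH
  have h7 : (d.stat (d.up i θ d.T) (d.down i θ d.T) (d.up j θ' d.T) (d.down j θ' d.T) m : ℝ) ≤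
      m * d.H * (1 / (16 * d.Z) + 1 / (16 * d.Z) + 1 / (4 * d.Z)) := by linarith
  have h8 : (d.stat (d.up i θ d.T) (d.down i θ d.T) (d.up j θ' d.T) (d.down j θ' d.T) m : ℝ) *
      d.Z ≤ m * d.H := by
    refine (mul_le_mul_of_nonneg_right h7 hZ0.le).trans ?_
    have e1 : m * d.H * (1 / (16 * d.Z) + 1 / (16 * d.Z) + 1 / (4 * d.Z)) * d.Z =
        m * d.H * (3 / 8 : ℝ) := by
      field_simp
      ring
    rw [e1]
    linarith
  exact_mod_cast h8

/-- On good samples, the test rejects if the conditional expectation of the spin of `i` is not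
close to functions not depending on the spin of `j`. -/
theorem GoodSamples.outcome_eq_one
    (hg : R.GoodSamples i j d.D d.step d.T ((2 : ℝ) ^ d.D)⁻¹ F X) (hm : 0 < m)
    (h : d.Matches i j X) (hd : d.Valid) (he : 2 ≤ d.e)
    (hF : IsBoundedForm (maskedSpin i i) d.D ((2 ^ d.D) ^ 5) (F false))
    (hFz : ∀ x, |F false x - R.halfLogit i x| ≤ εF)
    (hτ : 2 * (2 * ((2 : ℝ) ^ d.D)⁻¹ + 7 * ((2 : ℝ) ^ d.D)⁻¹ ^ 2 + 2 * εF) ≤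
      (1 / (16 * (d.Z : ℝ))) ^ 2)
    (hZ : 3 * ((2 : ℝ) ^ d.D)⁻¹ ≤ 1 / (4 * (d.Z : ℝ)))
    (hfar : ∀ g : (Fin n → Bool) → ℝ, (∀ x, g (flipSpin i x) = g x) →
      (∀ x, g (flipSpin j x) = g x) →
      2 / (d.Z : ℝ) ≤ ∑ x, R.prob x * |g x - tanh (R.halfLogit i x)|)
    (hv : d.Outcome v) : v = 1 := by
  obtain ⟨θ, θ', hθ, hθ', rfl⟩ := hv
  refine if_pos (mul_pos (by omega) (sub_pos.mpr ?_))
  rw [h.hm, h.hi, h.hj]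
  rw [h.hi] at hθ
  rw [h.hj] at hθ'
  obtain ⟨p, hp⟩ := TestData.Greedy.exists_predictor h hθ
  obtain ⟨p', hp'⟩ := TestData.Greedy.exists_predictor h hθ'
  have hZ0 : (0 : ℝ) < d.Z := by simp [TestData.Z]
  have h1 := hg.sum_prob_abs_le hm h hd false hθ hp hF hFz (by positivity) hτ
  have h2 := hfar (fun x => tanh (predictor i j d.D d.step p' x))
    (fun x => by simp only [predictor_flip (Or.inl rfl)])
    fun x => by simp only [predictor_flip (Or.inr rfl)]
  have h3 := (abs_le.mp (hg.abs_stat_sub_le h hd hθ hθ' hp hp')).1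
  have h4 : ∑ x, R.prob x * |tanh (predictor i j d.D d.step p' x) - tanh (R.halfLogit i x)| ≤
      ∑ x, R.prob x * |tanh (predictor i i d.D d.step p x) -
        tanh (predictor i j d.D d.step p' x)| + 1 / (16 * d.Z) := by
    refine le_trans ?_ (add_le_add le_rfl h1)
    rw [← Finset.sum_add_distrib]
    refine Finset.sum_le_sum fun x _ => ?_
    rw [← mul_add]
    refine mul_le_mul_of_nonneg_left ?_ (R.prob_pos x).le
    refine (abs_sub_le _ (tanh (predictor i i d.D d.step p x)) _).trans ?_
    rw [abs_sub_comm (tanh (predictor i j d.D d.step p' x))]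
    rfl
  have hH : (0 : ℝ) < d.H := by simp [TestData.H]
  have hm' : (0 : ℝ) < m := by exact_mod_cast hm
  have hmH : (0 : ℝ) < m * d.H := mul_pos hm' hH
  have h5 := mul_le_mul_of_nonneg_left (h2.trans h4) hmH.le
  have h6 := mul_le_mul_of_nonneg_left hZ hmH.le
  have h7 : m * d.H * (2 / d.Z - 1 / (16 * d.Z) - 1 / (4 * d.Z)) ≤
      (d.stat (d.up i θ d.T) (d.down i θ d.T) (d.up j θ' d.T) (d.down j θ' d.T) m : ℝ) := by
    linarith
  have h8 : m * d.H < (d.stat (d.up i θ d.T) (d.down i θ d.T) (d.up j θ' d.T) (d.down j θ' d.T) m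
      : ℝ) * d.Z := by
    refine lt_of_lt_of_le ?_ (mul_le_mul_of_nonneg_right h7 hZ0.le)
    have e1 : m * d.H * (2 / d.Z - 1 / (16 * d.Z) - 1 / (4 * d.Z)) * d.Z =
        m * d.H * (27 / 16 : ℝ) := by
      field_simp
      norm_num
    rw [e1]
    linarith
  exact_mod_cast h8

end RBM

open Real in
/-- The number of samples suffices for a union bound over all pairs of predictors and all pairs of
nodes. -/
theorem failure_probability_le {n D m C : ℕ} {L lam₂ δ : ℝ} (hL : L = max lam₂ 2) (hC : 200 ≤ C)
    (hn : 2 ≤ n) (hδ : 0 < δ) (hδ2 : δ < 2) (hA : 64 ≤ (2 : ℝ) ^ D)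
    (hm : sampleBound C D n lam₂ δ ≤ m) :
    0 < m ∧ 10 * ((n ^ D * 2 : ℝ) ^ ((2 ^ D) ^ 16)) ^ 2 *
      exp (-(m * ((2 : ℝ) ^ D)⁻¹ ^ 2 / (2 * (((2 : ℝ) ^ D) ^ 9) ^ 2))) ≤ δ / (2 * n ^ 2) := by
  have hn' : (2 : ℝ) ≤ n := by exact_mod_cast hn
  set Y : ℝ := 2 * n / δ with hY
  have hYn : (n : ℝ) ≤ Y := by rw [hY, le_div_iff₀ hδ]; nlinarith
  have hY2 : 2 ≤ Y := hn'.trans hYn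
  have hY0 : 0 < Y := by linarith
  set l := log Y with hl
  have hl0 : 0 < l := log_pos (by linarith)
  have hYl : exp l = Y := exp_log hY0
  set A : ℝ := 2 ^ D with hAdef
  have hA1 : 1 ≤ A := by linarith
  have hA0 : 0 < A := by linarith
  have hm1 : 200 * A ^ 40 * l ≤ m := by
    refine le_trans ?_ hm
    rw [sampleBound, ← hL]
    refine mul_le_mul_of_nonneg_right (mul_le_mul (by exact_mod_cast hC) ?_ (by positivity)
      (Nat.cast_nonneg C)) hl0.le
    have h2L : 2 ≤ L := hL ▸ le_max_right _ _
    calc A ^ 40 = 2 ^ (D * 40) := by rw [hAdef, ← pow_mul]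
      _ ≤ 2 ^ (C * D) := pow_le_pow_right₀ (by norm_num) (by nlinarith)
      _ ≤ L ^ (C * D) := pow_le_pow_left₀ (by norm_num) h2L _
  have hm0 : (0 : ℝ) < m := lt_of_lt_of_le (by positivity) hm1
  refine ⟨by exact_mod_cast hm0, ?_⟩
  set N : ℕ := 6 + 2 * ((D + 1) * (2 ^ D) ^ 16) with hN
  have h1 : (n ^ D * 2 : ℝ) ≤ Y ^ (D + 1) := by
    rw [pow_succ]
    exact mul_le_mul (pow_le_pow_left₀ (by linarith) hYn D) hY2 (by norm_num) (by positivity)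
  have h2 : 10 * ((n ^ D * 2 : ℝ) ^ ((2 ^ D) ^ 16)) ^ 2 ≤
      Y ^ 4 * Y ^ (2 * ((D + 1) * (2 ^ D) ^ 16)) := by
    refine mul_le_mul ?_ ?_ (by positivity) (by positivity)
    · linarith [pow_le_pow_left₀ (by norm_num) hY2 4]
    · rw [mul_comm 2, pow_mul, pow_mul]
      exact pow_le_pow_left₀ (by positivity) (pow_le_pow_left₀ (by positivity) h1 _) 2
  have h3 : N * l ≤ m * A⁻¹ ^ 2 / (2 * (A ^ 9) ^ 2) := by
    have e : (m : ℝ) * A⁻¹ ^ 2 / (2 * (A ^ 9) ^ 2) = m / (2 * A ^ 20) := by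
      field_simp
    rw [e, le_div_iff₀ (by positivity)]
    refine le_trans ?_ hm1
    have h4 : (D + 1 : ℝ) ≤ A := by
      have := Nat.lt_two_pow_self (n := D)
      rw [hAdef]
      exact_mod_cast this
    have h5 : (N : ℝ) ≤ 8 * A ^ 17 := by
      rw [hN]
      push_cast
      rw [← hAdef]
      have : (D + 1 : ℝ) * A ^ 16 ≤ A * A ^ 16 := mul_le_mul_of_nonneg_right h4 (by positivity)
      have h6 : 1 ≤ A ^ 17 := one_le_pow₀ hA1
      have e : A * A ^ 16 = A ^ 17 := by ring
      linarith
    have h7 : A ^ 37 ≤ A ^ 40 := pow_le_pow_right₀ hA1 (by norm_num)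
    calc N * l * (2 * A ^ 20) ≤ 8 * A ^ 17 * l * (2 * A ^ 20) :=
          mul_le_mul_of_nonneg_right (mul_le_mul_of_nonneg_right h5 hl0.le) (by positivity)
      _ = 16 * A ^ 37 * l := by ring
      _ ≤ 200 * A ^ 40 * l :=
          mul_le_mul_of_nonneg_right (by linarith [pow_pos hA0 40]) hl0.le
  calc _ ≤ Y ^ 4 * Y ^ (2 * ((D + 1) * (2 ^ D) ^ 16)) * exp (-(N * l)) :=
        mul_le_mul h2 (exp_le_exp.mpr (neg_le_neg h3)) (exp_pos _).le (by positivity)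
    _ = (Y * Y)⁻¹ := by
        rw [exp_neg, exp_nat_mul, hYl, hN, ← pow_add]
        rw [← div_eq_mul_inv, div_eq_iff (by positivity), eq_comm,
          inv_mul_eq_iff_eq_mul₀ (by positivity)]
        ring
    _ ≤ (n * Y)⁻¹ := inv_anti₀ (by positivity) (mul_le_mul_of_nonneg_right hYn hY0.le)
    _ = δ / (2 * n ^ 2) := by rw [hY]; field_simp

namespace RBM

open Real RAM

variable {n k m : ℕ} {R : RBM n k} {lam₁ lam₂ : ℝ}

/-- The conditional log-odds of a bounded machine are approximated by polynomials of degree `D` with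
coefficients bounded in terms of `D`. -/
theorem IsBounded.exists_approximation (hR : R.IsBounded lam₁ lam₂) {L E : ℝ} {D : ℕ}
    (hL : lam₂ ≤ L) (hL2 : 2 ≤ L) (hE1 : 1 ≤ E) (hE : lam₁ * L ≤ E) (hA : 64 ≤ (2 : ℝ) ^ D)
    (hEA : E ≤ 2 ^ D) {i q : Fin n} (hq : ∀ x, R.halfLogit i (flipSpin q x) = R.halfLogit i x) :
    ∃ F : (Fin n → Bool) → ℝ, IsBoundedForm (maskedSpin i q) D ((2 ^ D) ^ 5) F ∧
      (∀ x, |F x - R.halfLogit i x| ≤ 18 * E ^ 2 * 2 ^ (-(D / (2 * L)))) ∧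
      ∀ x, 2 * |F x| ≤ (2 ^ D) ^ 9 := by
  obtain ⟨F, hF, hFz⟩ := R.exists_isBoundedForm (i := i) (q := q) (L := L) (by linarith) rfl
    (fun j => (hR.2 j).trans hL) hq D
  have hS := hR.sum_abs_W_mul_le i hL hL2 hE hE1
  have hS0 : 0 ≤ ∑ j, |R.W i j| := Finset.sum_nonneg fun _ _ => abs_nonneg _
  set S := ∑ j, |R.W i j| with hSdef
  set A : ℝ := 2 ^ D with hAdef
  have hlam := hR.nonneg i
  have hb : |R.b₁ i| ≤ lam₁ :=
    (le_add_of_nonneg_left (Finset.sum_nonneg fun _ _ => abs_nonneg _)).trans (hR.1 i)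
  have hbA : |R.b₁ i| ≤ A := by nlinarith
  have hSA : S ≤ 2 * A ^ 2 := by nlinarith
  have h3 : (3 : ℝ) ^ (D + 1) ≤ 3 * A ^ 2 := by
    rw [pow_succ, mul_comm, hAdef, ← pow_mul, mul_comm D 2, pow_mul]
    exact mul_le_mul_of_nonneg_left (pow_le_pow_left₀ (by norm_num) (by norm_num) D) (by norm_num)
  have hB : |R.b₁ i| + S * 3 ^ (D + 1) ≤ A ^ 5 := by
    have h4 : S * 3 ^ (D + 1) ≤ 2 * A ^ 2 * (3 * A ^ 2) :=
      mul_le_mul hSA h3 (by positivity) (by positivity)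
    have h5 : A ≤ A ^ 4 := le_self_pow₀ (by linarith) (by norm_num)
    have h6 : 64 * A ^ 4 ≤ A ^ 5 := by
      rw [pow_succ A 4, mul_comm]
      exact mul_le_mul_of_nonneg_left hA (by positivity)
    have h7 : 0 ≤ A ^ 4 := by positivity
    nlinarith
  refine ⟨F, hF.mono hB, fun x => (hFz x).trans ?_, fun x => ?_⟩
  · have h4 := inv_pow_le_two_rpow (by linarith : 1 ≤ L) rfl (D + 1)
    have h5 : (2 : ℝ) ^ (-((D + 1 : ℕ) / (2 * L)) : ℝ) ≤ 2 ^ (-(D / (2 * L))) := by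
      refine rpow_le_rpow_of_exponent_le (by norm_num) (neg_le_neg ?_)
      exact div_le_div_of_nonneg_right (by push_cast; linarith) (by positivity)
    calc S * (6 * L * (1 + 1 / (2 * L))⁻¹ ^ (D + 1)) =
        6 * (S * L) * (1 + 1 / (2 * L))⁻¹ ^ (D + 1) := by ring
      _ ≤ 6 * (3 * E ^ 2) * 2 ^ (-(D / (2 * L))) := by
          refine mul_le_mul (by linarith) (h4.trans h5) (by positivity) (by positivity)
      _ = _ := by ring
  · have h4 := (hF.mono hB).abs_le (fun r x => abs_maskedSpin i q r x) x
    have h5 : A ^ 5 * 64 ≤ A ^ 9 := by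
      have : A ^ 9 = A ^ 5 * A ^ 4 := by ring
      rw [this]
      exact mul_le_mul_of_nonneg_left (hA.trans (le_self_pow₀ (by linarith) (by norm_num)))
        (by positivity)
    have : 0 ≤ A ^ 5 := by positivity
    linarith

theorem IsBounded.mul_le_exp (hR : R.IsBounded lam₁ lam₂) (i : Fin n) {η L : ℝ} (hη : 0 < η)
    (hL : 0 < L) : lam₁ * L ≤ η * exp (max 1 (log (lam₁ * L / η))) := by
  rw [← div_le_iff₀' hη]
  rcases (div_nonneg (mul_nonneg (hR.nonneg i) hL.le) hη.le).eq_or_lt with h | h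
  · rw [← h]; positivity
  · calc _ = exp (log (lam₁ * L / η)) := (exp_log h).symm
      _ ≤ _ := exp_le_exp.mpr (le_max_right _ _)

variable {η δ : ℝ} {C D : ℕ} {i j : Fin n} {d : (Fin m → Fin n → Bool) → TestData}
  {v : (Fin m → Fin n → Bool) → ℤ}

/-- The data of the tests, for all samples, and their results. -/
structure TestsWith (D e Q : ℕ) (i j : Fin n) (d : (Fin m → Fin n → Bool) → TestData)
    (v : (Fin m → Fin n → Bool) → ℤ) : Prop where
  hD : ∀ X, (d X).D = D
  hL : ∀ X, (d X).L = 8 * Q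
  he : ∀ X, (d X).e = e
  matching : ∀ X, (d X).Matches i j X
  valid : ∀ X, (d X).Valid
  outcome : ∀ X, (d X).Outcome (v X)

theorem le_ceil_add_two (lam₂ : ℝ) : max lam₂ 2 ≤ (⌈lam₂⌉₊ + 2 : ℕ) := by
  push_cast
  exact max_le (by linarith [Nat.le_ceil lam₂]) (by linarith [Nat.cast_nonneg (α := ℝ) ⌈lam₂⌉₊])

theorem ceil_add_two_le (lam₂ : ℝ) : (⌈lam₂⌉₊ + 2 : ℕ) ≤ 5 / 2 * max lam₂ 2 := by
  push_cast
  rcases le_total lam₂ 2 with h | h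
  · have : (⌈lam₂⌉₊ : ℝ) ≤ 2 := by exact_mod_cast Nat.ceil_le.mpr (by exact_mod_cast h)
    rw [max_eq_right h]
    linarith
  · have := Nat.ceil_lt_add_one (by linarith : 0 ≤ lam₂)
    rw [max_eq_left h]
    linarith

theorem sampleLaw_not_goodSamples_le_of_sampleBound (hC : 200 ≤ C) (hn : 2 ≤ n) (hδ : 0 < δ)
    (hδ2 : δ < 2) (hA : 64 ≤ (2 : ℝ) ^ D) (hm : sampleBound C D n lam₂ δ ≤ m)
    (i j : Fin n) {F : Bool → (Fin n → Bool) → ℝ} (hF : ∀ b x, 2 * |F b x| ≤ (2 ^ D) ^ 9) :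
    (R.sampleLaw m).real {X | ¬ R.GoodSamples i j D (artanh (1 / ((2 ^ D) ^ 9 : ℕ)))
      ((2 ^ D) ^ 16) ((2 : ℝ) ^ D)⁻¹ F X} ≤ δ / (2 * n ^ 2) := by
  set A : ℝ := 2 ^ D with hAdef
  have hA1 : 1 ≤ A := by linarith
  have hA9 : A ≤ A ^ 9 := le_self_pow₀ hA1 (by norm_num)
  have hH : (((2 ^ D) ^ 9 : ℕ) : ℝ) = A ^ 9 := by push_cast; rfl
  have h0 : (0 : ℝ) ≤ 1 / ((2 ^ D) ^ 9 : ℕ) := by positivity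
  have h1 : (1 : ℝ) / ((2 ^ D) ^ 9 : ℕ) ≤ 1 / 2 := by
    rw [hH]
    exact div_le_div_of_nonneg_left (by norm_num) (by norm_num) (by linarith)
  have h2 := artanh_le_two_mul h0 h1
  have h3 := (le_artanh h0 (by linarith)).trans' h0
  refine (R.sampleLaw_not_goodSamples_le i j D h3 ((2 ^ D) ^ 16) (K := A ^ 9) (by positivity)
    (by linarith) ?_ hF).trans (failure_probability_le rfl hC hn hδ hδ2 hA hm).2
  have hT : (((2 ^ D) ^ 16 : ℕ) : ℝ) = A ^ 16 := by push_cast; rfl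
  rw [hH] at h2 ⊢
  rw [hT]
  calc 2 * (artanh (1 / A ^ 9) * A ^ 16) ≤ 2 * (2 * (1 / A ^ 9) * A ^ 16) := by gcongr
    _ = 4 * A ^ 7 := by field_simp; norm_num
    _ ≤ A ^ 2 * A ^ 7 := mul_le_mul_of_nonneg_right (by nlinarith) (by positivity)
    _ = A ^ 9 := by ring

/-- The probability that the test rejects although `i` and `j` are not neighbors. -/
theorem IsBounded.sampleLaw_ne_zero_le (hR : R.IsBounded lam₁ lam₂) (hη : 0 < η) (hC : 200 ≤ C)
    (hδ : 0 < δ) (hδ2 : δ < 2) (hD : D = degree C lam₁ lam₂ η)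
    (hm : sampleBound C D n lam₂ δ ≤ m) (hn : 2 ≤ n) (hij : i ≠ j)
    (hd : TestsWith D ⌈1 / η⌉₊ (⌈lam₂⌉₊ + 2) i j d v) (h : ¬ R.TwoHopNeighbors i j) :
    (R.sampleLaw m).real {X | v X ≠ 0} ≤ δ / (2 * n ^ 2) := by
  rcases le_or_gt 1 η with hη1 | hη1
  · have : {X | v X ≠ 0} = ∅ := by
      refine Set.eq_empty_iff_forall_notMem.mpr fun X hX => hX ?_
      obtain ⟨_, _, _, _, hv⟩ := hd.outcome X
      have he : ⌈1 / η⌉₊ = 1 := by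
        refine le_antisymm (Nat.ceil_le.mpr ?_) (Nat.ceil_pos.mpr (by positivity))
        rw [Nat.cast_one, div_le_one hη]
        exact hη1
      rw [hv, hd.he, he]
      simp
    rw [this, measureReal_empty]
    positivity
  set L := max lam₂ 2 with hL
  have hL2 : 2 ≤ L := le_max_right _ _
  set U := max 1 (log (lam₁ * L / η)) with hU
  have hU1 : 1 ≤ U := le_max_left _ _
  have hD200 : 200 * L * U ≤ D := by
    rw [hD, degree]
    refine le_trans ?_ (Nat.le_ceil _)
    have : (200 : ℝ) ≤ C := by exact_mod_cast hC
    gcongr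
  obtain ⟨⟨hA, hEA⟩, hτ, hZ, hEZ⟩ := parameter_bounds hL2 hU1 hD200 (le_ceil_add_two lam₂)
    (ceil_add_two_le lam₂)
  have hE1 : 1 ≤ exp U := one_le_exp (by linarith)
  have hlam : lam₁ * L ≤ exp U := (hR.mul_le_exp i hη (by linarith)).trans (by nlinarith)
  obtain ⟨F₀, hF₀, hFz₀, hFK₀⟩ := hR.exists_approximation (D := D) (le_max_left _ _) hL2 hE1 hlam hA
    hEA fun x => R.halfLogit_flip_self i x
  obtain ⟨F₁, hF₁, hFz₁, hFK₁⟩ := hR.exists_approximation (D := D) (le_max_left _ _) hL2 hE1 hlam hA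
    hEA fun x => R.halfLogit_flip_of_not_twoHopNeighbors hij h x
  refine (measureReal_mono ?_).trans (R.sampleLaw_not_goodSamples_le_of_sampleBound hC hn hδ hδ2
    hA hm i j (F := fun b => cond b F₁ F₀) (by rintro (_ | _); exacts [hFK₀, hFK₁]))
  intro X hX hg
  refine hX ?_
  have hDX := hd.hD X
  subst hDX
  refine GoodSamples.outcome_eq_zero hg (hd.matching X) (hd.valid X)
    (by rw [hd.he]; exact Nat.ceil_pos.mpr (by positivity)) (by rintro (_ | _); exacts [hF₀, hF₁])
    (εF := 18 * exp U ^ 2 * 2 ^ (-((d X).D / (2 * L)))) (by rintro (_ | _); exacts [hFz₀, hFz₁])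
    ?_ ?_ (hd.outcome X)
  · simp only [TestData.Z, hd.hL]
    push_cast
    exact_mod_cast hτ
  · simp only [TestData.Z, hd.hL]
    push_cast
    exact_mod_cast hZ

/-- The probability that the test does not reject although `i` and `j` are nondegenerate
neighbors. -/
theorem IsBounded.sampleLaw_ne_one_le (hR : R.IsBounded lam₁ lam₂) (hη : 0 < η) (hC : 200 ≤ C)
    (hδ : 0 < δ) (hδ2 : δ < 2) (hD : D = degree C lam₁ lam₂ η)
    (hm : sampleBound C D n lam₂ δ ≤ m) (hn : 2 ≤ n) (hij : i ≠ j)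
    (hd : TestsWith D ⌈1 / η⌉₊ (⌈lam₂⌉₊ + 2) i j d v) (h : R.Nondegenerate η i j) :
    (R.sampleLaw m).real {X | v X ≠ 1} ≤ δ / (2 * n ^ 2) := by
  have hI : η ≤ R.condMutualInfo i j := by
    rcases h with h | h
    · exact h
    · rwa [condMutualInfo_comm] at h
  have hη1 : η < 1 := (hI.trans (R.condMutualInfo_le_log_two hij)).trans_lt
    (by linarith [log_two_lt_d9])
  set L := max lam₂ 2 with hL
  have hL2 : 2 ≤ L := le_max_right _ _
  set U := max 1 (log (lam₁ * L / η)) with hU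
  have hU1 : 1 ≤ U := le_max_left _ _
  have hD200 : 200 * L * U ≤ D := by
    rw [hD, degree]
    refine le_trans ?_ (Nat.le_ceil _)
    have : (200 : ℝ) ≤ C := by exact_mod_cast hC
    gcongr
  obtain ⟨⟨hA, hEA⟩, hτ, hZ, hEZ⟩ := parameter_bounds hL2 hU1 hD200 (le_ceil_add_two lam₂)
    (ceil_add_two_le lam₂)
  have hE1 : 1 ≤ exp U := one_le_exp (by linarith)
  have hlamη := hR.mul_le_exp i hη (by linarith : 0 < L)
  have hlam : lam₁ * L ≤ exp U := hlamη.trans (by nlinarith)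
  obtain ⟨F, hF, hFz, hFK⟩ := hR.exists_approximation (D := D) (le_max_left _ _) hL2 hE1 hlam hA
    hEA fun x => R.halfLogit_flip_self i x
  refine (measureReal_mono ?_).trans (R.sampleLaw_not_goodSamples_le_of_sampleBound hC hn hδ hδ2
    hA hm i j (F := fun _ => F) fun _ => hFK)
  intro X hX hg
  refine hX ?_
  have hm0 := (failure_probability_le rfl hC hn hδ hδ2 hA hm).1
  have hDX := hd.hD X
  subst hDX
  refine GoodSamples.outcome_eq_one hg hm0 (hd.matching X) (hd.valid X) ?_ hF
    (εF := 18 * exp U ^ 2 * 2 ^ (-((d X).D / (2 * L)))) hFz ?_ ?_ ?_ (hd.outcome X)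
  · rw [hd.he]
    refine Nat.lt_ceil.mpr ?_
    rw [Nat.cast_one, lt_div_iff₀ hη]
    linarith
  · simp only [TestData.Z, hd.hL]
    push_cast
    exact_mod_cast hτ
  · simp only [TestData.Z, hd.hL]
    push_cast
    exact_mod_cast hZ
  · intro g hgi hgj
    have h1 := R.condMutualInfo_le hij (R.abs_halfLogit_le i) hgi hgj
    set s := ∑ x, R.prob x * |g x - tanh (R.halfLogit i x)| with hs
    have hs0 : 0 ≤ s := Finset.sum_nonneg fun x _ => mul_nonneg (R.prob_pos x).le (abs_nonneg _)
    have h2 := hR.abs_add_sum_le i (le_max_left lam₂ 2) (by linarith)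
    have h3 : |R.b₁ i| + ∑ j, |R.W i j| ≤ 2 * (η * exp U) := by
      have := hR.nonneg i
      rw [← hL] at h2
      nlinarith
    have h4 : η ≤ 4 * (2 * (η * exp U)) * s :=
      hI.trans (h1.trans (mul_le_mul_of_nonneg_right (by linarith) hs0))
    have h5 : 1 ≤ 8 * exp U * s := by
      refine le_of_mul_le_mul_left ?_ hη
      linarith
    simp only [TestData.Z, hd.hL]
    push_cast
    rw [div_le_iff₀ (by positivity)]
    have h6 := mul_le_mul_of_nonneg_left hEZ hs0
    linarith

end RBM

/-! ### The main theorem -/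

open RAM

section Encoding

variable {n m : ℕ}

theorem encodeSamples_eq_ofFn (X : Fin m → Fin n → Bool) :
    encodeSamples X = List.ofFn fun t : Fin (m * n) => spin (X t.divNat t.modNat) := by
  rw [List.ofFn_mul, encodeSamples]
  congr 2
  funext a
  congr 1
  funext r
  have hn : 0 < n := r.pos
  congr 2
  · ext
    simp [Fin.divNat, Nat.mul_add_div hn, mul_comm, Nat.div_eq_of_lt r.2]
  · ext
    simp [Fin.modNat, Nat.mod_eq_of_lt r.2]

theorem length_encodeSamples (X : Fin m → Fin n → Bool) :
    (encodeSamples X).length = n * m := by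
  rw [encodeSamples_eq_ofFn, List.length_ofFn, mul_comm]

theorem eq_of_mem_encodeSamples (X : Fin m → Fin n → Bool) :
    ∀ z ∈ encodeSamples X, z = 1 ∨ z = -1 := by
  intro z hz
  rw [encodeSamples_eq_ofFn, List.mem_ofFn'] at hz
  obtain ⟨t, rfl⟩ := hz
  cases X t.divNat t.modNat <;> simp [spin]

theorem getD_encodeSamples (X : Fin m → Fin n → Bool) (a : Fin m) (r : Fin n) :
    (encodeSamples X).getD (a * n + r) 0 = spin (X a r) := by
  have hlt : (a : ℕ) * n + r < m * n := by
    have := Nat.mul_le_mul_right n (Nat.succ_le_of_lt a.2)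
    rw [Nat.succ_mul] at this
    omega
  have hn : 0 < n := r.pos
  rw [encodeSamples_eq_ofFn, List.getD_eq_getElem _ _ (by simpa using hlt), List.getElem_ofFn]
  congr 2
  · ext
    simp [Fin.divNat, Nat.mul_add_div hn, mul_comm, Nat.div_eq_of_lt r.2]
  · ext
    simp [Fin.modNat, Nat.mod_eq_of_lt r.2]

/-- Data that hold a list of samples. -/
theorem RAM.TestData.matches_and_valid {I : ℕ → ℤ} {P D st L e N : ℕ} {i j : Fin n}
    {X : Fin m → Fin n → Bool} (hn : 2 ≤ n) (hD : 1 ≤ D) (hN : n * m ≤ N) (hN' : 1 ≤ N)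
    (hI : ∀ t < n * m, I (st + t) = (encodeSamples X).getD t 0) (hP : st + n * m ≤ P) :
    TestData.Matches ⟨I, P, (n ^ D * N) ^ 16, valueBound (n ^ D * N), n, m, D, i, j, st, L, e⟩
      i j X ∧
    TestData.Valid ⟨I, P, (n ^ D * N) ^ 16, valueBound (n ^ D * N), n, m, D, i, j, st, L, e⟩ := by
  have hx : ∀ (a : Fin m) (r : Fin n), I (st + (a * n + r)) = spin (X a r) := by
    intro a r
    rw [hI, getD_encodeSamples]
    have := Nat.mul_le_mul_right n (Nat.succ_le_of_lt a.2)
    rw [Nat.succ_mul, mul_comm m n] at this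
    omega
  refine ⟨⟨rfl, rfl, rfl, rfl, hx⟩, TestData.valid_of hn hD i.2 j.2 hN hN' ?_ hP⟩
  intro a ha r hr
  rw [hx ⟨a, ha⟩ ⟨r, hr⟩]
  cases X ⟨a, ha⟩ ⟨r, hr⟩ <;> simp [spin]

end Encoding

theorem timeBound_mono {C₀ C D n : ℕ} (h : C₀ ≤ C) (hn : 0 < n) {input : List ℤ}
    (hi : 0 < input.length) :
    C₀ * (n ^ D * inputSize input) ^ C₀ ≤ timeBound C D n input := by
  have h1 : 1 ≤ n ^ D * inputSize input :=
    Nat.mul_pos (Nat.pow_pos hn) (hi.trans_le (length_le_inputSize input))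
  exact Nat.mul_le_mul h (Nat.pow_le_pow_right h1 h)

theorem one_le_degree {C : ℕ} (hC : 200 ≤ C) (lam₁ lam₂ η : ℝ) : 1 ≤ degree C lam₁ lam₂ η := by
  refine Nat.ceil_pos.mpr ?_
  have h1 : (0 : ℝ) < C := by exact_mod_cast (by omega : 0 < C)
  exact mul_pos (mul_pos h1 (by positivity)) (by positivity)

open RBM

/-- The testing program, for every sufficiently large constant. -/
theorem exists_test_program : ∃ C₀ : ℕ, ∀ C, C₀ ≤ C → ∃ P : RAM.Program,
    ∀ (lam₁ lam₂ η δ : ℝ), 0 < η → 0 < δ →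
      ∀ (D n m : ℕ) (i j : Fin n), i ≠ j → D = degree C lam₁ lam₂ η →
        sampleBound C D n lam₂ δ ≤ m →
        ∃ rejects : (Fin m → Fin n → Bool) → Bool,
          (∀ x, RAM.HaltsWithin P (testInput D lam₁ lam₂ η i j x)
            (timeBound C D n (testInput D lam₁ lam₂ η i j x))
            fun σ => σ 0 = if rejects x then 1 else 0) ∧
          ∃ α β : ℝ, 0 ≤ α ∧ 0 ≤ β ∧ α + β ≤ δ ∧
            (∀ (k : ℕ) (R : RBM n k), R.IsBounded lam₁ lam₂ → ¬ R.TwoHopNeighbors i j →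
              (R.sampleLaw m).real {x | rejects x = true} ≤ α) ∧
            (∀ (k : ℕ) (R : RBM n k), R.IsBounded lam₁ lam₂ → R.Nondegenerate η i j →
              (R.sampleLaw m).real {x | rejects x = false} ≤ β) := by
  obtain ⟨C₀, hC₀⟩ := exists_test_halts
  refine ⟨max 200 C₀, fun C hC => ⟨testProgram, ?_⟩⟩
  intro lam₁ lam₂ η δ hη hδ D n m i j hij hD hm
  have hC200 : 200 ≤ C := (le_max_left _ _).trans hC
  have hn : 2 ≤ n := by
    by_contra hc
    exact hij (Fin.ext (by omega))
  have hD1 : 1 ≤ D := hD ▸ one_le_degree hC200 lam₁ lam₂ η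
  have hrun := fun X : Fin m → Fin n → Bool =>
    hC₀ n m D i j ⌈lam₁⌉₊ ⌈lam₂⌉₊ ⌈1 / η⌉₊ (encodeSamples X) hn hD1 i.2 j.2
      (length_encodeSamples X) (eq_of_mem_encodeSamples X) (testInput D lam₁ lam₂ η i j X) rfl
  choose t σ ht hex hout using hrun
  have htests : TestsWith D ⌈1 / η⌉₊ (⌈lam₂⌉₊ + 2) i j
      (fun X => testData n m D ⌈lam₂⌉₊ ⌈1 / η⌉₊ i j (testInput D lam₁ lam₂ η i j X))
      fun X => σ X 0 := by
    have hmv : ∀ X : Fin m → Fin n → Bool, _ := fun X =>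
      RAM.TestData.matches_and_valid (X := X) (i := i) (j := j)
        (I := Function.update (initial (testInput D lam₁ lam₂ η i j X)) 5
          (8 + (n * m + n * n) : ℕ))
        (P := 8 + (n * m + n * n)) (D := D) (st := 8) (L := 8 * (⌈lam₂⌉₊ + 2)) (e := ⌈1 / η⌉₊)
        (N := inputSize (testInput D lam₁ lam₂ η i j X)) hn hD1
        (le_trans (by simp [testInput, length_encodeSamples, encodeParameters]; omega)
          (length_le_inputSize _))
        (le_trans (by simp [testInput, encodeParameters]) (length_le_inputSize _))
        (fun t _ => by
          rw [Function.update_of_ne (by omega), initial, testInput,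
            List.getD_append_right _ _ _ _ (by simp [encodeParameters])]
          simp [encodeParameters]) (by omega)
    exact ⟨fun _ => rfl, fun _ => rfl, fun _ => rfl, fun X => (hmv X).1, fun X => (hmv X).2, hout⟩
  refine ⟨fun X => decide (σ X 0 = 1), fun X => ⟨t X, σ X, (ht X).trans (timeBound_mono
    ((le_max_right _ _).trans hC) (by omega) (by simp [testInput])), hex X, ?_⟩, ?_⟩
  · rcases (hout X).zero_or_one with h | h <;> simp [h]
  rcases le_or_gt 2 δ with hδ2 | hδ2
  · exact ⟨1, 1, by norm_num, by norm_num, by linarith, fun k R _ _ => measureReal_le_one,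
      fun k R _ _ => measureReal_le_one⟩
  have hle : δ / (2 * (n : ℝ) ^ 2) ≤ δ / 2 := by
    have : (1 : ℝ) ≤ (n : ℝ) ^ 2 := one_le_pow₀ (by exact_mod_cast (by omega : 1 ≤ n))
    exact div_le_div_of_nonneg_left hδ.le two_pos (by linarith)
  refine ⟨δ / 2, δ / 2, by positivity, by positivity, by linarith, fun k R hR h => ?_,
    fun k R hR h => ?_⟩
  · refine (measureReal_mono fun X hX => ?_).trans
      ((hR.sampleLaw_ne_zero_le hη hC200 hδ hδ2 hD hm hn hij htests h).trans hle)
    have : σ X 0 = 1 := by simpa using hX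
    simp [this]
  · refine (measureReal_mono fun X hX => ?_).trans
      ((hR.sampleLaw_ne_one_le hη hC200 hδ hδ2 hD hm hn hij htests h).trans hle)
    simpa using hX

/-- The structure recovery program, for every sufficiently large constant. -/
theorem exists_recovery_program : ∃ C₀ : ℕ, ∀ C, C₀ ≤ C → ∃ P : RAM.Program,
    ∀ (lam₁ lam₂ η δ : ℝ), 0 < η → 0 < δ →
      ∀ (D n m : ℕ), 0 < n → D = degree C lam₁ lam₂ η →
        sampleBound C D n lam₂ δ ≤ m →
        ∃ adj : (Fin m → Fin n → Bool) → Fin n → Fin n → Bool,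
          (∀ x, RAM.HaltsWithin P (recoveryInput D lam₁ lam₂ η x)
            (timeBound C D n (recoveryInput D lam₁ lam₂ η x))
            fun σ => ∀ i j : Fin n, σ (n * i + j) = if adj x i j then 1 else 0) ∧
          ∀ (k : ℕ) (R : RBM n k), R.IsBounded lam₁ lam₂ →
            (∀ i j, i ≠ j → R.TwoHopNeighbors i j → R.Nondegenerate η i j) →
            1 - δ ≤ (R.sampleLaw m).real
              {x | ∀ i j, i ≠ j → (adj x i j = true ↔ R.TwoHopNeighbors i j)} := by
  obtain ⟨C₀, hC₀⟩ := exists_recovery_halts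
  refine ⟨max 200 C₀, fun C hC => ⟨recoveryProgram, ?_⟩⟩
  intro lam₁ lam₂ η δ hη hδ D n m hn hD hm
  have hC200 : 200 ≤ C := (le_max_left _ _).trans hC
  have hD1 : 1 ≤ D := hD ▸ one_le_degree hC200 lam₁ lam₂ η
  have hrun := fun X : Fin m → Fin n → Bool =>
    hC₀ n m D ⌈lam₁⌉₊ ⌈lam₂⌉₊ ⌈1 / η⌉₊ (encodeSamples X) hn hD1
      (length_encodeSamples X) (eq_of_mem_encodeSamples X) (recoveryInput D lam₁ lam₂ η X) rfl
  choose t σ ht hex hout using hrun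
  have htests : ∀ i j : Fin n, i ≠ j → 2 ≤ n ∧ TestsWith D ⌈1 / η⌉₊ (⌈lam₂⌉₊ + 2) i j
      (fun X => recoveryData n m D ⌈lam₂⌉₊ ⌈1 / η⌉₊ i j (recoveryInput D lam₁ lam₂ η X))
      fun X => σ X (n * i + j) := by
    intro i j hij
    have hn2 : 2 ≤ n := by
      by_contra hc
      exact hij (Fin.ext (by omega))
    have hmv : ∀ X : Fin m → Fin n → Bool, _ := fun X =>
      RAM.TestData.matches_and_valid (X := X) (i := i) (j := j)
        (I := Function.update (initial (recoveryInput D lam₁ lam₂ η X)) 3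
          (8 + (n * m + n * n) : ℕ))
        (P := 8 + (n * m + n * n)) (D := D) (st := 6) (L := 8 * (⌈lam₂⌉₊ + 2)) (e := ⌈1 / η⌉₊)
        (N := inputSize (recoveryInput D lam₁ lam₂ η X)) hn2 hD1
        (le_trans (by simp [recoveryInput, length_encodeSamples, encodeParameters]; omega)
          (length_le_inputSize _))
        (le_trans (by simp [recoveryInput, encodeParameters]) (length_le_inputSize _))
        (fun t _ => by
          rw [Function.update_of_ne (by omega), initial, recoveryInput,
            List.getD_append_right _ _ _ _ (by simp [encodeParameters])]
          simp [encodeParameters]) (by omega)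
    exact ⟨hn2, fun _ => rfl, fun _ => rfl, fun _ => rfl, fun X => (hmv X).1, fun X => (hmv X).2,
      fun X => (hout X i i.2 j j.2).2 (Fin.val_ne_of_ne hij)⟩
  refine ⟨fun X i j => decide (σ X (n * i + j) = 1), fun X => ⟨t X, σ X, (ht X).trans
    (timeBound_mono ((le_max_right _ _).trans hC) hn (by simp [recoveryInput])), hex X,
    fun i j => ?_⟩, fun k R hR hnd => ?_⟩
  · have h := hout X i i.2 j j.2
    by_cases hij : (i : ℕ) = j
    · simp [h.1 hij]
    · rcases (h.2 hij).zero_or_one with h | h <;> simp [h]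
  rcases le_or_gt 2 δ with hδ2 | hδ2
  · linarith [measureReal_nonneg (μ := R.sampleLaw m)
      (s := {x | ∀ i j : Fin n, i ≠ j →
        (decide (σ x (n * i + j) = 1) = true ↔ R.TwoHopNeighbors i j)})]
  set G := {x | ∀ i j : Fin n, i ≠ j →
    (decide (σ x (n * i + j) = 1) = true ↔ R.TwoHopNeighbors i j)} with hG
  let B : Fin n × Fin n → Set (Fin m → Fin n → Bool) := fun p =>
    {X | p.1 ≠ p.2 ∧ ¬ (σ X (n * p.1 + p.2) = 1 ↔ R.TwoHopNeighbors p.1 p.2)}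
  have hB : ∀ p, (R.sampleLaw m).real (B p) ≤ δ / (2 * n ^ 2) := by
    rintro ⟨i, j⟩
    by_cases hij : i = j
    · have : B (i, j) = ∅ := Set.eq_empty_iff_forall_notMem.mpr fun X hX => hX.1 hij
      rw [this, measureReal_empty]
      positivity
    obtain ⟨hn2, htest⟩ := htests i j hij
    by_cases h : R.TwoHopNeighbors i j
    · refine (measureReal_mono fun X hX => ?_).trans
        (hR.sampleLaw_ne_one_le hη hC200 hδ hδ2 hD hm hn2 hij htest (hnd i j hij h))
      exact fun hv => hX.2 ⟨fun _ => h, fun _ => hv⟩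
    · refine (measureReal_mono fun X hX => ?_).trans
        (hR.sampleLaw_ne_zero_le hη hC200 hδ hδ2 hD hm hn2 hij htest h)
      intro hv
      refine hX.2 ⟨fun h1 => ?_, fun h1 => absurd h1 h⟩
      rw [hv] at h1
      exact absurd h1 (by norm_num)
  have hsub : Gᶜ ⊆ ⋃ p, B p := by
    intro X hX
    simp only [hG, Set.mem_compl_iff, Set.mem_ofPred_eq, not_forall, decide_eq_true_eq] at hX
    obtain ⟨i, j, hij, h⟩ := hX
    exact Set.mem_iUnion.mpr ⟨(i, j), hij, h⟩
  have hGc : (R.sampleLaw m).real Gᶜ ≤ δ / 2 := by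
    refine (measureReal_mono hsub).trans ((measureReal_iUnion_fintype_le B).trans
      ((Finset.sum_le_sum fun p _ => hB p).trans_eq ?_))
    have hn0 : (0 : ℝ) < n := by exact_mod_cast hn
    simp only [Finset.sum_const, Finset.card_univ, Fintype.card_prod, Fintype.card_fin,
      nsmul_eq_mul]
    push_cast
    field_simp
  have h1 : 1 ≤ (R.sampleLaw m).real G + (R.sampleLaw m).real Gᶜ := by
    refine le_trans ?_ (measureReal_union_le G Gᶜ)
    rw [Set.union_compl_self, probReal_univ]
  linarith

theorem mainTheorem4 :
    ∃ C : ℕ,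
      -- testing a single pair; the output `1` in cell `0` rejects the null hypothesis
      (∃ P : RAM.Program, ∀ (lam₁ lam₂ η δ : ℝ), 0 < η → 0 < δ →
        ∀ (D n m : ℕ) (i j : Fin n), i ≠ j → D = degree C lam₁ lam₂ η →
          sampleBound C D n lam₂ δ ≤ m →
          ∃ rejects : (Fin m → Fin n → Bool) → Bool,
            (∀ x, RAM.HaltsWithin P (testInput D lam₁ lam₂ η i j x)
              (timeBound C D n (testInput D lam₁ lam₂ η i j x))
              fun σ => σ 0 = if rejects x then 1 else 0) ∧
            ∃ α β : ℝ, 0 ≤ α ∧ 0 ≤ β ∧ α + β ≤ δ ∧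
              (∀ (k : ℕ) (R : RBM n k), R.IsBounded lam₁ lam₂ → ¬ R.TwoHopNeighbors i j →
                (R.sampleLaw m).real {x | rejects x = true} ≤ α) ∧
              (∀ (k : ℕ) (R : RBM n k), R.IsBounded lam₁ lam₂ → R.Nondegenerate η i j →
                (R.sampleLaw m).real {x | rejects x = false} ≤ β)) ∧
      -- structure recovery; the output is the adjacency matrix, in the first `n ^ 2` cells
      (∃ P : RAM.Program, ∀ (lam₁ lam₂ η δ : ℝ), 0 < η → 0 < δ →
        ∀ (D n m : ℕ), 0 < n → D = degree C lam₁ lam₂ η →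
          sampleBound C D n lam₂ δ ≤ m →
          ∃ adj : (Fin m → Fin n → Bool) → Fin n → Fin n → Bool,
            (∀ x, RAM.HaltsWithin P (recoveryInput D lam₁ lam₂ η x)
              (timeBound C D n (recoveryInput D lam₁ lam₂ η x))
              fun σ => ∀ i j : Fin n, σ (n * i + j) = if adj x i j then 1 else 0) ∧
            ∀ (k : ℕ) (R : RBM n k), R.IsBounded lam₁ lam₂ →
              (∀ i j, i ≠ j → R.TwoHopNeighbors i j → R.Nondegenerate η i j) →
              1 - δ ≤ (R.sampleLaw m).real
                {x | ∀ i j, i ≠ j → (adj x i j = true ↔ R.TwoHopNeighbors i j)}) := by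
  obtain ⟨C₁, h₁⟩ := exists_test_program
  obtain ⟨C₂, h₂⟩ := exists_recovery_program
  exact ⟨max C₁ C₂, h₁ _ (le_max_left _ _), h₂ _ (le_max_right _ _)⟩
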